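/- Let $\Bbbk$ be an algebraically closed field of characteristic $0$, and let $A$, $B$ be finite-dimensional Hopf algebras over $\Bbbk$. Write $\mathrm{Rep}(A)$ for the tensor category of finite-dimensional left $A$-modules, and $A^{\rm cop}$ for $A$ with the opposite comultiplication. Let $\pi_A(x\otimes y)=\epsilon(y)x$ and $\pi_B(x\otimes y)=\epsilon(x)y$ be the canonical maps from $A^{\rm cop}\otimes B$ to $A$ and to $B$. Let $K$, $S$ be finite-dimensional left $A^{\rm cop}\otimes B$-comodule algebras, with coactions written $s\mapsto s_{-1}\otimes s_0$, that are right $A^{\rm cop}\otimes B$-simple, i.e. have no non-trivial right ideal that is stable under the coaction. All modules and bimodules below are finite-dimensional. *The categories of modules.* The category ${}_S\mathcal M$ of left $S$-modules is a left $\mathrm{Rep}(B)$-module category and a right $\mathrm{Rep}(A)$-module category, with $X\overline\otimes M=X\otimes_\Bbbk M$ and $M\overline\otimes Y=Y\otimes_\Bbbk M$ for $X\in\mathrm{Rep}(B)$, $Y\in\mathrm{Rep}(A)$, where $$s\cdot(x\otimes m)=\pi_B(s_{-1})x\otimes s_0m,\qquad s\cdot(y\otimes m)=\pi_A(s_{-1})y\otimes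 s_0m,$$ and with $X\overline\otimes(M\overline\otimes Y)\cong(X\overline\otimes M)\overline\otimes Y$ given by exchanging the factors. The same applies to ${}_K\mathcal M$. *The functor category.* $\mathrm{Fun}_{\mathrm{Rep}(B)}({}_S\mathcal M,{}_K\mathcal M)$ is the category of right exact $\Bbbk$-linear $\mathrm{Rep}(B)$-module functors $F:{}_S\mathcal M\to{}_K\mathcal M$ and module natural transformations. It is a $\mathrm{Rep}(A)$-bimodule category by $$(X\overline\otimes F)(M)=F(M\overline\otimes X),\qquad (F\overline\otimes Y)(M)=F(M)\overline\otimes Y.$$ *The category $\mathcal M(A,B,K,S)$.* Let ${}^B_K\mathcal M_S$ be the category of $(K,S)$-bimodules $P$ with a left $B$-comodule structure $p\mapsto p_{-1}\otimes p_0$ satisfying $$(r\cdot p\cdot s)_{-1}\otimes(r\cdot p\cdot s)_0=\pi_B(r_{-1})p_{-1}\pi_B(s_{-1})\otimes r_0\cdot p_0\cdot s_0 ,$$ the morphisms being the $B$-colinear bimodule maps. Let $\mathcal M(A,B,K,S)$ be this category with the following $\mathrm{Rep}(A)$-bimodule category structure. * $X\overline\otimes^l P=P\otimes_S(X\otimes_\Bbbk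 S)$, where $s\cdot(x\otimes t)=\pi_A(s_{-1})x\otimes s_0t$, the bimodule structure is $r\cdot(p\otimes x\otimes t)\cdot s=r\cdot p\otimes x\otimes ts$ and the coaction is $p\otimes x\otimes s\mapsto p_{-1}\pi_B(s_{-1})\otimes p_0\otimes x\otimes s_0$. * $P\overline\otimes^r Y=Y\otimes_\Bbbk P$, where $r\cdot(y\otimes p)\cdot s=\pi_A(r_{-1})y\otimes r_0\cdot p\cdot s$ and the coaction is $y\otimes p\mapsto p_{-1}\otimes y\otimes p_0$. * The associativity isomorphisms are $p\otimes(x\otimes y)\otimes s\mapsto(p\otimes y\otimes1)\otimes x\otimes s$ for the left action and $(x\otimes y)\otimes p\mapsto y\otimes x\otimes p$ for the right action. The isomorphism $(X\overline\otimes^lP)\overline\otimes^rY\cong X\overline\otimes^l(P\overline\otimes^rY)$ is $y\otimes(p\otimes x\otimes s)\mapsto(y\otimes p)\otimes x\otimes s$. The unit isomorphisms are $p\otimes 1\otimes s\mapsto p\cdot s$ and $1\otimes p\mapsto p$. **Theorem.** (i) For every $P\in{}^B_K\mathcal M_S$, the functor $N\mapsto P\otimes_SN$, with the maps $P\otimes_S(X\otimes_\Bbbk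 N)\to X\otimes_\Bbbk(P\otimes_SN)$, $p\otimes(x\otimes n)\mapsto p_{-1}x\otimes(p_0\otimes n)$, is a right exact $\mathrm{Rep}(B)$-module functor ${}_S\mathcal M\to{}_K\mathcal M$. The functor $$\Phi:\ \mathcal M(A,B,K,S)\longrightarrow\mathrm{Fun}_{\mathrm{Rep}(B)}({}_S\mathcal M,{}_K\mathcal M),\qquad\Phi(P)(N)=P\otimes_SN,$$ underlies an equivalence of $\mathrm{Rep}(A)$-bimodule categories: there are $\Bbbk$-linear $\mathrm{Rep}(A)$-bimodule functors in both directions, the one from left to right with underlying functor $\Phi$, whose composites are isomorphic to the identity functors through natural isomorphisms compatible with the left and the right module structures. (ii) If ${}_S\mathcal M$ is an exact $\mathrm{Rep}(B)$-module category, i.e. if $X\overline\otimes M$ is projective for every projective $X\in\mathrm{Rep}(B)$ and every $M\in{}_S\mathcal M$, then every $\Bbbk$-linear $\mathrm{Rep}(B)$-module functor ${}_S\mathcal M\to{}_K\mathcal M$ is right exact, so that in (i) $\mathrm{Fun}_{\mathrm{Rep}(B)}({}_S\mathcal M,{}_K\mathcal M)$ is the category of all $\Bbbk$-linear $\mathrm{Rep}(B)$-module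 functors. -/

import Mathlib

set_option linter.unusedVariables false
set_option linter.unusedSimpArgs false

universe u

open CategoryTheory MonoidalCategory TensorProduct
open scoped MonoidalLeftAction MonoidalRightAction

noncomputable section

namespace HopfBimod

section Raw

variable {k : Type u} [Field k]
  {S T U H H' H'' : Type u} [Ring S] [Algebra k S] [Ring T] [Algebra k T] [Ring U]
  [Algebra k U] [Ring H] [Algebra k H] [Ring H'] [Algebra k H'] [Ring H''] [Algebra k H'']
  {V W Z V' W' : Type u} [AddCommGroup V] [Module k V] [AddCommGroup W] [Module k W]
  [AddCommGroup Z] [Module k Z] [AddCommGroup V'] [Module k V'] [AddCommGroup W'] [Module k W']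

/-- The `k`-linear map `H ⊗ T → End (V ⊗ W)` given by linear maps `H → End V`, `T → End W`. -/
def tact (a : H →ₗ[k] Module.End k V) (b : T →ₗ[k] Module.End k W) :
    H ⊗[k] T →ₗ[k] Module.End k (V ⊗[k] W) :=
  TensorProduct.homTensorHomMap (RingHom.id k) V W V W ∘ₗ TensorProduct.map a b

@[simp] lemma tact_tmul (a : H →ₗ[k] Module.End k V) (b : T →ₗ[k] Module.End k W) (h : H)
    (t : T) (v : V) (w : W) : tact a b (h ⊗ₜ t) (v ⊗ₜ w) = a h v ⊗ₜ b t w := rfl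

/-- For an algebra map `f : S → H ⊗ T`, an `H`-module `V` and a `T`-module `W`, the action
of `S` on `V ⊗ W` through `f`. -/
def trep (f : S →ₐ[k] H ⊗[k] T) (a : H →ₐ[k] Module.End k V) (b : T →ₐ[k] Module.End k W) :
    S →ₐ[k] Module.End k (V ⊗[k] W) :=
  (Module.endTensorEndAlgHom (R := k) (S := k) (A := k)).comp
    ((Algebra.TensorProduct.map a b).comp f)

lemma trep_apply (f : S →ₐ[k] H ⊗[k] T) (a : H →ₐ[k] Module.End k V)
    (b : T →ₐ[k] Module.End k W) (s : S) :
    trep f a b s = tact a.toLinearMap b.toLinearMap (f s) := rfl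

lemma trep_map (f : S →ₐ[k] H ⊗[k] T) (a : H →ₐ[k] Module.End k V)
    (b : T →ₐ[k] Module.End k W) (a' : H →ₐ[k] Module.End k V') (b' : T →ₐ[k] Module.End k W')
    (φ : V →ₗ[k] V') (ψ : W →ₗ[k] W') (hφ : ∀ h v, φ (a h v) = a' h (φ v))
    (hψ : ∀ t w, ψ (b t w) = b' t (ψ w)) (s : S) (x : V ⊗[k] W) :
    TensorProduct.map φ ψ (trep f a b s x) = trep f a' b' s (TensorProduct.map φ ψ x) := by
  rw [trep_apply, trep_apply]
  induction f s with
  | zero => simp only [LinearMap.map_zero, LinearEquiv.map_zero, LinearMap.zero_apply,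
      TensorProduct.zero_tmul, TensorProduct.tmul_zero, smul_zero]
  | add w w' h h' => simp only [LinearMap.map_add, LinearEquiv.map_add, LinearMap.add_apply, h, h']
  | tmul h t =>
    induction x with
    | zero => simp only [LinearMap.map_zero, LinearEquiv.map_zero, LinearMap.zero_apply,
        TensorProduct.zero_tmul, TensorProduct.tmul_zero, smul_zero]
    | add v v' h h' => simp only [LinearMap.map_add, LinearEquiv.map_add, h, h']
    | tmul x m => simp [hφ, hψ]

lemma trep_assoc (f : S →ₐ[k] H ⊗[k] T) (g : T →ₐ[k] H' ⊗[k] U) (f' : S →ₐ[k] H'' ⊗[k] U)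
    (d : H'' →ₐ[k] H ⊗[k] H')
    (hfg : ∀ s, TensorProduct.assoc k H H' U (TensorProduct.map d.toLinearMap .id (f' s)) =
      TensorProduct.map .id g.toLinearMap (f s))
    (a : H →ₐ[k] Module.End k V) (b : H' →ₐ[k] Module.End k W) (c : U →ₐ[k] Module.End k Z)
    (s : S) (v : (V ⊗[k] W) ⊗[k] Z) :
    TensorProduct.assoc k V W Z (trep f' (trep d a b) c s v) =
      trep f a (trep g b c) s (TensorProduct.assoc k V W Z v) := by
  have h1 : ∀ (w : H ⊗[k] T), tact a.toLinearMap (trep g b c).toLinearMap w =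
      tact a.toLinearMap (tact b.toLinearMap c.toLinearMap)
        (TensorProduct.map .id g.toLinearMap w) := by
    intro w
    induction w with
    | zero => simp only [LinearMap.map_zero, LinearEquiv.map_zero, LinearMap.zero_apply,
        TensorProduct.zero_tmul, TensorProduct.tmul_zero, smul_zero]
    | add w w' h h' => simp only [LinearMap.map_add, LinearEquiv.map_add, h, h']
    | tmul h t => rfl
  rw [trep_apply, trep_apply, h1, ← hfg]
  induction f' s with
  | zero => simp only [LinearMap.map_zero, LinearEquiv.map_zero, LinearMap.zero_apply,
      TensorProduct.zero_tmul, TensorProduct.tmul_zero, smul_zero]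
  | add w w' h h' => simp only [LinearMap.map_add, LinearEquiv.map_add, LinearMap.add_apply, h, h']
  | tmul h t =>
    induction v with
    | zero => simp only [LinearMap.map_zero, LinearEquiv.map_zero, LinearMap.zero_apply,
        TensorProduct.zero_tmul, TensorProduct.tmul_zero, smul_zero]
    | add v v' h h' => simp only [LinearMap.map_add, LinearEquiv.map_add, h, h']
    | tmul v m =>
      simp only [TensorProduct.map_tmul, AlgHom.toLinearMap_apply, LinearMap.id_apply,
        tact_tmul, trep_apply]
      induction d h with
      | zero => simp only [LinearMap.map_zero, LinearEquiv.map_zero, LinearMap.zero_apply,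
          TensorProduct.zero_tmul, TensorProduct.tmul_zero, smul_zero]
      | add z z' h h' => simp only [LinearMap.map_add, LinearEquiv.map_add, LinearMap.add_apply, TensorProduct.add_tmul, h, h']
      | tmul p q =>
        induction v with
        | zero => simp only [LinearMap.map_zero, LinearEquiv.map_zero, LinearMap.zero_apply,
            TensorProduct.zero_tmul, TensorProduct.tmul_zero, smul_zero]
        | add v v' h h' => simp only [LinearMap.map_add, LinearEquiv.map_add, TensorProduct.add_tmul, h, h']
        | tmul x y => rfl

lemma trep_leftComm (f : S →ₐ[k] H ⊗[k] T) (g : T →ₐ[k] H' ⊗[k] U)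
    (f' : S →ₐ[k] H' ⊗[k] H'') (g' : H'' →ₐ[k] H ⊗[k] U)
    (hfg : ∀ s, TensorProduct.leftComm k H H' U (TensorProduct.map .id g.toLinearMap (f s)) =
      TensorProduct.map .id g'.toLinearMap (f' s))
    (a : H →ₐ[k] Module.End k V) (b : H' →ₐ[k] Module.End k W) (c : U →ₐ[k] Module.End k Z)
    (s : S) (v : V ⊗[k] (W ⊗[k] Z)) :
    TensorProduct.leftComm k V W Z (trep f a (trep g b c) s v) =
      trep f' b (trep g' a c) s (TensorProduct.leftComm k V W Z v) := by
  have h1 : ∀ (w : H' ⊗[k] H''), tact b.toLinearMap (trep g' a c).toLinearMap w =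
      tact b.toLinearMap (tact a.toLinearMap c.toLinearMap)
        (TensorProduct.map .id g'.toLinearMap w) := by
    intro w
    induction w with
    | zero => simp only [LinearMap.map_zero, LinearEquiv.map_zero, LinearMap.zero_apply,
        TensorProduct.zero_tmul, TensorProduct.tmul_zero, smul_zero]
    | add w w' h h' => simp only [LinearMap.map_add, LinearEquiv.map_add, h, h']
    | tmul h t => rfl
  rw [trep_apply, trep_apply, h1, ← hfg]
  induction f s with
  | zero => simp only [LinearMap.map_zero, LinearEquiv.map_zero, LinearMap.zero_apply,
      TensorProduct.zero_tmul, TensorProduct.tmul_zero, smul_zero]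
  | add w w' h h' => simp only [LinearMap.map_add, LinearEquiv.map_add, LinearMap.add_apply, h, h']
  | tmul h t =>
    induction v with
    | zero => simp only [LinearMap.map_zero, LinearEquiv.map_zero, LinearMap.zero_apply,
        TensorProduct.zero_tmul, TensorProduct.tmul_zero, smul_zero]
    | add v v' h h' => simp only [LinearMap.map_add, LinearEquiv.map_add, h, h']
    | tmul x v =>
      simp only [TensorProduct.map_tmul, AlgHom.toLinearMap_apply, LinearMap.id_apply,
        tact_tmul, trep_apply]
      induction g t with
      | zero => simp only [LinearMap.map_zero, LinearEquiv.map_zero, LinearMap.zero_apply,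
          TensorProduct.zero_tmul, TensorProduct.tmul_zero, smul_zero]
      | add z z' h h' => simp only [LinearMap.map_add, LinearEquiv.map_add, LinearMap.add_apply, TensorProduct.tmul_add, h, h']
      | tmul p q =>
        induction v with
        | zero => simp only [LinearMap.map_zero, LinearEquiv.map_zero, LinearMap.zero_apply,
            TensorProduct.zero_tmul, TensorProduct.tmul_zero, smul_zero]
        | add v v' h h' => simp only [LinearMap.map_add, LinearEquiv.map_add, TensorProduct.tmul_add, h, h']
        | tmul x y => rfl

/-- The action of `H` on `k` through a character. -/
def crep (e : H →ₐ[k] k) : H →ₐ[k] Module.End k k := (Algebra.ofId k (Module.End k k)).comp e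

@[simp] lemma crep_apply (e : H →ₐ[k] k) (h : H) (c : k) : crep e h c = e h * c := rfl

lemma trep_lid (f : S →ₐ[k] H ⊗[k] S) (e : H →ₐ[k] k)
    (hf : ∀ s, TensorProduct.lid k S (TensorProduct.map e.toLinearMap .id (f s)) = s)
    (b : S →ₐ[k] Module.End k V) (s : S) (v : k ⊗[k] V) :
    TensorProduct.lid k V (trep f (crep e) b s v) = b s (TensorProduct.lid k V v) := by
  conv_rhs => rw [← hf s]
  rw [trep_apply]
  induction f s with
  | zero => simp
  | add w w' h h' => simp only [map_add, LinearMap.add_apply, h, h']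
  | tmul h t =>
    induction v with
    | zero => simp only [LinearMap.map_zero, LinearEquiv.map_zero, LinearMap.zero_apply,
        TensorProduct.zero_tmul, TensorProduct.tmul_zero, smul_zero]
    | add v v' h h' => simp only [LinearMap.map_add, LinearEquiv.map_add, h, h']
    | tmul c m => simp [smul_smul, mul_comm]

lemma trep_rid (f : S →ₐ[k] S ⊗[k] H) (e : H →ₐ[k] k)
    (hf : ∀ s, TensorProduct.rid k S (TensorProduct.map .id e.toLinearMap (f s)) = s)
    (b : S →ₐ[k] Module.End k V) (s : S) (v : V ⊗[k] k) :
    TensorProduct.rid k V (trep f b (crep e) s v) = b s (TensorProduct.rid k V v) := by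
  conv_rhs => rw [← hf s]
  rw [trep_apply]
  induction f s with
  | zero => simp
  | add w w' h h' => simp only [map_add, LinearMap.add_apply, h, h']
  | tmul t h =>
    induction v with
    | zero => simp only [LinearMap.map_zero, LinearEquiv.map_zero, LinearMap.zero_apply,
        TensorProduct.zero_tmul, TensorProduct.tmul_zero, smul_zero]
    | add v v' h h' => simp only [LinearMap.map_add, LinearEquiv.map_add, h, h']
    | tmul m c => simp [smul_smul, mul_comm]

lemma trep_comm (f : S →ₐ[k] H ⊗[k] T) (g : S →ₐ[k] T ⊗[k] H)
    (hf : ∀ s, TensorProduct.comm k H T (f s) = g s)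
    (a : H →ₐ[k] Module.End k V) (b : T →ₐ[k] Module.End k W) (s : S) (v : V ⊗[k] W) :
    TensorProduct.comm k V W (trep f a b s v) = trep g b a s (TensorProduct.comm k V W v) := by
  rw [trep_apply, trep_apply, ← hf]
  induction f s with
  | zero => simp only [LinearMap.map_zero, LinearEquiv.map_zero, LinearMap.zero_apply,
      TensorProduct.zero_tmul, TensorProduct.tmul_zero, smul_zero]
  | add w w' h h' => simp only [LinearMap.map_add, LinearEquiv.map_add, LinearMap.add_apply, h, h']
  | tmul t h =>
    induction v with
    | zero => simp only [LinearMap.map_zero, LinearEquiv.map_zero, LinearMap.zero_apply,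
        TensorProduct.zero_tmul, TensorProduct.tmul_zero, smul_zero]
    | add v v' h h' => simp only [LinearMap.map_add, LinearEquiv.map_add, h, h']
    | tmul m c => simp

lemma traw_pentagon (X₁ X₂ X₃ X₄ : Type u) [AddCommGroup X₁] [Module k X₁] [AddCommGroup X₂]
    [Module k X₂] [AddCommGroup X₃] [Module k X₃] [AddCommGroup X₄] [Module k X₄] :
    (TensorProduct.map LinearMap.id (TensorProduct.assoc k X₂ X₃ X₄).toLinearMap ∘ₗ
      (TensorProduct.assoc k X₁ (X₂ ⊗[k] X₃) X₄).toLinearMap) ∘ₗ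
        TensorProduct.map (TensorProduct.assoc k X₁ X₂ X₃).toLinearMap LinearMap.id =
    (TensorProduct.assoc k X₁ X₂ (X₃ ⊗[k] X₄)).toLinearMap ∘ₗ
      (TensorProduct.assoc k (X₁ ⊗[k] X₂) X₃ X₄).toLinearMap :=
  TensorProduct.ext_fourfold fun _ _ _ _ => rfl

end Raw

section FDMod

variable {k : Type u} [Field k]

/-- A finite-dimensional left module over the `k`-algebra `S`, given as a finite-dimensional
vector space together with an algebra map `ρ` from `S` to its endomorphisms: `ρ s m` is `s · m`. -/
structure FDMod (k : Type u) [Field k] (S : Type u) [Ring S] [Algebra k S] where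
  carrier : Type u
  [addCommGroup : AddCommGroup carrier]
  [module : Module k carrier]
  [finite : FiniteDimensional k carrier]
  ρ : S →ₐ[k] Module.End k carrier

attribute [instance] FDMod.addCommGroup FDMod.module FDMod.finite

namespace FDMod

variable {S T U H H' H'' : Type u} [Ring S] [Algebra k S] [Ring T] [Algebra k T] [Ring U]
  [Algebra k U] [Ring H] [Algebra k H] [Ring H'] [Algebra k H'] [Ring H''] [Algebra k H'']

/-- The space of `S`-linear maps. -/
def homs (M N : FDMod k S) : Submodule k (M.carrier →ₗ[k] N.carrier) where
  carrier := {f | ∀ s m, f (M.ρ s m) = N.ρ s (f m)}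
  add_mem' {f g} hf hg s m := by
    have h1 := hf s m
    have h2 := hg s m
    simp [h1, h2]
  zero_mem' s m := by simp
  smul_mem' c f hf s m := by
    have h1 := hf s m
    simp [h1]

instance : Category (FDMod k S) where
  Hom M N := homs M N
  id M := ⟨LinearMap.id, fun _ _ => rfl⟩
  comp f g := ⟨g.1 ∘ₗ f.1, fun s m => by simp [f.2 s m, g.2 s]⟩

/-- The linear map underlying a morphism. -/
def lin {M N : FDMod k S} (f : M ⟶ N) : M.carrier →ₗ[k] N.carrier := f.1

/-- A morphism from an `S`-linear map. -/
def mk' {M N : FDMod k S} (f : M.carrier →ₗ[k] N.carrier)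
    (hf : ∀ s m, f (M.ρ s m) = N.ρ s (f m)) : M ⟶ N := ⟨f, hf⟩

@[simp] lemma lin_mk' {M N : FDMod k S} (f : M.carrier →ₗ[k] N.carrier) (hf) :
    lin (mk' f hf : M ⟶ N) = f := rfl

@[simp] lemma lin_id (M : FDMod k S) : lin (𝟙 M) = LinearMap.id := rfl

@[simp] lemma lin_comp {M N P : FDMod k S} (f : M ⟶ N) (g : N ⟶ P) :
    lin (f ≫ g) = lin g ∘ₗ lin f := rfl

lemma hom_ext {M N : FDMod k S} {f g : M ⟶ N} (h : lin f = lin g) : f = g := Subtype.ext h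

lemma lin_ρ {M N : FDMod k S} (f : M ⟶ N) (s : S) (m : M.carrier) :
    lin f (M.ρ s m) = N.ρ s (lin f m) := f.2 s m

instance : Preadditive (FDMod k S) where
  homGroup M N := inferInstanceAs (AddCommGroup (homs M N))
  add_comp M N P f f' g := Subtype.ext (LinearMap.ext fun m => map_add g.1 (f.1 m) (f'.1 m))
  comp_add M N P f g g' := Subtype.ext (LinearMap.ext fun m => rfl)

instance : Linear k (FDMod k S) where
  homModule M N := inferInstanceAs (Module k (homs M N))
  smul_comp M N P c f g := Subtype.ext (LinearMap.ext fun m => map_smul g.1 c (f.1 m))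
  comp_smul M N P f c g := Subtype.ext (LinearMap.ext fun m => rfl)

@[simp] lemma lin_add {M N : FDMod k S} (f g : M ⟶ N) : lin (f + g) = lin f + lin g := rfl

@[simp] lemma lin_smul {M N : FDMod k S} (c : k) (f : M ⟶ N) : lin (c • f) = c • lin f := rfl

/-- An isomorphism from an `S`-linear equivalence. -/
def isoMk {M N : FDMod k S} (e : M.carrier ≃ₗ[k] N.carrier)
    (he : ∀ s m, e (M.ρ s m) = N.ρ s (e m)) : M ≅ N where
  hom := mk' e.toLinearMap he
  inv := mk' e.symm.toLinearMap fun s m => e.injective (by simp [he])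
  hom_inv_id := hom_ext (by ext; simp)
  inv_hom_id := hom_ext (by ext; simp)

@[simp] lemma lin_isoMk_hom {M N : FDMod k S} (e : M.carrier ≃ₗ[k] N.carrier) (he) :
    lin (isoMk e he : M ≅ N).hom = e.toLinearMap := rfl

@[simp] lemma lin_isoMk_inv {M N : FDMod k S} (e : M.carrier ≃ₗ[k] N.carrier) (he) :
    lin (isoMk e he : M ≅ N).inv = e.symm.toLinearMap := rfl

/-- For an algebra map `f : S → H ⊗ T`, an `H`-module `X` and a `T`-module `M`, the vector space
`X ⊗ M` with the `S`-module structure given by `f`. -/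
abbrev tens (f : S →ₐ[k] H ⊗[k] T) (X : FDMod k H) (M : FDMod k T) : FDMod k S where
  carrier := X.carrier ⊗[k] M.carrier
  ρ := trep f X.ρ M.ρ

/-- The functoriality of `tens`. -/
abbrev tensMap (f : S →ₐ[k] H ⊗[k] T) {X X' : FDMod k H} {M M' : FDMod k T} (a : X ⟶ X')
    (b : M ⟶ M') : tens f X M ⟶ tens f X' M' :=
  mk' (TensorProduct.map (lin a) (lin b))
    (trep_map f X.ρ M.ρ X'.ρ M'.ρ (lin a) (lin b) (lin_ρ a) (lin_ρ b))

/-- The one-dimensional module given by a character. -/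
abbrev char (e : H →ₐ[k] k) : FDMod k H where
  carrier := k
  ρ := crep e

lemma tensMap_id (f : S →ₐ[k] H ⊗[k] T) (X : FDMod k H) (M : FDMod k T) :
    tensMap f (𝟙 X) (𝟙 M) = 𝟙 (tens f X M) := hom_ext TensorProduct.map_id

lemma tensMap_comp (f : S →ₐ[k] H ⊗[k] T) {X X' X'' : FDMod k H} {M M' M'' : FDMod k T}
    (a : X ⟶ X') (b : M ⟶ M') (a' : X' ⟶ X'') (b' : M' ⟶ M'') :
    tensMap f (a ≫ a') (b ≫ b') = tensMap f a b ≫ tensMap f a' b' :=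
  hom_ext (TensorProduct.map_comp (lin a') (lin b') (lin a) (lin b))

section Monoidal

variable {A : Type u} [Ring A] [Bialgebra k A]

variable (A) in
lemma comul_coassoc (s : A) :
    TensorProduct.assoc k A A A (TensorProduct.map (Bialgebra.comulAlgHom k A).toLinearMap .id
      (Bialgebra.comulAlgHom k A s)) =
    TensorProduct.map .id (Bialgebra.comulAlgHom k A).toLinearMap (Bialgebra.comulAlgHom k A s) :=
  Coalgebra.coassoc_apply (R := k) s

variable (A) in
lemma comul_lid (s : A) :
    TensorProduct.lid k A (TensorProduct.map (Bialgebra.counitAlgHom k A).toLinearMap .id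
      (Bialgebra.comulAlgHom k A s)) = s :=
  (congrArg (TensorProduct.lid k A) (Coalgebra.rTensor_counit_comul (R := k) s)).trans
    (by simp)

variable (A) in
lemma comul_rid (s : A) :
    TensorProduct.rid k A (TensorProduct.map .id (Bialgebra.counitAlgHom k A).toLinearMap
      (Bialgebra.comulAlgHom k A s)) = s :=
  (congrArg (TensorProduct.rid k A) (Coalgebra.lTensor_counit_comul (R := k) s)).trans
    (by simp)

/-- The tensor category `Rep(A)` of finite-dimensional left `A`-modules. -/
instance : MonoidalCategory (FDMod k A) where
  tensorObj X Y := tens (Bialgebra.comulAlgHom k A) X Y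
  tensorHom f g := tensMap _ f g
  whiskerLeft X _ _ g := tensMap _ (𝟙 X) g
  whiskerRight f Y := tensMap _ f (𝟙 Y)
  tensorUnit := char (Bialgebra.counitAlgHom k A)
  associator X Y Z := isoMk (TensorProduct.assoc k X.carrier Y.carrier Z.carrier)
    (trep_assoc _ _ _ _ (comul_coassoc A) X.ρ Y.ρ Z.ρ)
  leftUnitor X := isoMk (TensorProduct.lid k X.carrier) (trep_lid _ _ (comul_lid A) X.ρ)
  rightUnitor X := isoMk (TensorProduct.rid k X.carrier) (trep_rid _ _ (comul_rid A) X.ρ)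
  tensorHom_def f g := by
    rw [← tensMap_comp, Category.comp_id, Category.id_comp]
  id_tensorHom_id X Y := tensMap_id _ X Y
  tensorHom_comp_tensorHom f₁ f₂ g₁ g₂ := (tensMap_comp _ f₁ f₂ g₁ g₂).symm
  whiskerLeft_id X Y := tensMap_id _ X Y
  id_whiskerRight X Y := tensMap_id _ X Y
  associator_naturality f g h := hom_ext (TensorProduct.ext_threefold fun _ _ _ => rfl)
  leftUnitor_naturality f := hom_ext (TensorProduct.ext' fun a x =>
    (map_smul (lin f) a x).symm)
  rightUnitor_naturality f := hom_ext (TensorProduct.ext' fun x a =>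
    (map_smul (lin f) a x).symm)
  pentagon W X Y Z := hom_ext (traw_pentagon W.carrier X.carrier Y.carrier Z.carrier)
  triangle X Y := hom_ext (TensorProduct.ext_threefold fun x a y =>
    (TensorProduct.smul_tmul a x y).symm)

end Monoidal

end FDMod

end FDMod

section BimoduleCategory

variable (C D M : Type*) [Category* C] [MonoidalCategory C] [Category* D] [MonoidalCategory D]
  [Category* M]

open MonoidalLeftAction MonoidalRightAction

/-- A `(C, D)`-bimodule category: a category `M` with a left action of `C`, a right action of `D`
and natural isomorphisms `(X ⊙ₗ m) ⊙ᵣ Y ≅ X ⊙ₗ (m ⊙ᵣ Y)` compatible with the associativity and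
unit isomorphisms of both actions. -/
class BimoduleCategory [MonoidalLeftAction C M] [MonoidalRightAction D M] where
  γ (X : C) (m : M) (Y : D) : (X ⊙ₗ m) ⊙ᵣ Y ≅ X ⊙ₗ (m ⊙ᵣ Y)
  γ_naturality {X X' : C} {m m' : M} {Y Y' : D} (f : X ⟶ X') (g : m ⟶ m') (h : Y ⟶ Y') :
    ((f ⊙ₗₘ g) ⊙ᵣₘ h) ≫ (γ X' m' Y').hom = (γ X m Y).hom ≫ (f ⊙ₗₘ (g ⊙ᵣₘ h))
  γ_assoc_left (X X' : C) (m : M) (Y : D) :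
    (γ (X ⊗ X') m Y).hom ≫ (αₗ X X' (m ⊙ᵣ Y)).hom =
      (αₗ X X' m).hom ⊵ᵣ Y ≫ (γ X (X' ⊙ₗ m) Y).hom ≫ X ⊴ₗ (γ X' m Y).hom
  γ_assoc_right (X : C) (m : M) (Y Y' : D) :
    (γ X m (Y ⊗ Y')).hom ≫ X ⊴ₗ (αᵣ m Y Y').hom =
      (αᵣ (X ⊙ₗ m) Y Y').hom ≫ (γ X m Y).hom ⊵ᵣ Y' ≫ (γ X (m ⊙ᵣ Y) Y').hom
  γ_unit_left (m : M) (Y : D) :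
    (γ (𝟙_ C) m Y).hom ≫ (λₗ (m ⊙ᵣ Y)).hom = (λₗ m).hom ⊵ᵣ Y
  γ_unit_right (X : C) (m : M) :
    (γ X m (𝟙_ D)).hom ≫ X ⊴ₗ (ρᵣ m).hom = (ρᵣ (X ⊙ₗ m)).hom

end BimoduleCategory

section Comodule

variable {k : Type u} [Field k]

/-- The co-opposite `A^cop` of a bialgebra `A`: the same algebra with the comultiplication
`a ↦ a₍₂₎ ⊗ a₍₁₎`. -/
def Cop (A : Type u) : Type u := A

namespace Cop

variable (A : Type u) [Ring A] [Bialgebra k A]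

instance : Ring (Cop A) := ‹Ring A›

/-- The comultiplication `a ↦ a₍₂₎ ⊗ a₍₁₎` on `A`. -/
def comulAlgHom : A →ₐ[k] A ⊗[k] A :=
  (Algebra.TensorProduct.comm k A A).toAlgHom.comp (Bialgebra.comulAlgHom k A)

lemma comulAlgHom_apply (a : A) :
    comulAlgHom (k := k) A a = TensorProduct.comm k A A (Coalgebra.comul (R := k) a) := rfl

lemma coassoc (a : A) :
    TensorProduct.assoc k A A A (TensorProduct.map (comulAlgHom A).toLinearMap .id
      (comulAlgHom (k := k) A a)) =
    TensorProduct.map .id (comulAlgHom A).toLinearMap (comulAlgHom (k := k) A a) := by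
  let r : A ⊗[k] (A ⊗[k] A) →ₗ[k] A ⊗[k] (A ⊗[k] A) :=
    (TensorProduct.assoc k A A A).toLinearMap ∘ₗ
      TensorProduct.map (TensorProduct.comm k A A).toLinearMap .id ∘ₗ
        (TensorProduct.comm k A (A ⊗[k] A)).toLinearMap
  have h1 : ∀ w : A ⊗[k] A, TensorProduct.assoc k A A A
      (TensorProduct.map (comulAlgHom A).toLinearMap .id (TensorProduct.comm k A A w)) =
      r (TensorProduct.map .id (Coalgebra.comul (R := k)) w) := by
    intro w
    induction w with
    | zero => simp only [LinearMap.map_zero, LinearEquiv.map_zero, LinearMap.zero_apply,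
        TensorProduct.zero_tmul, TensorProduct.tmul_zero, smul_zero]
    | add x y hx hy => simp only [LinearMap.map_add, LinearEquiv.map_add, hx, hy]
    | tmul x y => rfl
  have h2 : ∀ w : A ⊗[k] A,
      TensorProduct.map .id (comulAlgHom A).toLinearMap (TensorProduct.comm k A A w) =
      r (TensorProduct.assoc k A A A (TensorProduct.map (Coalgebra.comul (R := k)) .id w)) := by
    intro w
    induction w with
    | zero => simp only [LinearMap.map_zero, LinearEquiv.map_zero, LinearMap.zero_apply,
        TensorProduct.zero_tmul, TensorProduct.tmul_zero, smul_zero]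
    | add x y hx hy => simp only [LinearMap.map_add, LinearEquiv.map_add, hx, hy]
    | tmul x y =>
      simp only [TensorProduct.comm_tmul, TensorProduct.map_tmul, LinearMap.id_apply,
        AlgHom.toLinearMap_apply, comulAlgHom_apply]
      induction Coalgebra.comul (R := k) x with
      | zero => simp only [LinearMap.map_zero, LinearEquiv.map_zero, LinearMap.zero_apply,
          TensorProduct.zero_tmul, TensorProduct.tmul_zero, smul_zero]
      | add x y hx hy => simp only [LinearMap.map_add, LinearEquiv.map_add, TensorProduct.tmul_add, TensorProduct.add_tmul, hx, hy]
      | tmul x y => rfl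
  rw [comulAlgHom_apply, h1, h2]
  exact congrArg r (Coalgebra.coassoc_apply (R := k) a).symm

lemma lid (a : A) :
    TensorProduct.lid k A (TensorProduct.map (Bialgebra.counitAlgHom k A).toLinearMap .id
      (comulAlgHom (k := k) A a)) = a := by
  have h : ∀ w : A ⊗[k] A, TensorProduct.lid k A
      (TensorProduct.map (Bialgebra.counitAlgHom k A).toLinearMap .id
        (TensorProduct.comm k A A w)) =
      TensorProduct.rid k A (TensorProduct.map .id (Bialgebra.counitAlgHom k A).toLinearMap w) := by
    intro w
    induction w with
    | zero => simp only [LinearMap.map_zero, LinearEquiv.map_zero, LinearMap.zero_apply,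
        TensorProduct.zero_tmul, TensorProduct.tmul_zero, smul_zero]
    | add x y hx hy => simp only [LinearMap.map_add, LinearEquiv.map_add, hx, hy]
    | tmul x y => simp
  rw [comulAlgHom_apply, h]
  exact FDMod.comul_rid A a

lemma rid (a : A) :
    TensorProduct.rid k A (TensorProduct.map .id (Bialgebra.counitAlgHom k A).toLinearMap
      (comulAlgHom (k := k) A a)) = a := by
  have h : ∀ w : A ⊗[k] A, TensorProduct.rid k A
      (TensorProduct.map .id (Bialgebra.counitAlgHom k A).toLinearMap
        (TensorProduct.comm k A A w)) =
      TensorProduct.lid k A (TensorProduct.map (Bialgebra.counitAlgHom k A).toLinearMap .id w) := by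
    intro w
    induction w with
    | zero => simp only [LinearMap.map_zero, LinearEquiv.map_zero, LinearMap.zero_apply,
        TensorProduct.zero_tmul, TensorProduct.tmul_zero, smul_zero]
    | add x y hx hy => simp only [LinearMap.map_add, LinearEquiv.map_add, hx, hy]
    | tmul x y => simp
  rw [comulAlgHom_apply, h]
  exact FDMod.comul_lid A a

/-- The bialgebra structure of `A^cop`, on the type `A`. -/
abbrev bialgebraAux : Bialgebra k A :=
  Bialgebra.ofAlgHom (comulAlgHom (k := k) A) (Bialgebra.counitAlgHom k A)
    (AlgHom.ext fun a => coassoc A a)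
    (AlgHom.ext fun a => (TensorProduct.lid k A).injective ((lid A a).trans (by simp)))
    (AlgHom.ext fun a => (TensorProduct.rid k A).injective ((rid A a).trans (by simp)))

instance : Bialgebra k (Cop A) := bialgebraAux A

/-- The identity map `A^cop → A`, an isomorphism of algebras. -/
def toA : Cop A →ₐ[k] A := AlgHom.id k A

end Cop

/-- A finite-dimensional left comodule algebra over the bialgebra `H`: an algebra with a coaction
`coact s = s₍₋₁₎ ⊗ s₍₀₎` that is coassociative, counital and an algebra map. -/
structure ComodAlg (k : Type u) [Field k] (H : Type u) [Ring H] [Bialgebra k H] where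
  carrier : Type u
  [ring : Ring carrier]
  [algebra : Algebra k carrier]
  [finite : FiniteDimensional k carrier]
  coact : carrier →ₐ[k] H ⊗[k] carrier
  coassoc (s : carrier) :
    TensorProduct.assoc k H H carrier
      (TensorProduct.map (Coalgebra.comul (R := k)) .id (coact s)) =
    TensorProduct.map .id coact.toLinearMap (coact s)
  counit (s : carrier) :
    TensorProduct.lid k carrier (TensorProduct.map (Coalgebra.counit (R := k)) .id (coact s)) = s

attribute [instance] ComodAlg.ring ComodAlg.algebra ComodAlg.finite

namespace ComodAlg

/-- A left `H`-comodule algebra is right `H`-simple if it has no non-trivial right ideal `I`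
that is `H`-costable, that is, whose image under the coaction lies in `H ⊗ I`. -/
def IsRightSimple {H : Type u} [Ring H] [Bialgebra k H] (S : ComodAlg k H) : Prop :=
  ∀ I : Submodule S.carrierᵐᵒᵖ S.carrier,
    (∀ s ∈ I, S.coact s ∈ LinearMap.range
      (TensorProduct.map (LinearMap.id (R := k) (M := H)) (I.restrictScalars k).subtype)) →
    I = ⊥ ∨ I = ⊤

variable {A B : Type u} [Ring A] [Bialgebra k A] [Ring B] [Bialgebra k B]

variable (k A B) in
/-- The algebra map `π_A : A^cop ⊗ B → A`, `x ⊗ y ↦ ε(y) x`. -/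
def piA : Cop A ⊗[k] B →ₐ[k] A :=
  (Cop.toA A).comp ((Algebra.TensorProduct.rid k k (Cop A)).toAlgHom.comp
    (Algebra.TensorProduct.map (AlgHom.id k (Cop A)) (Bialgebra.counitAlgHom k B)))

variable (k A B) in
/-- The algebra map `π_B : A^cop ⊗ B → B`, `x ⊗ y ↦ ε(x) y`. -/
def piB : Cop A ⊗[k] B →ₐ[k] B :=
  (Algebra.TensorProduct.lid k B).toAlgHom.comp
    (Algebra.TensorProduct.map ((Bialgebra.counitAlgHom k A).comp (Cop.toA A)) (AlgHom.id k B))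

lemma piA_tmul (a : Cop A) (b : B) :
    piA k A B (a ⊗ₜ b) = Coalgebra.counit (R := k) b • Cop.toA (k := k) A a := rfl

lemma piB_tmul (a : Cop A) (b : B) :
    piB k A B (a ⊗ₜ b) = Coalgebra.counit (R := k) (Cop.toA (k := k) A a) • b := rfl

section pi

variable {P Q : Type u} [AddCommGroup P] [Module k P] [AddCommGroup Q] [Module k Q]

lemma map_ttt (p : Cop A ⊗[k] B →ₗ[k] P) (q : Cop A ⊗[k] B →ₗ[k] Q)
    (F : A ⊗[k] A →ₗ[k] B ⊗[k] B →ₗ[k] P ⊗[k] Q)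
    (hF : ∀ (a a' : A) (b b' : B), p ((show Cop A from a) ⊗ₜ b) ⊗ₜ q ((show Cop A from a') ⊗ₜ b') =
      F (a ⊗ₜ a') (b ⊗ₜ b')) (a : Cop A) (b : B) :
    TensorProduct.map p q (Coalgebra.comul (R := k) (a ⊗ₜ[k] b)) =
      F (Cop.comulAlgHom (k := k) A (Cop.toA (k := k) A a)) (Coalgebra.comul (R := k) b) := by
  have h : ∀ (u : Cop A ⊗[k] Cop A) (v : B ⊗[k] B), TensorProduct.map p q
      (TensorProduct.AlgebraTensorModule.tensorTensorTensorComm k k k k (Cop A) (Cop A) B B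
        (u ⊗ₜ v)) = F (TensorProduct.map (Cop.toA A).toLinearMap (Cop.toA A).toLinearMap u) v := by
    intro u v
    induction u with
    | zero => simp only [LinearMap.map_zero, LinearEquiv.map_zero, LinearMap.zero_apply,
        TensorProduct.zero_tmul, TensorProduct.tmul_zero, smul_zero]
    | add x y hx hy => simp only [LinearMap.map_add, LinearEquiv.map_add, TensorProduct.add_tmul, LinearMap.add_apply, hx, hy]
    | tmul x y =>
      induction v with
      | zero => simp only [LinearMap.map_zero, LinearEquiv.map_zero, LinearMap.zero_apply,
          TensorProduct.zero_tmul, TensorProduct.tmul_zero, smul_zero]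
      | add x y hx hy => simp only [LinearMap.map_add, LinearEquiv.map_add, TensorProduct.tmul_add, hx, hy]
      | tmul z w => exact hF x y z w
  refine (h (Coalgebra.comul (R := k) a) (Coalgebra.comul (R := k) b)).trans ?_
  congr 2
  exact LinearMap.congr_fun TensorProduct.map_id (Coalgebra.comul (R := k) a)

end pi

end ComodAlg

end Comodule

section Comodule

variable {k : Type u} [Field k] {A B : Type u} [Ring A] [Bialgebra k A] [Ring B] [Bialgebra k B]

namespace ComodAlg

lemma counit_counit {C : Type u} [AddCommGroup C] [Module k C] [Coalgebra k C] (c : C) :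
    TensorProduct.lid k k (TensorProduct.map (Coalgebra.counit (R := k))
      (Coalgebra.counit (R := k)) (Coalgebra.comul (R := k) c)) = Coalgebra.counit (R := k) c := by
  have h : ∀ w : C ⊗[k] C, TensorProduct.lid k k (TensorProduct.map (Coalgebra.counit (R := k))
      (Coalgebra.counit (R := k)) w) =
      Coalgebra.counit (R := k) (TensorProduct.lid k C
        ((Coalgebra.counit (R := k)).rTensor C w)) := by
    intro w
    induction w with
    | zero => simp only [LinearMap.map_zero, LinearEquiv.map_zero, LinearMap.zero_apply,
        TensorProduct.zero_tmul, TensorProduct.tmul_zero, smul_zero]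
    | add x y hx hy => simp only [LinearMap.map_add, LinearEquiv.map_add, hx, hy]
    | tmul x y => simp
  rw [h, Coalgebra.rTensor_counit_comul]
  simp

lemma counitCop (a : A) :
    TensorProduct.lid k k (TensorProduct.map (Coalgebra.counit (R := k))
      (Coalgebra.counit (R := k)) (Cop.comulAlgHom (k := k) A a)) =
        Coalgebra.counit (R := k) a := counit_counit (C := Cop A) a

lemma piB_comul (h : Cop A ⊗[k] B) :
    TensorProduct.map (piB k A B).toLinearMap (piB k A B).toLinearMap
      (Coalgebra.comul (R := k) h) = Coalgebra.comul (R := k) (piB k A B h) := by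
  induction h with
  | zero => simp
  | add x y hx hy => simp only [map_add, hx, hy]
  | tmul a b =>
    rw [map_ttt _ _ (LinearMap.lsmul k (B ⊗[k] B) ∘ₗ ((TensorProduct.lid k k).toLinearMap ∘ₗ
      TensorProduct.map (Coalgebra.counit (R := k)) (Coalgebra.counit (R := k))))
      (fun a a' b b' => by
        exact TensorProduct.smul_tmul_smul _ _ _ _)]
    rw [piB_tmul, map_smul]
    exact congrArg (fun c : k => c • Coalgebra.comul (R := k) b) (counitCop _)

lemma piA_comul (h : Cop A ⊗[k] B) :
    TensorProduct.map (piA k A B).toLinearMap (piA k A B).toLinearMap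
      (Coalgebra.comul (R := k) h) = Cop.comulAlgHom (k := k) A (piA k A B h) := by
  induction h with
  | zero => simp
  | add x y hx hy => simp only [map_add, hx, hy]
  | tmul a b =>
    rw [map_ttt _ _ (LinearMap.lsmul k (A ⊗[k] A) ∘ₗ ((TensorProduct.lid k k).toLinearMap ∘ₗ
      TensorProduct.map (Coalgebra.counit (R := k)) (Coalgebra.counit (R := k)))).flip
      (fun a a' b b' => by
        exact TensorProduct.smul_tmul_smul _ _ _ _)]
    rw [piA_tmul, map_smul]
    exact congrArg (fun c : k => c • Cop.comulAlgHom (k := k) A (Cop.toA (k := k) A a))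
      (counit_counit b)

lemma piA_piB_comul (h : Cop A ⊗[k] B) :
    TensorProduct.comm k A B (TensorProduct.map (piA k A B).toLinearMap (piB k A B).toLinearMap
      (Coalgebra.comul (R := k) h)) =
    TensorProduct.map (piB k A B).toLinearMap (piA k A B).toLinearMap
      (Coalgebra.comul (R := k) h) := by
  induction h with
  | zero => simp only [LinearMap.map_zero, LinearEquiv.map_zero, LinearMap.zero_apply,
      TensorProduct.zero_tmul, TensorProduct.tmul_zero, smul_zero]
  | add x y hx hy => simp only [LinearMap.map_add, LinearEquiv.map_add, hx, hy]
  | tmul a b =>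
    rw [map_ttt _ _ ((TensorProduct.mk k A B).compl₁₂
        ((TensorProduct.rid k A).toLinearMap ∘ₗ
          TensorProduct.map .id (Bialgebra.counitAlgHom k A).toLinearMap)
        ((TensorProduct.lid k B).toLinearMap ∘ₗ
          TensorProduct.map (Bialgebra.counitAlgHom k B).toLinearMap .id))
      (fun a a' b b' => by
        exact (TensorProduct.smul_tmul_smul _ _ _ _).trans
          ((congrArg (· • _) (mul_comm _ _)).trans
            (TensorProduct.smul_tmul_smul _ _ _ _).symm)),
      map_ttt _ _ ((TensorProduct.mk k B A).compl₁₂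
        ((TensorProduct.rid k B).toLinearMap ∘ₗ
          TensorProduct.map .id (Bialgebra.counitAlgHom k B).toLinearMap)
        ((TensorProduct.lid k A).toLinearMap ∘ₗ
          TensorProduct.map (Bialgebra.counitAlgHom k A).toLinearMap .id)).flip
      (fun a a' b b' => by
        exact (TensorProduct.smul_tmul_smul _ _ _ _).trans
          ((congrArg (· • _) (mul_comm _ _)).trans
            (TensorProduct.smul_tmul_smul _ _ _ _).symm))]
    simp only [LinearMap.compl₁₂_apply, LinearMap.flip_apply, TensorProduct.mk_apply,
      LinearMap.comp_apply, LinearEquiv.coe_coe, TensorProduct.comm_tmul]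
    have e1 := Cop.rid (k := k) A (Cop.toA (k := k) A a)
    have e2 := Cop.lid (k := k) A (Cop.toA (k := k) A a)
    have e3 := FDMod.comul_rid (k := k) B b
    have e4 := FDMod.comul_lid (k := k) B b
    simp only [Bialgebra.comulAlgHom_apply] at e3 e4
    rw [e1, e2, e3, e4]

variable (S : ComodAlg k (Cop A ⊗[k] B))

/-- The map `s ↦ π_A(s₍₋₁₎) ⊗ s₍₀₎`. -/
def coA : S.carrier →ₐ[k] A ⊗[k] S.carrier :=
  (Algebra.TensorProduct.map (piA k A B) (AlgHom.id k S.carrier)).comp S.coact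

/-- The map `s ↦ π_B(s₍₋₁₎) ⊗ s₍₀₎`, making `S` a left `B`-comodule algebra. -/
def coB : S.carrier →ₐ[k] B ⊗[k] S.carrier :=
  (Algebra.TensorProduct.map (piB k A B) (AlgHom.id k S.carrier)).comp S.coact

lemma coA_apply (s : S.carrier) :
    S.coA s = TensorProduct.map (piA k A B).toLinearMap .id (S.coact s) := rfl

lemma coB_apply (s : S.carrier) :
    S.coB s = TensorProduct.map (piB k A B).toLinearMap .id (S.coact s) := rfl

section

variable {P Q : Type u} [Ring P] [Algebra k P] [Ring Q] [Algebra k Q]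

lemma map_co (p : Cop A ⊗[k] B →ₐ[k] P) (q : Cop A ⊗[k] B →ₐ[k] Q) (s : S.carrier) :
    TensorProduct.map (LinearMap.id (R := k) (M := P))
      ((Algebra.TensorProduct.map q (AlgHom.id k S.carrier)).comp S.coact).toLinearMap
      (TensorProduct.map p.toLinearMap .id (S.coact s)) =
    TensorProduct.assoc k P Q S.carrier (TensorProduct.map
      (TensorProduct.map p.toLinearMap q.toLinearMap ∘ₗ Coalgebra.comul (R := k)) .id
        (S.coact s)) := by
  have h1 : ∀ w : (Cop A ⊗[k] B) ⊗[k] S.carrier, TensorProduct.map (LinearMap.id (R := k) (M := P))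
      ((Algebra.TensorProduct.map q (AlgHom.id k S.carrier)).comp S.coact).toLinearMap
      (TensorProduct.map p.toLinearMap .id w) =
      TensorProduct.map p.toLinearMap (TensorProduct.map q.toLinearMap .id)
        (TensorProduct.map .id S.coact.toLinearMap w) := by
    intro w
    induction w with
    | zero => simp only [LinearMap.map_zero, LinearEquiv.map_zero, LinearMap.zero_apply,
        TensorProduct.zero_tmul, TensorProduct.tmul_zero, smul_zero]
    | add x y hx hy => simp only [LinearMap.map_add, LinearEquiv.map_add, hx, hy]
    | tmul x y => rfl
  have h2 : ∀ w : (Cop A ⊗[k] B) ⊗[k] S.carrier,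
      TensorProduct.map p.toLinearMap (TensorProduct.map q.toLinearMap .id)
        (TensorProduct.assoc k _ _ _ (TensorProduct.map (Coalgebra.comul (R := k)) .id w)) =
      TensorProduct.assoc k P Q S.carrier (TensorProduct.map
        (TensorProduct.map p.toLinearMap q.toLinearMap ∘ₗ Coalgebra.comul (R := k)) .id w) := by
    intro w
    induction w with
    | zero => simp only [LinearMap.map_zero, LinearEquiv.map_zero, LinearMap.zero_apply,
        TensorProduct.zero_tmul, TensorProduct.tmul_zero, smul_zero]
    | add x y hx hy => simp only [LinearMap.map_add, LinearEquiv.map_add, hx, hy]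
    | tmul x y =>
      simp only [TensorProduct.map_tmul, LinearMap.comp_apply]
      induction Coalgebra.comul (R := k) x with
      | zero => simp only [LinearMap.map_zero, LinearEquiv.map_zero, LinearMap.zero_apply,
          TensorProduct.zero_tmul, TensorProduct.tmul_zero, smul_zero]
      | add x y hx hy => simp only [LinearMap.map_add, LinearEquiv.map_add, TensorProduct.add_tmul, hx, hy]
      | tmul x y => rfl
  rw [h1, ← S.coassoc, h2]

end

lemma coB_coassoc (s : S.carrier) :
    TensorProduct.assoc k B B S.carrier
      (TensorProduct.map (Bialgebra.comulAlgHom k B).toLinearMap .id (S.coB s)) =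
    TensorProduct.map .id S.coB.toLinearMap (S.coB s) := by
  refine Eq.trans ?_ (map_co S (piB k A B) (piB k A B) s).symm
  rw [coB_apply]
  congr 1
  have h : TensorProduct.map (piB k A B).toLinearMap (piB k A B).toLinearMap ∘ₗ
      Coalgebra.comul (R := k) =
      (Bialgebra.comulAlgHom k B).toLinearMap ∘ₗ (piB k A B).toLinearMap :=
    LinearMap.ext piB_comul
  rw [h, ← LinearMap.comp_apply, ← TensorProduct.map_comp]
  rfl

lemma coA_coassoc (s : S.carrier) :
    TensorProduct.assoc k A A S.carrier
      (TensorProduct.map (Cop.comulAlgHom A).toLinearMap .id (S.coA s)) =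
    TensorProduct.map .id S.coA.toLinearMap (S.coA s) := by
  refine Eq.trans ?_ (map_co S (piA k A B) (piA k A B) s).symm
  rw [coA_apply]
  congr 1
  have h : TensorProduct.map (piA k A B).toLinearMap (piA k A B).toLinearMap ∘ₗ
      Coalgebra.comul (R := k) =
      (Cop.comulAlgHom A).toLinearMap ∘ₗ (piA k A B).toLinearMap :=
    LinearMap.ext piA_comul
  rw [h, ← LinearMap.comp_apply, ← TensorProduct.map_comp]
  rfl

lemma leftComm_assoc {P Q R : Type u} [AddCommGroup P] [Module k P] [AddCommGroup Q] [Module k Q]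
    [AddCommGroup R] [Module k R] (w : (P ⊗[k] Q) ⊗[k] R) :
    TensorProduct.leftComm k P Q R (TensorProduct.assoc k P Q R w) =
    TensorProduct.assoc k Q P R
      (TensorProduct.map (TensorProduct.comm k P Q).toLinearMap .id w) := by
  induction w with
  | zero => simp only [LinearMap.map_zero, LinearEquiv.map_zero, LinearMap.zero_apply,
      TensorProduct.zero_tmul, TensorProduct.tmul_zero, smul_zero]
  | add x y hx hy => simp only [LinearMap.map_add, LinearEquiv.map_add, hx, hy]
  | tmul x y =>
    induction x with
    | zero => simp only [LinearMap.map_zero, LinearEquiv.map_zero, LinearMap.zero_apply,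
        TensorProduct.zero_tmul, TensorProduct.tmul_zero, smul_zero]
    | add x y hx hy => simp only [LinearMap.map_add, LinearEquiv.map_add, TensorProduct.add_tmul, hx, hy]
    | tmul x y => rfl

lemma coA_coB (s : S.carrier) :
    TensorProduct.leftComm k A B S.carrier
      (TensorProduct.map .id S.coB.toLinearMap (S.coA s)) =
    TensorProduct.map .id S.coA.toLinearMap (S.coB s) := by
  refine Eq.trans ?_ (map_co S (piB k A B) (piA k A B) s).symm
  refine (congrArg _ (map_co S (piA k A B) (piB k A B) s)).trans ?_
  rw [leftComm_assoc, ← LinearMap.comp_apply, ← TensorProduct.map_comp]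
  have h : (TensorProduct.comm k A B).toLinearMap ∘ₗ
      TensorProduct.map (piA k A B).toLinearMap (piB k A B).toLinearMap ∘ₗ
        Coalgebra.comul (R := k) =
      TensorProduct.map (piB k A B).toLinearMap (piA k A B).toLinearMap ∘ₗ
        Coalgebra.comul (R := k) := LinearMap.ext piA_piB_comul
  rw [h]
  rfl

lemma coB_counit (s : S.carrier) :
    TensorProduct.lid k S.carrier
      (TensorProduct.map (Bialgebra.counitAlgHom k B).toLinearMap .id (S.coB s)) = s := by
  conv_rhs => rw [← S.counit s]
  rw [coB_apply, ← LinearMap.comp_apply, ← TensorProduct.map_comp]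
  have h : (Bialgebra.counitAlgHom k B).toLinearMap ∘ₗ (piB k A B).toLinearMap =
      Coalgebra.counit (R := k) (A := Cop A ⊗[k] B) := TensorProduct.ext' fun a b => by
    simp only [LinearMap.comp_apply, AlgHom.toLinearMap_apply, piB_tmul, map_smul]
    exact mul_comm _ _
  rw [h]
  rfl

lemma coA_counit (s : S.carrier) :
    TensorProduct.lid k S.carrier
      (TensorProduct.map (Bialgebra.counitAlgHom k A).toLinearMap .id (S.coA s)) = s := by
  conv_rhs => rw [← S.counit s]
  rw [coA_apply, ← LinearMap.comp_apply, ← TensorProduct.map_comp]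
  have h : (Bialgebra.counitAlgHom k A).toLinearMap ∘ₗ (piA k A B).toLinearMap =
      Coalgebra.counit (R := k) (A := Cop A ⊗[k] B) := TensorProduct.ext' fun a b => by
    simp only [LinearMap.comp_apply, AlgHom.toLinearMap_apply, piA_tmul, map_smul]
    rfl
  rw [h]
  rfl

end ComodAlg

end Comodule

section Actions

variable {k : Type u} [Field k]

section Raw

/-- The isomorphism `(V ⊗ W) ⊗ Z ≅ W ⊗ (V ⊗ Z)`. -/
def rassoc (V W Z : Type u) [AddCommGroup V] [Module k V] [AddCommGroup W] [Module k W]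
    [AddCommGroup Z] [Module k Z] : (V ⊗[k] W) ⊗[k] Z ≃ₗ[k] W ⊗[k] (V ⊗[k] Z) :=
  (TensorProduct.congr (TensorProduct.comm k V W) (LinearEquiv.refl k Z)).trans
    (TensorProduct.assoc k W V Z)

@[simp] lemma rassoc_tmul {V W Z : Type u} [AddCommGroup V] [Module k V] [AddCommGroup W]
    [Module k W] [AddCommGroup Z] [Module k Z] (v : V) (w : W) (z : Z) :
    rassoc (k := k) V W Z ((v ⊗ₜ w) ⊗ₜ z) = w ⊗ₜ (v ⊗ₜ z) := rfl

lemma trep_rassoc {A S V W Z : Type u} [AddCommGroup V] [Module k V] [AddCommGroup W]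
    [Module k W] [AddCommGroup Z] [Module k Z] [Ring A] [Bialgebra k A] [Ring S] [Algebra k S]
    (f : S →ₐ[k] A ⊗[k] S)
    (hf : ∀ s, TensorProduct.assoc k A A S
      (TensorProduct.map (Cop.comulAlgHom A).toLinearMap .id (f s)) =
      TensorProduct.map .id f.toLinearMap (f s))
    (a : A →ₐ[k] Module.End k V) (b : A →ₐ[k] Module.End k W) (c : S →ₐ[k] Module.End k Z)
    (s : S) (v : (V ⊗[k] W) ⊗[k] Z) :
    rassoc (k := k) V W Z (trep f (trep (Bialgebra.comulAlgHom k A) a b) c s v) =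
      trep f b (trep f a c) s (rassoc (k := k) V W Z v) := by
  have h := trep_map f (trep (Bialgebra.comulAlgHom k A) a b) c (trep (Cop.comulAlgHom A) b a) c
    (TensorProduct.comm k V W).toLinearMap LinearMap.id
    (fun h v => trep_comm (Bialgebra.comulAlgHom k A) (Cop.comulAlgHom A) (fun _ => rfl) a b h v)
    (fun _ _ => rfl) s v
  have h' := trep_assoc f f f (Cop.comulAlgHom A) hf b a c s
    (TensorProduct.map (TensorProduct.comm k V W).toLinearMap LinearMap.id v)
  exact (congrArg (TensorProduct.assoc k W V Z) h).trans h'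

lemma text_fourfold {V W Z V' P : Type u} [AddCommGroup V] [Module k V] [AddCommGroup W]
    [Module k W] [AddCommGroup Z] [Module k Z] [AddCommGroup V'] [Module k V'] [AddCommGroup P]
    [Module k P] {f g : V ⊗[k] ((W ⊗[k] Z) ⊗[k] V') →ₗ[k] P}
    (h : ∀ v w z v', f (v ⊗ₜ ((w ⊗ₜ z) ⊗ₜ v')) = g (v ⊗ₜ ((w ⊗ₜ z) ⊗ₜ v'))) : f = g :=
  TensorProduct.ext (LinearMap.ext fun v => TensorProduct.ext_threefold fun w z v' => h v w z v')

end Raw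

variable {A B : Type u} [Ring A] [Bialgebra k A] [Ring B] [Bialgebra k B]

open FDMod

/-- The left action of `Rep(B)` on the category of left `S`-modules: `X ⊙ₗ M = X ⊗ M` with
`s · (x ⊗ m) = π_B(s₍₋₁₎) x ⊗ s₍₀₎ m`. -/
instance leftAction (S : ComodAlg k (Cop A ⊗[k] B)) :
    MonoidalLeftAction (FDMod k B) (FDMod k S.carrier) where
  actionObj X M := tens S.coB X M
  actionHomLeft f M := tensMap _ f (𝟙 M)
  actionHomRight X _ _ g := tensMap _ (𝟙 X) g
  actionHom f g := tensMap _ f g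
  actionAssocIso X Y M := isoMk (TensorProduct.assoc k X.carrier Y.carrier M.carrier)
    (trep_assoc S.coB S.coB S.coB _ S.coB_coassoc X.ρ Y.ρ M.ρ)
  actionUnitIso M := isoMk (TensorProduct.lid k M.carrier) (trep_lid S.coB _ S.coB_counit M.ρ)
  actionHom_def f g := by rw [← tensMap_comp, Category.comp_id, Category.id_comp]
  actionHomRight_id X M := tensMap_id _ X M
  id_actionHomLeft X M := tensMap_id _ X M
  actionHom_comp f₁ f₂ g₁ g₂ := tensMap_comp _ f₁ g₁ f₂ g₂
  actionAssocIso_hom_naturality f g h := hom_ext (TensorProduct.ext_threefold fun _ _ _ => rfl)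
  actionUnitIso_hom_naturality f := hom_ext (TensorProduct.ext' fun a x => map_smul (lin f) a x)
  whiskerLeft_actionHomLeft X _ _ f M := hom_ext (TensorProduct.ext_threefold fun _ _ _ => rfl)
  whiskerRight_actionHomLeft X f M := hom_ext (TensorProduct.ext_threefold fun _ _ _ => rfl)
  associator_actionHom X Y Z M :=
    hom_ext (traw_pentagon X.carrier Y.carrier Z.carrier M.carrier)
  leftUnitor_actionHom X M := hom_ext (TensorProduct.ext_threefold fun a x m =>
    (TensorProduct.smul_tmul' a x m))
  rightUnitor_actionHom X M := hom_ext (TensorProduct.ext_threefold fun x a m =>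
    (TensorProduct.smul_tmul a x m))

/-- The right action of `Rep(A)` on the category of left `S`-modules: `M ⊙ᵣ Y = Y ⊗ M` with
`s · (y ⊗ m) = π_A(s₍₋₁₎) y ⊗ s₍₀₎ m`. -/
instance rightAction (S : ComodAlg k (Cop A ⊗[k] B)) :
    MonoidalRightAction (FDMod k A) (FDMod k S.carrier) where
  actionObj M Y := tens S.coA Y M
  actionHomLeft f Y := tensMap _ (𝟙 Y) f
  actionHomRight M _ _ g := tensMap _ g (𝟙 M)
  actionHom f g := tensMap _ g f
  actionAssocIso M X Y := isoMk (rassoc X.carrier Y.carrier M.carrier)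
    (trep_rassoc S.coA S.coA_coassoc X.ρ Y.ρ M.ρ)
  actionUnitIso M := isoMk (TensorProduct.lid k M.carrier) (trep_lid S.coA _ S.coA_counit M.ρ)
  actionHom_def f g := by rw [← tensMap_comp, Category.comp_id, Category.id_comp]
  actionHomRight_id X M := tensMap_id _ X M
  id_actionHomLeft X M := tensMap_id _ X M
  actionHom_comp f₁ f₂ g₁ g₂ := tensMap_comp _ g₁ f₁ g₂ f₂
  actionAssocIso_hom_naturality f g h := hom_ext (TensorProduct.ext_threefold fun _ _ _ => rfl)
  actionUnitIso_hom_naturality f := hom_ext (TensorProduct.ext' fun a x => map_smul (lin f) a x)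
  actionHomRight_whiskerRight f Y M := hom_ext (TensorProduct.ext_threefold fun _ _ _ => rfl)
  whiskerRight_actionHomLeft Y _ _ f M := hom_ext (TensorProduct.ext_threefold fun _ _ _ => rfl)
  actionHom_associator X Y Z M := hom_ext (TensorProduct.ext_fourfold fun _ _ _ _ => rfl)
  actionHom_leftUnitor X M := hom_ext (TensorProduct.ext_threefold fun a x m =>
    (TensorProduct.smul_tmul a x m))
  actionHom_rightUnitor X M := hom_ext (TensorProduct.ext_threefold fun x a m =>
    (TensorProduct.smul_tmul' a x m))

/-- The category of left `S`-modules is a `(Rep(B), Rep(A))`-bimodule category. -/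
instance bimoduleCategory (S : ComodAlg k (Cop A ⊗[k] B)) :
    BimoduleCategory (FDMod k B) (FDMod k A) (FDMod k S.carrier) where
  γ X M Y := isoMk (TensorProduct.leftComm k Y.carrier X.carrier M.carrier)
    (trep_leftComm S.coA S.coB S.coB S.coA S.coA_coB Y.ρ X.ρ M.ρ)
  γ_naturality f g h := hom_ext (TensorProduct.ext_threefold' fun _ _ _ => rfl)
  γ_assoc_left X X' M Y := hom_ext (text_fourfold fun _ _ _ _ => rfl)
  γ_assoc_right X M Y Y' := hom_ext (TensorProduct.ext_fourfold' fun _ _ _ _ => rfl)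
  γ_unit_left M Y := hom_ext (TensorProduct.ext_threefold' fun y a m =>
    (TensorProduct.tmul_smul a y m).symm)
  γ_unit_right X M := hom_ext (TensorProduct.ext_threefold' fun a x m =>
    TensorProduct.tmul_smul a x m)

end Actions

section OplaxFunctors

open MonoidalLeftAction MonoidalRightAction

variable {C D M N P : Type*} [Category* C] [MonoidalCategory C] [Category* D] [MonoidalCategory D]
  [Category* M] [Category* N] [Category* P]

section gamma

variable [MonoidalRightAction D M] [MonoidalLeftAction C M] [BimoduleCategory C D M]

namespace BimoduleCategory

lemma γ_nat_left {X X' : C} (f : X ⟶ X') (m : M) (Y : D) :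
    (f ⊵ₗ m) ⊵ᵣ Y ≫ (γ X' m Y).hom = (γ X m Y).hom ≫ f ⊵ₗ (m ⊙ᵣ Y) := by
  simpa using γ_naturality f (𝟙 m) (𝟙 Y)

lemma γ_nat_mid (X : C) {m m' : M} (g : m ⟶ m') (Y : D) :
    (X ⊴ₗ g) ⊵ᵣ Y ≫ (γ X m' Y).hom = (γ X m Y).hom ≫ X ⊴ₗ (g ⊵ᵣ Y) := by
  simpa using γ_naturality (𝟙 X) g (𝟙 Y)

lemma γ_nat_right (X : C) (m : M) {Y Y' : D} (h : Y ⟶ Y') :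
    (X ⊙ₗ m) ⊴ᵣ h ≫ (γ X m Y').hom = (γ X m Y).hom ≫ X ⊴ₗ (m ⊴ᵣ h) := by
  simpa using γ_naturality (𝟙 X) (𝟙 m) h

lemma γ_unit_left_inv (m : M) (Y : D) :
    (λₗ (m ⊙ᵣ Y)).inv = (λₗ m).inv ⊵ᵣ Y ≫ (γ (𝟙_ C) m Y).hom := by
  have h : (γ (𝟙_ C) m Y).hom = (λₗ m).hom ⊵ᵣ Y ≫ (λₗ (m ⊙ᵣ Y)).inv := by
    rw [← γ_unit_left, Category.assoc, Iso.hom_inv_id, Category.comp_id]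
  rw [h, ← MonoidalRightAction.comp_actionHomLeft_assoc, Iso.inv_hom_id,
    MonoidalRightAction.id_actionHomLeft, Category.id_comp]

end BimoduleCategory

open BimoduleCategory

variable (M) in
/-- The functor `m ↦ m ⊙ᵣ Y`. -/
abbrev rtr (Y : D) : M ⥤ M where
  obj m := m ⊙ᵣ Y
  map f := f ⊵ᵣ Y

variable (C) in
/-- In a `(C, D)`-bimodule category the functor `m ↦ m ⊙ᵣ Y` is a `C`-module functor. -/
instance oplaxRtr (Y : D) : (rtr M Y).OplaxLeftLinear C where
  δₗ X m := (γ X m Y).hom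
  δₗ_naturality_left f m := γ_nat_left f m Y
  δₗ_naturality_right X _ _ g := γ_nat_mid X g Y
  δₗ_associativity X X' m := γ_assoc_left X X' m Y
  δₗ_unitality_inv m := γ_unit_left_inv m Y

end gamma

variable [MonoidalLeftAction C M] [MonoidalLeftAction C N] [MonoidalLeftAction C P]

open Functor.OplaxLeftLinear

variable (C) in
/-- The composite of module functors. -/
instance oplaxComp (F : M ⥤ N) (G : N ⥤ P) [F.OplaxLeftLinear C] [G.OplaxLeftLinear C] :
    (F ⋙ G).OplaxLeftLinear C where
  δₗ X m := G.map (δₗ F X m) ≫ δₗ G X (F.obj m)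
  δₗ_naturality_left f m := by
    dsimp
    rw [← G.map_comp_assoc, δₗ_naturality_left, G.map_comp_assoc, δₗ_naturality_left,
      Category.assoc]
  δₗ_naturality_right X _ _ g := by
    dsimp
    rw [← G.map_comp_assoc, δₗ_naturality_right, G.map_comp_assoc, δₗ_naturality_right,
      Category.assoc]
  δₗ_associativity X X' m := by
    dsimp
    rw [Category.assoc, δₗ_associativity, ← G.map_comp_assoc, δₗ_associativity]
    simp only [Functor.map_comp, Category.assoc, MonoidalLeftAction.actionHomRight_comp]
    rw [δₗ_naturality_right_assoc]
  δₗ_unitality_inv m := by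
    dsimp
    rw [δₗ_unitality_inv G, δₗ_unitality_inv F, G.map_comp, Category.assoc]

end OplaxFunctors

section Fun

open MonoidalLeftAction MonoidalRightAction FDMod BimoduleCategory
open Functor.OplaxLeftLinear

variable {k : Type u} [Field k] {A B : Type u} [Ring A] [Bialgebra k A] [Ring B] [Bialgebra k B]

/-- A functor between categories of finite-dimensional modules is right exact if it sends
exact sequences `X → Y → Z → 0` to exact sequences. -/
def RightExact {S T : Type u} [Ring S] [Algebra k S] [Ring T] [Algebra k T]
    (F : FDMod k S ⥤ FDMod k T) : Prop :=
  ∀ ⦃X Y Z : FDMod k S⦄ (f : X ⟶ Y) (g : Y ⟶ Z), Function.Exact (lin f) (lin g) →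
    Function.Surjective (lin g) →
    Function.Exact (lin (F.map f)) (lin (F.map g)) ∧ Function.Surjective (lin (F.map g))

/-- A `k`-linear functor `F` with natural maps `c : F (X ⊙ₗ M) ⟶ X ⊙ₗ F M` satisfying the
associativity and unit conditions is a `Rep(B)`-module functor if all the maps `c` are
isomorphisms. -/
structure IsModuleFunctor (S K : ComodAlg k (Cop A ⊗[k] B))
    (F : FDMod k S.carrier ⥤ FDMod k K.carrier) [F.OplaxLeftLinear (FDMod k B)] : Prop where
  additive : F.Additive
  linear : F.Linear k
  isIso (X : FDMod k B) (M : FDMod k S.carrier) : IsIso (δₗ F X M)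

/-- The objects of `Fun_{Rep(B)}(_S M, _K M)`: right exact `Rep(B)`-module functors from left
`S`-modules to left `K`-modules. -/
structure ModFun (S K : ComodAlg k (Cop A ⊗[k] B)) where
  F : FDMod k S.carrier ⥤ FDMod k K.carrier
  [oplax : F.OplaxLeftLinear (FDMod k B)]
  isModuleFunctor : IsModuleFunctor S K F
  rightExact : RightExact F

attribute [instance] ModFun.oplax

lemma tensMap_add_right {S H T : Type u} [Ring S] [Algebra k S] [Ring H] [Algebra k H] [Ring T]
    [Algebra k T] (f : S →ₐ[k] H ⊗[k] T) {X X' : FDMod k H} {M M' : FDMod k T} (a : X ⟶ X')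
    (b b' : M ⟶ M') : tensMap f a (b + b') = tensMap f a b + tensMap f a b' :=
  hom_ext (TensorProduct.map_add_right _ _ _)

lemma tensMap_smul_right {S H T : Type u} [Ring S] [Algebra k S] [Ring H] [Algebra k H] [Ring T]
    [Algebra k T] (f : S →ₐ[k] H ⊗[k] T) {X X' : FDMod k H} {M M' : FDMod k T} (a : X ⟶ X')
    (c : k) (b : M ⟶ M') : tensMap f a (c • b) = c • tensMap f a b :=
  hom_ext (TensorProduct.map_smul_right _ _ _)

section

variable (S : ComodAlg k (Cop A ⊗[k] B))

lemma left_add (X : FDMod k B) {M N : FDMod k S.carrier} (f g : M ⟶ N) :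
    X ⊴ₗ (f + g) = X ⊴ₗ f + X ⊴ₗ g := tensMap_add_right _ _ _ _

lemma left_smul (X : FDMod k B) {M N : FDMod k S.carrier} (c : k) (f : M ⟶ N) :
    X ⊴ₗ (c • f) = c • X ⊴ₗ f := tensMap_smul_right _ _ _ _

lemma right_add (Y : FDMod k A) {M N : FDMod k S.carrier} (f g : M ⟶ N) :
    (f + g) ⊵ᵣ Y = f ⊵ᵣ Y + g ⊵ᵣ Y := tensMap_add_right _ _ _ _

lemma right_smul (Y : FDMod k A) {M N : FDMod k S.carrier} (c : k) (f : M ⟶ N) :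
    (c • f) ⊵ᵣ Y = c • f ⊵ᵣ Y := tensMap_smul_right _ _ _ _

lemma isModuleFunctor_rtr (Y : FDMod k A) :
    IsModuleFunctor S S (rtr (FDMod k S.carrier) Y) where
  additive := { map_add := right_add S Y _ _ }
  linear := { map_smul := fun f c => right_smul S Y c f }
  isIso X M := (γ X M Y).isIso_hom

lemma rightExact_rtr (Y : FDMod k A) : RightExact (rtr (FDMod k S.carrier) Y) :=
  fun _ _ _ _ _ hfg hg => ⟨lTensor_exact Y.carrier hfg hg, LinearMap.lTensor_surjective _ hg⟩

variable {S}

lemma IsModuleFunctor.comp {K L : ComodAlg k (Cop A ⊗[k] B)}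
    {F : FDMod k S.carrier ⥤ FDMod k K.carrier} {G : FDMod k K.carrier ⥤ FDMod k L.carrier}
    [F.OplaxLeftLinear (FDMod k B)] [G.OplaxLeftLinear (FDMod k B)]
    (hF : IsModuleFunctor S K F) (hG : IsModuleFunctor K L G) :
    IsModuleFunctor S L (F ⋙ G) where
  additive := by
    have := hF.additive
    have := hG.additive
    infer_instance
  linear := by
    have := hF.linear
    have := hG.linear
    infer_instance
  isIso X M := by
    have := hF.isIso X M
    have := hG.isIso X (F.obj M)
    exact inferInstanceAs (IsIso (G.map (δₗ F X M) ≫ δₗ G X (F.obj M)))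

lemma RightExact.comp {S T U : Type u} [Ring S] [Algebra k S] [Ring T] [Algebra k T]
    [Ring U] [Algebra k U] {F : FDMod k S ⥤ FDMod k T} {G : FDMod k T ⥤ FDMod k U}
    (hF : RightExact F) (hG : RightExact G) : RightExact (F ⋙ G) :=
  fun _ _ _ f g hfg hg => hG _ _ (hF f g hfg hg).1 (hF f g hfg hg).2

end

namespace ModFun

variable {S K : ComodAlg k (Cop A ⊗[k] B)}

/-- The morphisms of module functors: natural transformations `α` compatible with the module
structures. -/
def homs (F G : ModFun S K) : Submodule k (F.F ⟶ G.F) where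
  carrier := {α | ∀ (X : FDMod k B) (M : FDMod k S.carrier),
    α.app (X ⊙ₗ M) ≫ δₗ G.F X M = δₗ F.F X M ≫ X ⊴ₗ α.app M}
  add_mem' {α β} hα hβ X M := by
    have h1 := hα X M
    have h2 := hβ X M
    rw [NatTrans.app_add, NatTrans.app_add, Preadditive.add_comp, left_add, Preadditive.comp_add,
      h1, h2]
  zero_mem' X M := by
    have : X ⊴ₗ (0 : F.F.obj M ⟶ G.F.obj M) = 0 := by
      simpa using left_smul K X (0 : k) (0 : F.F.obj M ⟶ G.F.obj M)
    rw [NatTrans.app_zero, NatTrans.app_zero, this]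
    simp
  smul_mem' c α hα X M := by
    have h1 := hα X M
    rw [NatTrans.app_smul, NatTrans.app_smul, Linear.smul_comp, left_smul, Linear.comp_smul, h1]

/-- The category `Fun_{Rep(B)}(_S M, _K M)`. -/
instance : Category (ModFun S K) where
  Hom F G := homs F G
  id F := ⟨𝟙 F.F, fun X M => by simp⟩
  comp {F G H} α β := ⟨α.1 ≫ β.1, fun X M => by
    have h1 := α.2 X M
    have h2 := β.2 X M
    simp only [NatTrans.comp_app, Category.assoc, MonoidalLeftAction.actionHomRight_comp]
    rw [h2, reassoc_of% h1]⟩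

/-- The natural transformation underlying a morphism. -/
def nat {F G : ModFun S K} (α : F ⟶ G) : F.F ⟶ G.F := α.1

/-- A morphism from a compatible natural transformation. -/
def mkHom {F G : ModFun S K} (α : F.F ⟶ G.F) (hα : ∀ (X : FDMod k B) (M : FDMod k S.carrier),
    α.app (X ⊙ₗ M) ≫ δₗ G.F X M = δₗ F.F X M ≫ X ⊴ₗ α.app M) : F ⟶ G := ⟨α, hα⟩

@[simp] lemma nat_mkHom {F G : ModFun S K} (α : F.F ⟶ G.F) (hα) :
    nat (mkHom α hα : F ⟶ G) = α := rfl

@[simp] lemma nat_id (F : ModFun S K) : nat (𝟙 F) = 𝟙 F.F := rfl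

@[simp] lemma nat_comp {F G H : ModFun S K} (α : F ⟶ G) (β : G ⟶ H) :
    nat (α ≫ β) = nat α ≫ nat β := rfl

lemma hom_ext {F G : ModFun S K} {α β : F ⟶ G} (h : ∀ M, (nat α).app M = (nat β).app M) :
    α = β := Subtype.ext (NatTrans.ext (funext h))

lemma nat_δ {F G : ModFun S K} (α : F ⟶ G) (X : FDMod k B) (M : FDMod k S.carrier) :
    (nat α).app (X ⊙ₗ M) ≫ δₗ G.F X M = δₗ F.F X M ≫ X ⊴ₗ (nat α).app M := α.2 X M

instance : Preadditive (ModFun S K) where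
  homGroup F G := inferInstanceAs (AddCommGroup (homs F G))
  add_comp F G H α β δ := Subtype.ext (Preadditive.add_comp _ _ _ α.1 β.1 δ.1)
  comp_add F G H α β δ := Subtype.ext (Preadditive.comp_add _ _ _ α.1 β.1 δ.1)

instance : Linear k (ModFun S K) where
  homModule F G := inferInstanceAs (Module k (homs F G))
  smul_comp F G H c α β := Subtype.ext (Linear.smul_comp _ _ _ c α.1 β.1)
  comp_smul F G H α c β := Subtype.ext (Linear.comp_smul _ _ _ α.1 c β.1)

/-- An isomorphism from a compatible natural isomorphism. -/
def isoMk {F G : ModFun S K} (α : F.F ≅ G.F) (hα : ∀ (X : FDMod k B) (M : FDMod k S.carrier),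
    α.hom.app (X ⊙ₗ M) ≫ δₗ G.F X M = δₗ F.F X M ≫ X ⊴ₗ α.hom.app M) : F ≅ G where
  hom := mkHom α.hom hα
  inv := mkHom α.inv fun X M => by
    rw [← cancel_epi (α.hom.app (X ⊙ₗ M)), Iso.hom_inv_id_app_assoc, ← Category.assoc, hα,
      Category.assoc, ← MonoidalLeftAction.actionHomRight_comp, Iso.hom_inv_id_app,
      MonoidalLeftAction.actionHomRight_id, Category.comp_id]
  hom_inv_id := hom_ext fun M => by simp
  inv_hom_id := hom_ext fun M => by simp

@[simp] lemma nat_isoMk_hom {F G : ModFun S K} (α : F.F ≅ G.F) (hα) :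
    nat (isoMk α hα : F ≅ G).hom = α.hom := rfl

@[simp] lemma nat_isoMk_inv {F G : ModFun S K} (α : F.F ≅ G.F) (hα) :
    nat (isoMk α hα : F ≅ G).inv = α.inv := rfl

/-- The left action: `(X ⊙ₗ F)(M) = F(M ⊙ᵣ X)`. -/
abbrev actL (X : FDMod k A) (F : ModFun S K) : ModFun S K where
  F := rtr (FDMod k S.carrier) X ⋙ F.F
  isModuleFunctor := (isModuleFunctor_rtr S X).comp F.isModuleFunctor
  rightExact := (rightExact_rtr S X).comp F.rightExact

/-- The right action: `(F ⊙ᵣ Y)(M) = F(M) ⊙ᵣ Y`. -/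
abbrev actR (F : ModFun S K) (Y : FDMod k A) : ModFun S K where
  F := F.F ⋙ rtr (FDMod k K.carrier) Y
  isModuleFunctor := F.isModuleFunctor.comp (isModuleFunctor_rtr K Y)
  rightExact := F.rightExact.comp (rightExact_rtr K Y)

lemma actL_δ (X : FDMod k A) (F : ModFun S K) (Z : FDMod k B) (M : FDMod k S.carrier) :
    δₗ (actL X F).F Z M = F.F.map (γ Z M X).hom ≫ δₗ F.F Z (M ⊙ᵣ X) := rfl

lemma actR_δ (F : ModFun S K) (Y : FDMod k A) (Z : FDMod k B) (M : FDMod k S.carrier) :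
    δₗ (actR F Y).F Z M = δₗ F.F Z M ⊵ᵣ Y ≫ (γ Z (F.F.obj M) Y).hom := rfl

/-- The map `X ⊙ₗ F ⟶ X' ⊙ₗ F`, with components `F(M ⊙ᵣ X) ⟶ F(M ⊙ᵣ X')`. -/
abbrev actLmapL {X X' : FDMod k A} (f : X ⟶ X') (F : ModFun S K) : actL X F ⟶ actL X' F :=
  mkHom { app := fun M => F.F.map (M ⊴ᵣ f)
          naturality := fun M N g => by
            dsimp
            rw [← F.F.map_comp, ← F.F.map_comp, MonoidalRightAction.action_exchange] }
    fun Z M => by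
      change F.F.map ((Z ⊙ₗ M) ⊴ᵣ f) ≫ F.F.map (γ Z M X').hom ≫ δₗ F.F Z (M ⊙ᵣ X') =
        (F.F.map (γ Z M X).hom ≫ δₗ F.F Z (M ⊙ᵣ X)) ≫ Z ⊴ₗ F.F.map (M ⊴ᵣ f)
      rw [← F.F.map_comp_assoc, γ_nat_right, F.F.map_comp_assoc, δₗ_naturality_right,
        Category.assoc]

/-- The map `X ⊙ₗ F ⟶ X ⊙ₗ G`, with components `F(M ⊙ᵣ X) ⟶ G(M ⊙ᵣ X)`. -/
abbrev actLmapR (X : FDMod k A) {F G : ModFun S K} (α : F ⟶ G) : actL X F ⟶ actL X G :=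
  mkHom { app := fun M => (nat α).app (M ⊙ᵣ X)
          naturality := fun M N g => (nat α).naturality _ }
    fun Z M => by
      change (nat α).app ((Z ⊙ₗ M) ⊙ᵣ X) ≫ G.F.map (γ Z M X).hom ≫ δₗ G.F Z (M ⊙ᵣ X) =
        (F.F.map (γ Z M X).hom ≫ δₗ F.F Z (M ⊙ᵣ X)) ≫ Z ⊴ₗ (nat α).app (M ⊙ᵣ X)
      rw [← (nat α).naturality_assoc, nat_δ, Category.assoc]

/-- The map `F ⊙ᵣ Y ⟶ F ⊙ᵣ Y'`, with components `F(M) ⊙ᵣ Y ⟶ F(M) ⊙ᵣ Y'`. -/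
abbrev actRmapR (F : ModFun S K) {Y Y' : FDMod k A} (f : Y ⟶ Y') : actR F Y ⟶ actR F Y' :=
  mkHom { app := fun M => F.F.obj M ⊴ᵣ f
          naturality := fun M N g => by
            dsimp
            rw [MonoidalRightAction.action_exchange] }
    fun Z M => by
      change F.F.obj (Z ⊙ₗ M) ⊴ᵣ f ≫ δₗ F.F Z M ⊵ᵣ Y' ≫ (γ Z (F.F.obj M) Y').hom =
        (δₗ F.F Z M ⊵ᵣ Y ≫ (γ Z (F.F.obj M) Y).hom) ≫ Z ⊴ₗ (F.F.obj M ⊴ᵣ f)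
      rw [Category.assoc, ← γ_nat_right, ← MonoidalRightAction.action_exchange_assoc]

/-- The map `F ⊙ᵣ Y ⟶ G ⊙ᵣ Y`, with components `F(M) ⊙ᵣ Y ⟶ G(M) ⊙ᵣ Y`. -/
abbrev actRmapL {F G : ModFun S K} (α : F ⟶ G) (Y : FDMod k A) : actR F Y ⟶ actR G Y :=
  mkHom { app := fun M => (nat α).app M ⊵ᵣ Y
          naturality := fun M N g => by
            dsimp
            rw [← MonoidalRightAction.comp_actionHomLeft, (nat α).naturality,
              MonoidalRightAction.comp_actionHomLeft] }
    fun Z M => by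
      change (nat α).app (Z ⊙ₗ M) ⊵ᵣ Y ≫ δₗ G.F Z M ⊵ᵣ Y ≫ (γ Z (G.F.obj M) Y).hom =
        (δₗ F.F Z M ⊵ᵣ Y ≫ (γ Z (F.F.obj M) Y).hom) ≫ Z ⊴ₗ ((nat α).app M ⊵ᵣ Y)
      rw [← MonoidalRightAction.comp_actionHomLeft_assoc, nat_δ,
        MonoidalRightAction.comp_actionHomLeft_assoc, γ_nat_mid, Category.assoc]

/-- The left `Rep(A)`-module category structure of `Fun_{Rep(B)}(_S M, _K M)`. -/
instance leftAction : MonoidalLeftAction (FDMod k A) (ModFun S K) where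
  actionObj X F := actL X F
  actionHomLeft f F := actLmapL f F
  actionHomRight X _ _ α := actLmapR X α
  actionAssocIso X X' F := isoMk
    (NatIso.ofComponents (fun M => F.F.mapIso (αᵣ M X X')) fun {M N} f => by
      change F.F.map (f ⊵ᵣ (X ⊗ X')) ≫ F.F.map (αᵣ N X X').hom =
        F.F.map (αᵣ M X X').hom ≫ F.F.map ((f ⊵ᵣ X) ⊵ᵣ X')
      rw [← F.F.map_comp, ← F.F.map_comp, MonoidalRightAction.actionHomLeft_tensor]
      simp)
    fun Z M => by
      change F.F.map (αᵣ (Z ⊙ₗ M) X X').hom ≫ F.F.map ((γ Z M X).hom ⊵ᵣ X') ≫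
          F.F.map (γ Z (M ⊙ᵣ X) X').hom ≫ δₗ F.F Z ((M ⊙ᵣ X) ⊙ᵣ X') =
        (F.F.map (γ Z M (X ⊗ X')).hom ≫ δₗ F.F Z (M ⊙ᵣ (X ⊗ X'))) ≫
          Z ⊴ₗ F.F.map (αᵣ M X X').hom
      rw [Category.assoc, ← δₗ_naturality_right]
      simp only [← F.F.map_comp_assoc, γ_assoc_right, Category.assoc]
  actionUnitIso F := isoMk
    (NatIso.ofComponents (fun M => F.F.mapIso (ρᵣ M)) fun {M N} f => by
      change F.F.map (f ⊵ᵣ 𝟙_ (FDMod k A)) ≫ F.F.map (ρᵣ N).hom =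
        F.F.map (ρᵣ M).hom ≫ F.F.map f
      rw [← F.F.map_comp, ← F.F.map_comp, MonoidalRightAction.actionUnitIso_hom_naturality])
    fun Z M => by
      change F.F.map (ρᵣ (Z ⊙ₗ M)).hom ≫ δₗ F.F Z M =
        (F.F.map (γ Z M (𝟙_ (FDMod k A))).hom ≫ δₗ F.F Z (M ⊙ᵣ 𝟙_ (FDMod k A))) ≫
          Z ⊴ₗ F.F.map (ρᵣ M).hom
      rw [Category.assoc, ← δₗ_naturality_right, ← F.F.map_comp_assoc, γ_unit_right]
  actionHom_def f g := rfl
  actionHomRight_id X F := hom_ext fun M => rfl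
  id_actionHomLeft X F := hom_ext fun M => by
    change F.F.map (M ⊴ᵣ 𝟙 X) = _
    rw [MonoidalRightAction.actionHomRight_id]
    exact F.F.map_id _
  actionHom_comp {X X' X'' F G H} f₁ f₂ g₁ g₂ := hom_ext fun M => by
    change F.F.map (M ⊴ᵣ (f₁ ≫ f₂)) ≫ (nat g₁).app (M ⊙ᵣ X'') ≫ (nat g₂).app (M ⊙ᵣ X'') =
      (F.F.map (M ⊴ᵣ f₁) ≫ (nat g₁).app (M ⊙ᵣ X')) ≫
        (G.F.map (M ⊴ᵣ f₂) ≫ (nat g₂).app (M ⊙ᵣ X''))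
    simp
  actionAssocIso_hom_naturality {X₁ X₂ X₃ X₄ F G} f g α := hom_ext fun M => by
    change (F.F.map (M ⊴ᵣ (f ⊗ₘ g)) ≫ (nat α).app (M ⊙ᵣ (X₂ ⊗ X₄))) ≫
        G.F.map (αᵣ M X₂ X₄).hom = F.F.map (αᵣ M X₁ X₃).hom ≫
      F.F.map ((M ⊴ᵣ f) ⊵ᵣ X₃) ≫ F.F.map ((M ⊙ᵣ X₂) ⊴ᵣ g) ≫
        (nat α).app ((M ⊙ᵣ X₂) ⊙ᵣ X₄)
    have h := MonoidalRightAction.actionAssocIso_hom_naturality (𝟙 M) f g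
    rw [MonoidalRightAction.id_actionHom, MonoidalRightAction.id_actionHom] at h
    rw [Category.assoc, ← (nat α).naturality]
    simp only [← F.F.map_comp_assoc, h, MonoidalRightAction.actionHom_def, Category.assoc]
  actionUnitIso_hom_naturality α := hom_ext fun M => (nat α).naturality _
  whiskerLeft_actionHomLeft X X' X'' f F := hom_ext fun M => by
    change F.F.map (M ⊴ᵣ (X ◁ f)) = F.F.map (αᵣ M X X').hom ≫
      F.F.map ((M ⊙ᵣ X) ⊴ᵣ f) ≫ F.F.map (αᵣ M X X'').inv
    rw [MonoidalRightAction.whiskerRight_actionHomLeft, F.F.map_comp, F.F.map_comp]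
  whiskerRight_actionHomLeft {X X'} X'' f F := hom_ext fun M => by
    change F.F.map (M ⊴ᵣ (f ▷ X'')) = F.F.map (αᵣ M X X'').hom ≫
      F.F.map ((M ⊴ᵣ f) ⊵ᵣ X'') ≫ F.F.map (αᵣ M X' X'').inv
    rw [MonoidalRightAction.actionHomRight_whiskerRight, F.F.map_comp, F.F.map_comp]
  associator_actionHom X Y Z F := hom_ext fun M => by
    change F.F.map (M ⊴ᵣ (α_ X Y Z).hom) ≫ F.F.map (αᵣ M X (Y ⊗ Z)).hom ≫
        F.F.map (αᵣ (M ⊙ᵣ X) Y Z).hom =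
      F.F.map (αᵣ M (X ⊗ Y) Z).hom ≫ F.F.map ((αᵣ M X Y).hom ⊵ᵣ Z)
    simp only [← F.F.map_comp, MonoidalRightAction.actionHom_associator]
  leftUnitor_actionHom X F := hom_ext fun M => by
    change F.F.map (M ⊴ᵣ (λ_ X).hom) = F.F.map (αᵣ M (𝟙_ _) X).hom ≫ F.F.map ((ρᵣ M).hom ⊵ᵣ X)
    rw [← F.F.map_comp, MonoidalRightAction.actionHom_leftUnitor]
  rightUnitor_actionHom X F := hom_ext fun M => by
    change F.F.map (M ⊴ᵣ (ρ_ X).hom) = F.F.map (αᵣ M X (𝟙_ _)).hom ≫ F.F.map (ρᵣ (M ⊙ᵣ X)).hom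
    rw [← F.F.map_comp, MonoidalRightAction.actionHom_rightUnitor]

/-- The right `Rep(A)`-module category structure of `Fun_{Rep(B)}(_S M, _K M)`. -/
instance rightAction : MonoidalRightAction (FDMod k A) (ModFun S K) where
  actionObj F Y := actR F Y
  actionHomLeft α Y := actRmapL α Y
  actionHomRight F _ _ f := actRmapR F f
  actionAssocIso F Y Y' := isoMk
    (NatIso.ofComponents (fun M => αᵣ (F.F.obj M) Y Y') fun {M N} f => by
      change F.F.map f ⊵ᵣ (Y ⊗ Y') ≫ (αᵣ (F.F.obj N) Y Y').hom =
        (αᵣ (F.F.obj M) Y Y').hom ≫ (F.F.map f ⊵ᵣ Y) ⊵ᵣ Y'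
      simp)
    fun Z M => by
      change (αᵣ (F.F.obj (Z ⊙ₗ M)) Y Y').hom ≫ ((δₗ F.F Z M ⊵ᵣ Y ≫ (γ Z (F.F.obj M) Y).hom) ⊵ᵣ Y') ≫
          (γ Z (F.F.obj M ⊙ᵣ Y) Y').hom =
        (δₗ F.F Z M ⊵ᵣ (Y ⊗ Y') ≫ (γ Z (F.F.obj M) (Y ⊗ Y')).hom) ≫
          Z ⊴ₗ (αᵣ (F.F.obj M) Y Y').hom
      rw [Category.assoc, γ_assoc_right]
      simp
  actionUnitIso F := isoMk
    (NatIso.ofComponents (fun M => ρᵣ (F.F.obj M)) fun {M N} f => by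
      change F.F.map f ⊵ᵣ 𝟙_ (FDMod k A) ≫ (ρᵣ (F.F.obj N)).hom =
        (ρᵣ (F.F.obj M)).hom ≫ F.F.map f
      rw [MonoidalRightAction.actionUnitIso_hom_naturality])
    fun Z M => by
      change (ρᵣ (F.F.obj (Z ⊙ₗ M))).hom ≫ δₗ F.F Z M =
        (δₗ F.F Z M ⊵ᵣ 𝟙_ (FDMod k A) ≫ (γ Z (F.F.obj M) (𝟙_ (FDMod k A))).hom) ≫
          Z ⊴ₗ (ρᵣ (F.F.obj M)).hom
      rw [Category.assoc, γ_unit_right, MonoidalRightAction.actionUnitIso_hom_naturality]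
  actionHom_def f g := rfl
  actionHomRight_id X F := hom_ext fun M => MonoidalRightAction.actionHomRight_id _ _
  id_actionHomLeft X F := hom_ext fun M => MonoidalRightAction.id_actionHomLeft _ _
  actionHom_comp {X X' X'' F G H} f₁ f₂ g₁ g₂ := hom_ext fun M => by
    have h := MonoidalRightAction.actionHom_comp ((nat f₁).app M) ((nat f₂).app M) g₁ g₂
    simp only [MonoidalRightAction.actionHom_def] at h
    exact h
  actionAssocIso_hom_naturality {F G X₁ X₂ X₃ X₄} α f g := hom_ext fun M => by
    have h := MonoidalRightAction.actionAssocIso_hom_naturality ((nat α).app M) f g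
    simp only [MonoidalRightAction.actionHom_def] at h
    exact h
  actionUnitIso_hom_naturality α := hom_ext fun M =>
    MonoidalRightAction.actionUnitIso_hom_naturality ((nat α).app M)
  actionHomRight_whiskerRight f X F := hom_ext fun M =>
    MonoidalRightAction.actionHomRight_whiskerRight f X (F.F.obj M)
  whiskerRight_actionHomLeft X _ _ f F := hom_ext fun M =>
    MonoidalRightAction.whiskerRight_actionHomLeft X f (F.F.obj M)
  actionHom_associator X Y Z F := hom_ext fun M =>
    MonoidalRightAction.actionHom_associator X Y Z (F.F.obj M)
  actionHom_leftUnitor X F := hom_ext fun M =>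
    MonoidalRightAction.actionHom_leftUnitor X (F.F.obj M)
  actionHom_rightUnitor X F := hom_ext fun M =>
    MonoidalRightAction.actionHom_rightUnitor X (F.F.obj M)

/-- The `Rep(A)`-bimodule category `Fun_{Rep(B)}(_S M, _K M)`; the maps
`((X ⊙ₗ F) ⊙ᵣ Y)(M) = F(M ⊙ᵣ X) ⊙ᵣ Y ⟶ (X ⊙ₗ (F ⊙ᵣ Y))(M)` are identities. -/
instance bimoduleCategory : BimoduleCategory (FDMod k A) (FDMod k A) (ModFun S K) where
  γ X F Y := isoMk (Iso.refl (rtr (FDMod k S.carrier) X ⋙ F.F ⋙ rtr (FDMod k K.carrier) Y))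
    fun Z M => by
      change 𝟙 (F.F.obj ((Z ⊙ₗ M) ⊙ᵣ X) ⊙ᵣ Y) ≫ (F.F.map (γ Z M X).hom ⊵ᵣ Y ≫
          δₗ F.F Z (M ⊙ᵣ X) ⊵ᵣ Y ≫ (γ Z (F.F.obj (M ⊙ᵣ X)) Y).hom) =
        ((F.F.map (γ Z M X).hom ≫ δₗ F.F Z (M ⊙ᵣ X)) ⊵ᵣ Y ≫ (γ Z (F.F.obj (M ⊙ᵣ X)) Y).hom) ≫
          Z ⊴ₗ 𝟙 (F.F.obj (M ⊙ᵣ X) ⊙ᵣ Y)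
      simp
  γ_naturality {X X' F G Y Y'} f α g := hom_ext fun M => by
    change ((F.F.map (M ⊴ᵣ f) ≫ (nat α).app (M ⊙ᵣ X')) ⊵ᵣ Y ≫ G.F.obj (M ⊙ᵣ X') ⊴ᵣ g) ≫
        𝟙 (G.F.obj (M ⊙ᵣ X') ⊙ᵣ Y') =
      𝟙 (F.F.obj (M ⊙ᵣ X) ⊙ᵣ Y) ≫ F.F.map (M ⊴ᵣ f) ⊵ᵣ Y ≫
        ((nat α).app (M ⊙ᵣ X') ⊵ᵣ Y ≫ G.F.obj (M ⊙ᵣ X') ⊴ᵣ g)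
    simp only [Category.comp_id, Category.id_comp, MonoidalRightAction.comp_actionHomLeft,
      Category.assoc]
  γ_assoc_left X X' F Y := hom_ext fun M => by
    change 𝟙 (F.F.obj (M ⊙ᵣ (X ⊗ X')) ⊙ᵣ Y) ≫ F.F.map (αᵣ M X X').hom ⊵ᵣ Y =
      F.F.map (αᵣ M X X').hom ⊵ᵣ Y ≫ 𝟙 (F.F.obj ((M ⊙ᵣ X) ⊙ᵣ X') ⊙ᵣ Y) ≫
        𝟙 (F.F.obj ((M ⊙ᵣ X) ⊙ᵣ X') ⊙ᵣ Y)
    simp only [Category.comp_id, Category.id_comp]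
  γ_assoc_right X F Y Y' := hom_ext fun M => by
    change 𝟙 (F.F.obj (M ⊙ᵣ X) ⊙ᵣ (Y ⊗ Y')) ≫ (αᵣ (F.F.obj (M ⊙ᵣ X)) Y Y').hom =
      (αᵣ (F.F.obj (M ⊙ᵣ X)) Y Y').hom ≫ 𝟙 (F.F.obj (M ⊙ᵣ X) ⊙ᵣ Y) ⊵ᵣ Y' ≫
        𝟙 ((F.F.obj (M ⊙ᵣ X) ⊙ᵣ Y) ⊙ᵣ Y')
    simp only [Category.comp_id, Category.id_comp, MonoidalRightAction.id_actionHomLeft]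
  γ_unit_left F Y := hom_ext fun M => Category.id_comp _
  γ_unit_right X F := hom_ext fun M => Category.id_comp _

end ModFun

end Fun

section Balanced

variable {k : Type u} [Field k]
  {S R L B : Type u} [Ring S] [Algebra k S] [Ring R] [Algebra k R] [Ring L] [Algebra k L]
  [Ring B] [Bialgebra k B]
  {V W V' W' V'' W'' Z : Type u} [AddCommGroup V] [Module k V] [AddCommGroup W] [Module k W]
  [AddCommGroup Z] [Module k Z] [AddCommGroup V'] [Module k V'] [AddCommGroup W'] [Module k W']
  [AddCommGroup V''] [Module k V''] [AddCommGroup W''] [Module k W'']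

/-- The relations `p s ⊗ n = p ⊗ s n` in `V ⊗ W`, where `r` gives a right action of `S` on `V`
and `l` a left action on `W`. -/
def balRel (r : S →ₗ[k] Module.End k V) (l : S →ₐ[k] Module.End k W) :
    Submodule k (V ⊗[k] W) :=
  Submodule.span k {z | ∃ s v w, z = r s v ⊗ₜ w - v ⊗ₜ l s w}

/-- The tensor product `V ⊗_S W` of a right `S`-module and a left `S`-module. -/
def Bal (r : S →ₗ[k] Module.End k V) (l : S →ₐ[k] Module.End k W) : Type u :=
  (V ⊗[k] W) ⧸ balRel r l

namespace Bal

variable (r : S →ₗ[k] Module.End k V) (l : S →ₐ[k] Module.End k W)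

instance : AddCommGroup (Bal r l) := inferInstanceAs (AddCommGroup ((V ⊗[k] W) ⧸ balRel r l))

instance : Module k (Bal r l) := inferInstanceAs (Module k ((V ⊗[k] W) ⧸ balRel r l))

instance [FiniteDimensional k V] [FiniteDimensional k W] : FiniteDimensional k (Bal r l) :=
  inferInstanceAs (FiniteDimensional k ((V ⊗[k] W) ⧸ balRel r l))

/-- The projection `V ⊗ W → V ⊗_S W`. -/
def mk : V ⊗[k] W →ₗ[k] Bal r l := (balRel r l).mkQ

lemma mk_surjective : Function.Surjective (mk r l) := (balRel r l).mkQ_surjective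

lemma mk_rel (s : S) (v : V) (w : W) : mk r l (r s v ⊗ₜ w) = mk r l (v ⊗ₜ l s w) :=
  (Submodule.Quotient.eq _).2 (Submodule.subset_span ⟨s, v, w, rfl⟩)

variable {r l}

/-- The linear map on `V ⊗_S W` given by a balanced map. -/
def lift (f : V ⊗[k] W →ₗ[k] Z) (hf : ∀ s v w, f (r s v ⊗ₜ w) = f (v ⊗ₜ l s w)) :
    Bal r l →ₗ[k] Z :=
  (balRel r l).liftQ f (Submodule.span_le.2 (by
    rintro _ ⟨s, v, w, rfl⟩
    simp [hf]))

@[simp] lemma lift_mk (f : V ⊗[k] W →ₗ[k] Z) (hf) (z : V ⊗[k] W) :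
    lift (r := r) (l := l) f hf (mk r l z) = f z := rfl

lemma ext {f g : Bal r l →ₗ[k] Z} (h : ∀ v w, f (mk r l (v ⊗ₜ w)) = g (mk r l (v ⊗ₜ w))) :
    f = g := by
  have h' : f ∘ₗ mk r l = g ∘ₗ mk r l := TensorProduct.ext' h
  refine LinearMap.ext fun x => ?_
  obtain ⟨z, rfl⟩ := mk_surjective r l x
  exact LinearMap.congr_fun h' z

variable {r' : S →ₗ[k] Module.End k V'} {l' : S →ₐ[k] Module.End k W'}
  {r'' : S →ₗ[k] Module.End k V''} {l'' : S →ₐ[k] Module.End k W''}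

/-- The functoriality of `V ⊗_S W`. -/
def map (f : V →ₗ[k] V') (g : W →ₗ[k] W') (hf : ∀ s v, f (r s v) = r' s (f v))
    (hg : ∀ s w, g (l s w) = l' s (g w)) : Bal r l →ₗ[k] Bal r' l' :=
  lift (mk r' l' ∘ₗ TensorProduct.map f g) fun s v w => by
    simp [hf, hg, mk_rel]

@[simp] lemma map_mk (f : V →ₗ[k] V') (g : W →ₗ[k] W') (hf) (hg) (z : V ⊗[k] W) :
    map (r := r) (l := l) (r' := r') (l' := l') f g hf hg (mk r l z) =
      mk r' l' (TensorProduct.map f g z) := rfl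

variable (l) in
/-- The left action of `R` on `V ⊗_S W` for an `(R, S)`-bimodule `V`. -/
def repL (a : R →ₐ[k] Module.End k V) (h : ∀ x s v, a x (r s v) = r s (a x v)) :
    R →ₐ[k] Module.End k (Bal r l) where
  toFun x := map (a x) .id (h x) fun _ _ => rfl
  map_one' := ext fun v w => by simp
  map_mul' x y := ext fun v w => by simp
  map_zero' := ext fun v w => by simp
  map_add' x y := ext fun v w => by simp [TensorProduct.add_tmul]
  commutes' c := ext fun v w => by
    simp only [AlgHom.commutes, Module.algebraMap_end_apply, map_mk, TensorProduct.map_tmul,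
      LinearMap.id_apply]
    rw [← TensorProduct.smul_tmul', map_smul]

@[simp] lemma repL_mk (a : R →ₐ[k] Module.End k V) (h) (x : R) (v : V) (w : W) :
    repL (r := r) l a h x (mk r l (v ⊗ₜ w)) = mk r l (a x v ⊗ₜ w) := rfl

variable (r) in
/-- The right action of `L` on `V ⊗_S W` for an `(S, L)`-bimodule `W`. -/
def repR (b : L →ₗ[k] Module.End k W) (h : ∀ x s w, b x (l s w) = l s (b x w)) :
    L →ₗ[k] Module.End k (Bal r l) where
  toFun x := map .id (b x) (fun _ _ => rfl) (h x)
  map_add' x y := ext fun v w => by simp [TensorProduct.tmul_add]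
  map_smul' c x := ext fun v w => by simp

@[simp] lemma repR_mk (b : L →ₗ[k] Module.End k W) (h) (x : L) (v : V) (w : W) :
    repR (l := l) r b h x (mk r l (v ⊗ₜ w)) = mk r l (v ⊗ₜ b x w) := rfl

variable (r l) in
/-- The map `(b ⊗ v) ⊗ (c ⊗ w) ↦ b c ⊗ (v ⊗ w)`. -/
def mm : (B ⊗[k] V) ⊗[k] (B ⊗[k] W) →ₗ[k] B ⊗[k] Bal r l :=
  TensorProduct.map (LinearMap.mul' k B) (mk r l) ∘ₗ
    (TensorProduct.tensorTensorTensorComm k B V B W).toLinearMap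

@[simp] lemma mm_tmul (b c : B) (v : V) (w : W) :
    mm r l ((b ⊗ₜ v) ⊗ₜ (c ⊗ₜ w)) = (b * c) ⊗ₜ mk r l (v ⊗ₜ w) := rfl

lemma tensor_ext₃ {V₁ V₂ V₃ : Type u} [AddCommGroup V₁] [Module k V₁] [AddCommGroup V₂]
    [Module k V₂] [AddCommGroup V₃] [Module k V₃] {f g : V₁ →ₗ[k] V₂ →ₗ[k] V₃ →ₗ[k] Z}
    (h : ∀ x y z, f x y z = g x y z) : f = g :=
  LinearMap.ext fun x => LinearMap.ext fun y => LinearMap.ext fun z => h x y z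

lemma mm_bal (u : B ⊗[k] S) (v : B ⊗[k] V) (w : B ⊗[k] W) :
    mm r l (tact (LinearMap.mul k B).flip r u v ⊗ₜ w) =
      mm r l (v ⊗ₜ tact (LinearMap.mul k B) l.toLinearMap u w) := by
  induction u with
  | zero => simp only [LinearMap.map_zero, LinearEquiv.map_zero, LinearMap.zero_apply,
      TensorProduct.zero_tmul, TensorProduct.tmul_zero, smul_zero]
  | add x y hx hy => simp only [LinearMap.map_add, LinearEquiv.map_add, LinearMap.add_apply, TensorProduct.add_tmul,
      TensorProduct.tmul_add, hx, hy]
  | tmul c s =>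
    induction v with
    | zero => simp only [LinearMap.map_zero, LinearEquiv.map_zero, LinearMap.zero_apply,
        TensorProduct.zero_tmul, TensorProduct.tmul_zero, smul_zero]
    | add x y hx hy => simp only [LinearMap.map_add, LinearEquiv.map_add, TensorProduct.add_tmul, hx, hy]
    | tmul b v =>
      induction w with
      | zero => simp only [LinearMap.map_zero, LinearEquiv.map_zero, LinearMap.zero_apply,
          TensorProduct.zero_tmul, TensorProduct.tmul_zero, smul_zero]
      | add x y hx hy => simp only [LinearMap.map_add, LinearEquiv.map_add, TensorProduct.tmul_add, hx, hy]
      | tmul d w => simp [mul_assoc, mk_rel]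

/-- The coaction `v ⊗ w ↦ v₍₋₁₎ w₍₋₁₎ ⊗ (v₍₀₎ ⊗ w₍₀₎)` on `V ⊗_S W`. -/
def coact (f : S →ₐ[k] B ⊗[k] S) (δ : V →ₗ[k] B ⊗[k] V) (δ' : W →ₗ[k] B ⊗[k] W)
    (h : ∀ s v, δ (r s v) = tact (LinearMap.mul k B).flip r (f s) (δ v))
    (h' : ∀ s w, δ' (l s w) = trep f (Algebra.lmul k B) l s (δ' w)) :
    Bal r l →ₗ[k] B ⊗[k] Bal r l :=
  lift (mm r l ∘ₗ TensorProduct.map δ δ') fun s v w => by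
    simp only [LinearMap.comp_apply, TensorProduct.map_tmul, h, h']
    exact mm_bal _ _ _

section coact

variable {f : S →ₐ[k] B ⊗[k] S} {δ : V →ₗ[k] B ⊗[k] V} {δ' : W →ₗ[k] B ⊗[k] W}
    (h : ∀ s v, δ (r s v) = tact (LinearMap.mul k B).flip r (f s) (δ v))
    (h' : ∀ s w, δ' (l s w) = trep f (Algebra.lmul k B) l s (δ' w))

@[simp] lemma coact_mk (v : V) (w : W) :
    coact f δ δ' h h' (mk r l (v ⊗ₜ w)) = mm r l (δ v ⊗ₜ δ' w) := rfl

lemma coact_coassoc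
    (c : ∀ v, TensorProduct.assoc k B B V (TensorProduct.map (Coalgebra.comul (R := k)) .id
      (δ v)) = TensorProduct.map .id δ (δ v))
    (c' : ∀ w, TensorProduct.assoc k B B W (TensorProduct.map (Coalgebra.comul (R := k)) .id
      (δ' w)) = TensorProduct.map .id δ' (δ' w)) (z : Bal r l) :
    TensorProduct.assoc k B B (Bal r l) (TensorProduct.map (Coalgebra.comul (R := k)) .id
      (coact f δ δ' h h' z)) =
    TensorProduct.map .id (coact f δ δ' h h') (coact f δ δ' h h' z) := by
  let m : (B ⊗[k] (B ⊗[k] V)) ⊗[k] (B ⊗[k] (B ⊗[k] W)) →ₗ[k] B ⊗[k] (B ⊗[k] Bal r l) :=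
    TensorProduct.map (LinearMap.mul' k B) (mm r l) ∘ₗ
      (TensorProduct.tensorTensorTensorComm k B (B ⊗[k] V) B (B ⊗[k] W)).toLinearMap
  have e1 : ∀ (x : B ⊗[k] V) (y : B ⊗[k] W),
      TensorProduct.assoc k B B (Bal r l) (TensorProduct.map (Coalgebra.comul (R := k)) .id
        (mm r l (x ⊗ₜ y))) =
      m (TensorProduct.assoc k B B V (TensorProduct.map (Coalgebra.comul (R := k)) .id x) ⊗ₜ
        TensorProduct.assoc k B B W (TensorProduct.map (Coalgebra.comul (R := k)) .id y)) := by
    intro x y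
    induction x with
    | zero => simp only [LinearMap.map_zero, LinearEquiv.map_zero, LinearMap.zero_apply,
        TensorProduct.zero_tmul, TensorProduct.tmul_zero, smul_zero]
    | add x y hx hy => simp only [LinearMap.map_add, LinearEquiv.map_add, TensorProduct.add_tmul, hx, hy]
    | tmul b v =>
      induction y with
      | zero => simp only [LinearMap.map_zero, LinearEquiv.map_zero, LinearMap.zero_apply,
          TensorProduct.zero_tmul, TensorProduct.tmul_zero, smul_zero]
      | add x y hx hy => simp only [LinearMap.map_add, LinearEquiv.map_add, TensorProduct.tmul_add, hx, hy]
      | tmul c w =>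
        simp only [mm_tmul, TensorProduct.map_tmul, LinearMap.id_apply, Bialgebra.comul_mul]
        induction Coalgebra.comul (R := k) b with
        | zero => simp
        | add x y hx hy => simp only [LinearMap.map_add, LinearEquiv.map_add, TensorProduct.add_tmul, add_mul, hx, hy]
        | tmul b b' =>
          induction Coalgebra.comul (R := k) c with
          | zero => simp
          | add x y hx hy =>
            simp only [LinearMap.map_add, LinearEquiv.map_add, TensorProduct.add_tmul, TensorProduct.tmul_add, mul_add, hx, hy]
          | tmul c c' =>
            rw [Algebra.TensorProduct.tmul_mul_tmul]
            rfl
  have e2 : ∀ (x : B ⊗[k] V) (y : B ⊗[k] W),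
      TensorProduct.map .id (coact f δ δ' h h') (mm r l (x ⊗ₜ y)) =
      m (TensorProduct.map .id δ x ⊗ₜ TensorProduct.map .id δ' y) := by
    intro x y
    induction x with
    | zero => simp only [LinearMap.map_zero, LinearEquiv.map_zero, LinearMap.zero_apply,
        TensorProduct.zero_tmul, TensorProduct.tmul_zero, smul_zero]
    | add x y hx hy => simp only [LinearMap.map_add, LinearEquiv.map_add, TensorProduct.add_tmul, hx, hy]
    | tmul b v =>
      induction y with
      | zero => simp only [LinearMap.map_zero, LinearEquiv.map_zero, LinearMap.zero_apply,
          TensorProduct.zero_tmul, TensorProduct.tmul_zero, smul_zero]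
      | add x y hx hy => simp only [LinearMap.map_add, LinearEquiv.map_add, TensorProduct.tmul_add, hx, hy]
      | tmul c w => rfl
  refine LinearMap.congr_fun (f := (TensorProduct.assoc k B B (Bal r l)).toLinearMap ∘ₗ
    TensorProduct.map (Coalgebra.comul (R := k)) .id ∘ₗ coact f δ δ' h h')
    (g := TensorProduct.map .id (coact f δ δ' h h') ∘ₗ coact f δ δ' h h') (ext fun v w => ?_) z
  simp only [LinearMap.comp_apply, coact_mk, LinearEquiv.coe_coe]
  rw [e1, e2, c, c']

lemma coact_counit
    (c : ∀ v, TensorProduct.lid k V (TensorProduct.map (Coalgebra.counit (R := k)) .id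
      (δ v)) = v)
    (c' : ∀ w, TensorProduct.lid k W (TensorProduct.map (Coalgebra.counit (R := k)) .id
      (δ' w)) = w) (z : Bal r l) :
    TensorProduct.lid k (Bal r l) (TensorProduct.map (Coalgebra.counit (R := k)) .id
      (coact f δ δ' h h' z)) = z := by
  have e1 : ∀ (x : B ⊗[k] V) (y : B ⊗[k] W),
      TensorProduct.lid k (Bal r l) (TensorProduct.map (Coalgebra.counit (R := k)) .id
        (mm r l (x ⊗ₜ y))) =
      mk r l (TensorProduct.lid k V (TensorProduct.map (Coalgebra.counit (R := k)) .id x) ⊗ₜ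
        TensorProduct.lid k W (TensorProduct.map (Coalgebra.counit (R := k)) .id y)) := by
    intro x y
    induction x with
    | zero => simp only [LinearMap.map_zero, LinearEquiv.map_zero, LinearMap.zero_apply,
        TensorProduct.zero_tmul, TensorProduct.tmul_zero, smul_zero]
    | add x y hx hy => simp only [LinearMap.map_add, LinearEquiv.map_add, TensorProduct.add_tmul, hx, hy]
    | tmul b v =>
      induction y with
      | zero => simp only [LinearMap.map_zero, LinearEquiv.map_zero, LinearMap.zero_apply,
          TensorProduct.zero_tmul, TensorProduct.tmul_zero, smul_zero]
      | add x y hx hy => simp only [LinearMap.map_add, LinearEquiv.map_add, TensorProduct.tmul_add, hx, hy]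
      | tmul c w =>
        simp only [mm_tmul, TensorProduct.map_tmul, LinearMap.id_apply, TensorProduct.lid_tmul,
          Bialgebra.counit_mul, TensorProduct.smul_tmul_smul, map_smul]
  refine LinearMap.congr_fun (f := (TensorProduct.lid k (Bal r l)).toLinearMap ∘ₗ
    TensorProduct.map (Coalgebra.counit (R := k)) .id ∘ₗ coact f δ δ' h h')
    (g := LinearMap.id) (ext fun v w => ?_) z
  simp only [LinearMap.comp_apply, coact_mk, LinearEquiv.coe_coe]
  rw [e1, c, c']
  rfl

lemma coact_repL {g : R →ₐ[k] B ⊗[k] R} (a : R →ₐ[k] Module.End k V)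
    (ha : ∀ x s v, a x (r s v) = r s (a x v))
    (hδ : ∀ x v, δ (a x v) = trep g (Algebra.lmul k B) a x (δ v)) (x : R) (z : Bal r l) :
    coact f δ δ' h h' (repL l a ha x z) =
      trep g (Algebra.lmul k B) (repL l a ha) x (coact f δ δ' h h' z) := by
  have e1 : ∀ (u : B ⊗[k] R) (x : B ⊗[k] V) (y : B ⊗[k] W),
      mm r l (tact (LinearMap.mul k B) a.toLinearMap u x ⊗ₜ y) =
      tact (LinearMap.mul k B) (repL l a ha).toLinearMap u (mm r l (x ⊗ₜ y)) := by
    intro u x y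
    induction u with
    | zero => simp only [LinearMap.map_zero, LinearEquiv.map_zero, LinearMap.zero_apply,
        TensorProduct.zero_tmul, TensorProduct.tmul_zero, smul_zero]
    | add x y hx hy => simp only [LinearMap.map_add, LinearEquiv.map_add, LinearMap.add_apply, TensorProduct.add_tmul, hx, hy]
    | tmul d t =>
      induction x with
      | zero => simp only [LinearMap.map_zero, LinearEquiv.map_zero, LinearMap.zero_apply,
          TensorProduct.zero_tmul, TensorProduct.tmul_zero, smul_zero]
      | add x y hx hy => simp only [LinearMap.map_add, LinearEquiv.map_add, TensorProduct.add_tmul, hx, hy]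
      | tmul b v =>
        induction y with
        | zero => simp only [LinearMap.map_zero, LinearEquiv.map_zero, LinearMap.zero_apply,
            TensorProduct.zero_tmul, TensorProduct.tmul_zero, smul_zero]
        | add x y hx hy => simp only [LinearMap.map_add, LinearEquiv.map_add, TensorProduct.tmul_add, hx, hy]
        | tmul c w => simp [mul_assoc]
  refine LinearMap.congr_fun (f := coact f δ δ' h h' ∘ₗ repL l a ha x)
    (g := trep g (Algebra.lmul k B) (repL l a ha) x ∘ₗ coact f δ δ' h h')
    (ext fun v w => ?_) z
  simp only [LinearMap.comp_apply, coact_mk, repL_mk, hδ]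
  exact e1 _ _ _

lemma coact_repR {g : L →ₐ[k] B ⊗[k] L} (b : L →ₗ[k] Module.End k W)
    (hb : ∀ x s w, b x (l s w) = l s (b x w))
    (hδ : ∀ x w, δ' (b x w) = tact (LinearMap.mul k B).flip b (g x) (δ' w)) (x : L)
    (z : Bal r l) :
    coact f δ δ' h h' (repR r b hb x z) =
      tact (LinearMap.mul k B).flip (repR r b hb) (g x) (coact f δ δ' h h' z) := by
  have e1 : ∀ (u : B ⊗[k] L) (x : B ⊗[k] V) (y : B ⊗[k] W),
      mm r l (x ⊗ₜ tact (LinearMap.mul k B).flip b u y) =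
      tact (LinearMap.mul k B).flip (repR r b hb) u (mm r l (x ⊗ₜ y)) := by
    intro u x y
    induction u with
    | zero => simp only [LinearMap.map_zero, LinearEquiv.map_zero, LinearMap.zero_apply,
        TensorProduct.zero_tmul, TensorProduct.tmul_zero, smul_zero]
    | add x y hx hy => simp only [LinearMap.map_add, LinearEquiv.map_add, LinearMap.add_apply, TensorProduct.tmul_add, hx, hy]
    | tmul d t =>
      induction x with
      | zero => simp only [LinearMap.map_zero, LinearEquiv.map_zero, LinearMap.zero_apply,
          TensorProduct.zero_tmul, TensorProduct.tmul_zero, smul_zero]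
      | add x y hx hy => simp only [LinearMap.map_add, LinearEquiv.map_add, TensorProduct.add_tmul, hx, hy]
      | tmul b v =>
        induction y with
        | zero => simp only [LinearMap.map_zero, LinearEquiv.map_zero, LinearMap.zero_apply,
            TensorProduct.zero_tmul, TensorProduct.tmul_zero, smul_zero]
        | add x y hx hy => simp only [LinearMap.map_add, LinearEquiv.map_add, TensorProduct.tmul_add, hx, hy]
        | tmul c w => simp [mul_assoc]
  refine LinearMap.congr_fun (f := coact f δ δ' h h' ∘ₗ repR r b hb x)
    (g := tact (LinearMap.mul k B).flip (repR r b hb) (g x) ∘ₗ coact f δ δ' h h')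
    (ext fun v w => ?_) z
  simp only [LinearMap.comp_apply, coact_mk, repR_mk, hδ]
  exact e1 _ _ _

lemma coact_map {k₁ : V' →ₗ[k] B ⊗[k] V'} {k₂ : W' →ₗ[k] B ⊗[k] W'}
    (h₁ : ∀ s v, k₁ (r' s v) = tact (LinearMap.mul k B).flip r' (f s) (k₁ v))
    (h₂ : ∀ s w, k₂ (l' s w) = trep f (Algebra.lmul k B) l' s (k₂ w))
    (φ : V →ₗ[k] V') (ψ : W →ₗ[k] W') (hφ : ∀ s v, φ (r s v) = r' s (φ v))
    (hψ : ∀ s w, ψ (l s w) = l' s (ψ w))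
    (cφ : ∀ v, k₁ (φ v) = TensorProduct.map .id φ (δ v))
    (cψ : ∀ w, k₂ (ψ w) = TensorProduct.map .id ψ (δ' w)) (z : Bal r l) :
    coact f k₁ k₂ h₁ h₂ (map φ ψ hφ hψ z) =
      TensorProduct.map .id (map φ ψ hφ hψ) (coact f δ δ' h h' z) := by
  have e1 : ∀ (x : B ⊗[k] V) (y : B ⊗[k] W),
      mm r' l' (TensorProduct.map .id φ x ⊗ₜ TensorProduct.map .id ψ y) =
      TensorProduct.map .id (map φ ψ hφ hψ) (mm r l (x ⊗ₜ y)) := by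
    intro x y
    induction x with
    | zero => simp only [LinearMap.map_zero, LinearEquiv.map_zero, LinearMap.zero_apply,
        TensorProduct.zero_tmul, TensorProduct.tmul_zero, smul_zero]
    | add x y hx hy => simp only [LinearMap.map_add, LinearEquiv.map_add, TensorProduct.add_tmul, hx, hy]
    | tmul b v =>
      induction y with
      | zero => simp only [LinearMap.map_zero, LinearEquiv.map_zero, LinearMap.zero_apply,
          TensorProduct.zero_tmul, TensorProduct.tmul_zero, smul_zero]
      | add x y hx hy => simp only [LinearMap.map_add, LinearEquiv.map_add, TensorProduct.tmul_add, hx, hy]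
      | tmul c w => rfl
  refine LinearMap.congr_fun (f := coact f k₁ k₂ h₁ h₂ ∘ₗ map φ ψ hφ hψ)
    (g := TensorProduct.map .id (map φ ψ hφ hψ) ∘ₗ coact f δ δ' h h') (ext fun v w => ?_) z
  simp only [LinearMap.comp_apply, coact_mk, map_mk, TensorProduct.map_tmul, cφ, cψ]
  exact e1 _ _

end coact

section modStr

variable {X : Type u} [AddCommGroup X] [Module k X]

variable (r l) in
/-- The map `(b ⊗ v) ⊗ (x ⊗ w) ↦ b x ⊗ (v ⊗ w)`. -/
def nn (a : B →ₐ[k] Module.End k X) :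
    (B ⊗[k] V) ⊗[k] (X ⊗[k] W) →ₗ[k] X ⊗[k] Bal r l :=
  TensorProduct.map (TensorProduct.lift a.toLinearMap) (mk r l) ∘ₗ
    (TensorProduct.tensorTensorTensorComm k B V X W).toLinearMap

@[simp] lemma nn_tmul (a : B →ₐ[k] Module.End k X) (b : B) (x : X) (v : V) (w : W) :
    nn r l a ((b ⊗ₜ v) ⊗ₜ (x ⊗ₜ w)) = a b x ⊗ₜ mk r l (v ⊗ₜ w) := rfl

lemma nn_bal (a : B →ₐ[k] Module.End k X) (u : B ⊗[k] S) (v : B ⊗[k] V) (w : X ⊗[k] W) :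
    nn r l a (tact (LinearMap.mul k B).flip r u v ⊗ₜ w) =
      nn r l a (v ⊗ₜ tact a.toLinearMap l.toLinearMap u w) := by
  induction u with
  | zero => simp only [LinearMap.map_zero, LinearEquiv.map_zero, LinearMap.zero_apply,
      TensorProduct.zero_tmul, TensorProduct.tmul_zero, smul_zero]
  | add x y hx hy => simp only [LinearMap.map_add, LinearEquiv.map_add, LinearMap.add_apply, TensorProduct.add_tmul,
      TensorProduct.tmul_add, hx, hy]
  | tmul c s =>
    induction v with
    | zero => simp only [LinearMap.map_zero, LinearEquiv.map_zero, LinearMap.zero_apply,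
        TensorProduct.zero_tmul, TensorProduct.tmul_zero, smul_zero]
    | add x y hx hy => simp only [LinearMap.map_add, LinearEquiv.map_add, TensorProduct.add_tmul, hx, hy]
    | tmul b v =>
      induction w with
      | zero => simp only [LinearMap.map_zero, LinearEquiv.map_zero, LinearMap.zero_apply,
          TensorProduct.zero_tmul, TensorProduct.tmul_zero, smul_zero]
      | add x y hx hy => simp only [LinearMap.map_add, LinearEquiv.map_add, TensorProduct.tmul_add, hx, hy]
      | tmul d w => simp [mk_rel]

/-- The map `V ⊗_S (X ⊗ W) → X ⊗ (V ⊗_S W)`, `v ⊗ (x ⊗ w) ↦ v₍₋₁₎ x ⊗ (v₍₀₎ ⊗ w)`. -/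
def str (f : S →ₐ[k] B ⊗[k] S) (δ : V →ₗ[k] B ⊗[k] V)
    (h : ∀ s v, δ (r s v) = tact (LinearMap.mul k B).flip r (f s) (δ v))
    (a : B →ₐ[k] Module.End k X) : Bal r (trep f a l) →ₗ[k] X ⊗[k] Bal r l :=
  lift (nn r l a ∘ₗ TensorProduct.map δ .id) fun s v w => by
    simp only [LinearMap.comp_apply, TensorProduct.map_tmul, h]
    exact nn_bal _ _ _ _

variable {f : S →ₐ[k] B ⊗[k] S} {δ : V →ₗ[k] B ⊗[k] V}
    (h : ∀ s v, δ (r s v) = tact (LinearMap.mul k B).flip r (f s) (δ v))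

lemma str_mk (a : B →ₐ[k] Module.End k X) (v : V) (w : X ⊗[k] W) :
    str f δ h a (mk r (trep f a l) (v ⊗ₜ w)) = nn r l a (δ v ⊗ₜ w) := rfl

lemma str_repL {g : R →ₐ[k] B ⊗[k] R} (a : B →ₐ[k] Module.End k X) (ρ : R →ₐ[k] Module.End k V)
    (hρ : ∀ x s v, ρ x (r s v) = r s (ρ x v))
    (hδ : ∀ x v, δ (ρ x v) = trep g (Algebra.lmul k B) ρ x (δ v)) (x : R)
    (z : Bal r (trep f a l)) :
    str f δ h a (repL (trep f a l) ρ hρ x z) = trep g a (repL l ρ hρ) x (str f δ h a z) := by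
  have e1 : ∀ (u : B ⊗[k] R) (x : B ⊗[k] V) (y : X ⊗[k] W),
      nn r l a (tact (LinearMap.mul k B) ρ.toLinearMap u x ⊗ₜ y) =
      tact a.toLinearMap (repL l ρ hρ).toLinearMap u (nn r l a (x ⊗ₜ y)) := by
    intro u x y
    induction u with
    | zero => simp only [LinearMap.map_zero, LinearEquiv.map_zero, LinearMap.zero_apply,
        TensorProduct.zero_tmul, TensorProduct.tmul_zero, smul_zero]
    | add x y hx hy => simp only [LinearMap.map_add, LinearEquiv.map_add, LinearMap.add_apply, TensorProduct.add_tmul, hx, hy]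
    | tmul d t =>
      induction x with
      | zero => simp only [LinearMap.map_zero, LinearEquiv.map_zero, LinearMap.zero_apply,
          TensorProduct.zero_tmul, TensorProduct.tmul_zero, smul_zero]
      | add x y hx hy => simp only [LinearMap.map_add, LinearEquiv.map_add, TensorProduct.add_tmul, hx, hy]
      | tmul b v =>
        induction y with
        | zero => simp only [LinearMap.map_zero, LinearEquiv.map_zero, LinearMap.zero_apply,
            TensorProduct.zero_tmul, TensorProduct.tmul_zero, smul_zero]
        | add x y hx hy => simp only [LinearMap.map_add, LinearEquiv.map_add, TensorProduct.tmul_add, hx, hy]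
        | tmul c w => simp
  refine LinearMap.congr_fun (f := str f δ h a ∘ₗ repL (trep f a l) ρ hρ x)
    (g := trep g a (repL l ρ hρ) x ∘ₗ str f δ h a) (ext fun v w => ?_) z
  simp only [LinearMap.comp_apply, repL_mk, str_mk, hδ]
  exact e1 _ _ _

lemma str_map {X' : Type u} [AddCommGroup X'] [Module k X'] (a : B →ₐ[k] Module.End k X)
    (a' : B →ₐ[k] Module.End k X') {δ₁ : V' →ₗ[k] B ⊗[k] V'}
    (h₁ : ∀ s v, δ₁ (r' s v) = tact (LinearMap.mul k B).flip r' (f s) (δ₁ v))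
    (φ : V →ₗ[k] V') (hφ : ∀ s v, φ (r s v) = r' s (φ v))
    (cφ : ∀ v, δ₁ (φ v) = TensorProduct.map .id φ (δ v))
    (ξ : X →ₗ[k] X') (hξ : ∀ b x, ξ (a b x) = a' b (ξ x))
    (ψ : W →ₗ[k] W') (hψ : ∀ s w, ψ (l s w) = l' s (ψ w)) (hh)
    (z : Bal r (trep f a l)) :
    str f δ₁ h₁ a' (map (r' := r') (l' := trep f a' l') φ (TensorProduct.map ξ ψ) hφ hh z) =
      TensorProduct.map ξ (map φ ψ hφ hψ) (str f δ h a z) := by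
  have e1 : ∀ (x : B ⊗[k] V) (y : X ⊗[k] W),
      nn r' l' a' (TensorProduct.map .id φ x ⊗ₜ TensorProduct.map ξ ψ y) =
      TensorProduct.map ξ (map φ ψ hφ hψ) (nn r l a (x ⊗ₜ y)) := by
    intro x y
    induction x with
    | zero => simp only [LinearMap.map_zero, LinearEquiv.map_zero, LinearMap.zero_apply,
        TensorProduct.zero_tmul, TensorProduct.tmul_zero, smul_zero]
    | add x y hx hy => simp only [LinearMap.map_add, LinearEquiv.map_add, TensorProduct.add_tmul, hx, hy]
    | tmul b v =>
      induction y with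
      | zero => simp only [LinearMap.map_zero, LinearEquiv.map_zero, LinearMap.zero_apply,
          TensorProduct.zero_tmul, TensorProduct.tmul_zero, smul_zero]
      | add x y hx hy => simp only [LinearMap.map_add, LinearEquiv.map_add, TensorProduct.tmul_add, hx, hy]
      | tmul c w => simp [hξ]
  refine LinearMap.congr_fun (f := str f δ₁ h₁ a' ∘ₗ
      map (r' := r') (l' := trep f a' l') φ (TensorProduct.map ξ ψ) hφ hh)
    (g := TensorProduct.map ξ (map φ ψ hφ hψ) ∘ₗ str f δ h a) (ext fun v w => ?_) z
  simp only [LinearMap.comp_apply, str_mk, map_mk, TensorProduct.map_tmul, cφ]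
  exact e1 _ _

lemma str_assoc {X' : Type u} [AddCommGroup X'] [Module k X'] (a : B →ₐ[k] Module.End k X)
    (a' : B →ₐ[k] Module.End k X')
    (c : ∀ v, TensorProduct.assoc k B B V (TensorProduct.map (Coalgebra.comul (R := k)) .id
      (δ v)) = TensorProduct.map .id δ (δ v)) (hh)
    (z : Bal r (trep f (trep (Bialgebra.comulAlgHom k B) a a') l)) :
    TensorProduct.assoc k X X' (Bal r l)
        (str f δ h (trep (Bialgebra.comulAlgHom k B) a a') z) =
      TensorProduct.map .id (str f δ h a') (str f δ h a
        (map (l' := trep f a (trep f a' l)) .id (TensorProduct.assoc k X X' W).toLinearMap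
          (fun _ _ => rfl) hh z)) := by
  let m : (B ⊗[k] (B ⊗[k] V)) ⊗[k] (X ⊗[k] (X' ⊗[k] W)) →ₗ[k] X ⊗[k] (X' ⊗[k] Bal r l) :=
    TensorProduct.map (TensorProduct.lift a.toLinearMap) (nn r l a') ∘ₗ
      (TensorProduct.tensorTensorTensorComm k B (B ⊗[k] V) X (X' ⊗[k] W)).toLinearMap
  have e1 : ∀ (v : B ⊗[k] V) (x : X) (x' : X') (w : W), TensorProduct.assoc k X X' (Bal r l)
      (nn r l (trep (Bialgebra.comulAlgHom k B) a a') (v ⊗ₜ ((x ⊗ₜ x') ⊗ₜ w))) =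
      m (TensorProduct.assoc k B B V (TensorProduct.map (Coalgebra.comul (R := k)) .id v) ⊗ₜ
        (x ⊗ₜ (x' ⊗ₜ w))) := by
    intro v x x' w
    induction v with
    | zero => simp only [LinearMap.map_zero, LinearEquiv.map_zero, LinearMap.zero_apply,
        TensorProduct.zero_tmul, TensorProduct.tmul_zero, smul_zero]
    | add x y hx hy => simp only [LinearMap.map_add, LinearEquiv.map_add, TensorProduct.add_tmul, hx, hy]
    | tmul b v =>
      simp only [nn_tmul, trep_apply, TensorProduct.map_tmul, Bialgebra.comulAlgHom_apply,
        LinearMap.id_apply]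
      induction Coalgebra.comul (R := k) b with
      | zero => simp only [LinearMap.map_zero, LinearEquiv.map_zero, LinearMap.zero_apply,
          TensorProduct.zero_tmul, TensorProduct.tmul_zero, smul_zero]
      | add x y hx hy =>
        simp only [LinearMap.map_add, LinearEquiv.map_add, TensorProduct.add_tmul, LinearMap.add_apply, hx, hy]
      | tmul b b' => rfl
  have e2 : ∀ (v : B ⊗[k] V) (x : X) (x' : X') (w : W),
      TensorProduct.map .id (str f δ h a') (nn r (trep f a' l) a (v ⊗ₜ (x ⊗ₜ (x' ⊗ₜ w)))) =
      m (TensorProduct.map .id δ v ⊗ₜ (x ⊗ₜ (x' ⊗ₜ w))) := by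
    intro v x x' w
    induction v with
    | zero => simp only [LinearMap.map_zero, LinearEquiv.map_zero, LinearMap.zero_apply,
        TensorProduct.zero_tmul, TensorProduct.tmul_zero, smul_zero]
    | add x y hx hy => simp only [LinearMap.map_add, LinearEquiv.map_add, TensorProduct.add_tmul, hx, hy]
    | tmul b v => rfl
  refine LinearMap.congr_fun (f := (TensorProduct.assoc k X X' (Bal r l)).toLinearMap ∘ₗ
      str f δ h (trep (Bialgebra.comulAlgHom k B) a a'))
    (g := TensorProduct.map .id (str f δ h a') ∘ₗ str f δ h a ∘ₗ
      map (l' := trep f a (trep f a' l)) .id (TensorProduct.assoc k X X' W).toLinearMap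
          (fun _ _ => rfl) hh) (ext fun v w => ?_) z
  simp only [LinearMap.comp_apply, str_mk, map_mk, TensorProduct.map_tmul, LinearEquiv.coe_coe,
    LinearMap.id_apply]
  induction w with
  | zero => simp only [LinearMap.map_zero, LinearEquiv.map_zero, LinearMap.zero_apply,
      TensorProduct.zero_tmul, TensorProduct.tmul_zero, smul_zero]
  | add x y hx hy => simp only [LinearMap.map_add, LinearEquiv.map_add, TensorProduct.tmul_add, hx, hy]
  | tmul y w =>
    induction y with
    | zero => simp only [LinearMap.map_zero, LinearEquiv.map_zero, LinearMap.zero_apply,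
        TensorProduct.zero_tmul, TensorProduct.tmul_zero, smul_zero]
    | add x y hx hy => simp only [LinearMap.map_add, LinearEquiv.map_add, TensorProduct.tmul_add, TensorProduct.add_tmul, hx, hy]
    | tmul x x' => exact (e1 _ _ _ _).trans ((congrArg (fun t => m (t ⊗ₜ _)) (c v)).trans
        (e2 _ _ _ _).symm)

lemma str_unit
    (c : ∀ v, TensorProduct.lid k V (TensorProduct.map (Coalgebra.counit (R := k)) .id
      (δ v)) = v) (hh) (z : Bal r l) :
    str f δ h (crep (Bialgebra.counitAlgHom k B))
      (map (l' := trep f (crep (Bialgebra.counitAlgHom k B)) l) .id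
        (TensorProduct.lid k W).symm.toLinearMap (fun _ _ => rfl) hh z) =
      (TensorProduct.lid k (Bal r l)).symm z := by
  have e1 : ∀ (v : B ⊗[k] V) (w : W),
      nn r l (crep (Bialgebra.counitAlgHom k B)) (v ⊗ₜ (1 ⊗ₜ w)) =
      (TensorProduct.lid k (Bal r l)).symm (mk r l
        (TensorProduct.lid k V (TensorProduct.map (Coalgebra.counit (R := k)) .id v) ⊗ₜ w)) := by
    intro v w
    induction v with
    | zero => simp only [LinearMap.map_zero, LinearEquiv.map_zero, LinearMap.zero_apply,
        TensorProduct.zero_tmul, TensorProduct.tmul_zero, smul_zero]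
    | add x y hx hy => simp only [LinearMap.map_add, LinearEquiv.map_add, TensorProduct.add_tmul, hx, hy]
    | tmul b v =>
      simp only [nn_tmul, crep_apply, TensorProduct.map_tmul, TensorProduct.lid_tmul,
        Bialgebra.counitAlgHom_apply, ← TensorProduct.smul_tmul', map_smul, LinearMap.id_apply,
        TensorProduct.lid_symm_apply, mul_one]
      rw [TensorProduct.smul_tmul', smul_eq_mul, mul_one]
  refine LinearMap.congr_fun (f := str f δ h (crep (Bialgebra.counitAlgHom k B)) ∘ₗ
      (map (l' := trep f (crep (Bialgebra.counitAlgHom k B)) l) .id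
        (TensorProduct.lid k W).symm.toLinearMap (fun _ _ => rfl) hh))
    (g := (TensorProduct.lid k (Bal r l)).symm.toLinearMap) (ext fun v w => ?_) z
  simp only [LinearMap.comp_apply, str_mk, map_mk, TensorProduct.map_tmul, LinearEquiv.coe_coe,
    LinearMap.id_apply, TensorProduct.lid_symm_apply]
  exact (e1 _ _).trans (by rw [c, TensorProduct.lid_symm_apply])

end modStr

end Bal

end Balanced

section RelBimod

open FDMod MonoidalLeftAction MonoidalRightAction

variable {k : Type u} [Field k] {A B : Type u} [Ring A] [Bialgebra k A] [Ring B] [Bialgebra k B]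

/-- The objects of `{}^B_K M_S`: finite-dimensional `(K, S)`-bimodules `P` with a left
`B`-coaction `δ p = p₍₋₁₎ ⊗ p₍₀₎` that is a morphism of bimodules, that is,
`δ (r p s) = π_B(r₍₋₁₎) p₍₋₁₎ π_B(s₍₋₁₎) ⊗ r₍₀₎ p₍₀₎ s₍₀₎`.
Here `ρR s p` is `p · s`. -/
structure RelBimod (K S : ComodAlg k (Cop A ⊗[k] B)) extends FDMod k K.carrier where
  ρR : S.carrier →ₗ[k] Module.End k carrier
  ρR_one (p : carrier) : ρR 1 p = p
  ρR_mul (s t : S.carrier) (p : carrier) : ρR (s * t) p = ρR t (ρR s p)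
  ρ_ρR (r : K.carrier) (s : S.carrier) (p : carrier) : ρ r (ρR s p) = ρR s (ρ r p)
  δ : carrier →ₗ[k] B ⊗[k] carrier
  δ_coassoc (p : carrier) :
    TensorProduct.assoc k B B carrier
      (TensorProduct.map (Coalgebra.comul (R := k)) .id (δ p)) = TensorProduct.map .id δ (δ p)
  δ_counit (p : carrier) :
    TensorProduct.lid k carrier (TensorProduct.map (Coalgebra.counit (R := k)) .id (δ p)) = p
  δ_left (r : K.carrier) (p : carrier) :
    δ (ρ r p) = trep K.coB (Algebra.lmul k B) ρ r (δ p)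
  δ_right (s : S.carrier) (p : carrier) :
    δ (ρR s p) = tact (LinearMap.mul k B).flip ρR (S.coB s) (δ p)

namespace RelBimod

section Category

variable {K S : ComodAlg k (Cop A ⊗[k] B)}

/-- The space of `B`-colinear bimodule maps. -/
def homs (P Q : RelBimod K S) : Submodule k (P.carrier →ₗ[k] Q.carrier) where
  carrier := {f | (∀ r p, f (P.ρ r p) = Q.ρ r (f p)) ∧ (∀ s p, f (P.ρR s p) = Q.ρR s (f p)) ∧
    ∀ p, Q.δ (f p) = TensorProduct.map .id f (P.δ p)}
  add_mem' {f g} hf hg := by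
    refine ⟨fun r p => ?_, fun s p => ?_, fun p => ?_⟩
    · have h1 := hf.1 r p
      have h2 := hg.1 r p
      simp [h1, h2]
    · have h1 := hf.2.1 s p
      have h2 := hg.2.1 s p
      simp [h1, h2]
    · have h1 := hf.2.2 p
      have h2 := hg.2.2 p
      rw [TensorProduct.map_add_right]
      simp [h1, h2]
  zero_mem' := ⟨fun r p => by simp, fun s p => by simp, fun p => by
    rw [TensorProduct.map_zero_right]
    simp⟩
  smul_mem' c f hf := by
    refine ⟨fun r p => ?_, fun s p => ?_, fun p => ?_⟩
    · have h1 := hf.1 r p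
      simp [h1]
    · have h1 := hf.2.1 s p
      simp [h1]
    · have h1 := hf.2.2 p
      rw [TensorProduct.map_smul_right]
      simp [h1]

/-- The category `{}^B_K M_S`. -/
instance : Category (RelBimod K S) where
  Hom P Q := homs P Q
  id P := ⟨LinearMap.id, fun _ _ => rfl, fun _ _ => rfl, fun p => by
    rw [TensorProduct.map_id]
    rfl⟩
  comp f g := ⟨g.1 ∘ₗ f.1, fun r p => by simp [f.2.1 r p, g.2.1 r],
    fun s p => by simp [f.2.2.1 s p, g.2.2.1 s], fun p => by
      rw [LinearMap.comp_apply, g.2.2.2, f.2.2.2, ← LinearMap.comp_apply, ← TensorProduct.map_comp]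
      rfl⟩

/-- The linear map underlying a morphism. -/
def lin {P Q : RelBimod K S} (f : P ⟶ Q) : P.carrier →ₗ[k] Q.carrier := f.1

/-- A morphism from a colinear bimodule map. -/
def mk' {P Q : RelBimod K S} (f : P.carrier →ₗ[k] Q.carrier)
    (h₁ : ∀ r p, f (P.ρ r p) = Q.ρ r (f p)) (h₂ : ∀ s p, f (P.ρR s p) = Q.ρR s (f p))
    (h₃ : ∀ p, Q.δ (f p) = TensorProduct.map .id f (P.δ p)) : P ⟶ Q := ⟨f, h₁, h₂, h₃⟩

lemma hom_ext {P Q : RelBimod K S} {f g : P ⟶ Q} (h : lin f = lin g) : f = g := Subtype.ext h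

lemma lin_ρ {P Q : RelBimod K S} (f : P ⟶ Q) (r : K.carrier) (p : P.carrier) :
    lin f (P.ρ r p) = Q.ρ r (lin f p) := f.2.1 r p

lemma lin_ρR {P Q : RelBimod K S} (f : P ⟶ Q) (s : S.carrier) (p : P.carrier) :
    lin f (P.ρR s p) = Q.ρR s (lin f p) := f.2.2.1 s p

lemma lin_δ {P Q : RelBimod K S} (f : P ⟶ Q) (p : P.carrier) :
    Q.δ (lin f p) = TensorProduct.map .id (lin f) (P.δ p) := f.2.2.2 p

instance : Preadditive (RelBimod K S) where
  homGroup P Q := inferInstanceAs (AddCommGroup (homs P Q))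
  add_comp P Q R f f' g := Subtype.ext (LinearMap.ext fun m => map_add g.1 (f.1 m) (f'.1 m))
  comp_add P Q R f g g' := Subtype.ext (LinearMap.ext fun m => rfl)

instance : Linear k (RelBimod K S) where
  homModule P Q := inferInstanceAs (Module k (homs P Q))
  smul_comp P Q R c f g := Subtype.ext (LinearMap.ext fun m => map_smul g.1 c (f.1 m))
  comp_smul P Q R f c g := Subtype.ext (LinearMap.ext fun m => rfl)

/-- An isomorphism from a colinear bimodule equivalence. -/
def isoMk {P Q : RelBimod K S} (e : P.carrier ≃ₗ[k] Q.carrier)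
    (h₁ : ∀ r p, e (P.ρ r p) = Q.ρ r (e p)) (h₂ : ∀ s p, e (P.ρR s p) = Q.ρR s (e p))
    (h₃ : ∀ p, Q.δ (e p) = TensorProduct.map .id e.toLinearMap (P.δ p)) : P ≅ Q where
  hom := mk' e.toLinearMap h₁ h₂ h₃
  inv := mk' e.symm.toLinearMap (fun s m => e.injective (by simp [h₁]))
    (fun s m => e.injective (by simp [h₂])) fun m => by
      obtain ⟨p, rfl⟩ := e.surjective m
      have h : e.symm.toLinearMap ∘ₗ e.toLinearMap = LinearMap.id := by
        ext
        simp
      have h' := LinearMap.congr_fun (TensorProduct.map_comp (LinearMap.id (R := k) (M := B))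
        e.symm.toLinearMap .id e.toLinearMap) (P.δ p)
      rw [h, LinearMap.id_comp, TensorProduct.map_id, LinearMap.id_apply] at h'
      rw [h₃]
      exact (congrArg P.δ (e.symm_apply_apply p)).trans h'
  hom_inv_id := hom_ext (LinearMap.ext fun p => e.symm_apply_apply p)
  inv_hom_id := hom_ext (LinearMap.ext fun p => e.apply_symm_apply p)

end Category

variable {K S L : ComodAlg k (Cop A ⊗[k] B)}

/-- The bimodule `P ⊗_S Q` with the coaction `p ⊗ q ↦ p₍₋₁₎ q₍₋₁₎ ⊗ (p₍₀₎ ⊗ q₍₀₎)`. -/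
abbrev comp (P : RelBimod K S) (Q : RelBimod S L) : RelBimod K L where
  carrier := Bal P.ρR Q.ρ
  ρ := Bal.repL Q.ρ P.ρ fun r s p => P.ρ_ρR r s p
  ρR := Bal.repR P.ρR Q.ρR fun t s q => (Q.ρ_ρR s t q).symm
  ρR_one z := LinearMap.congr_fun (g := LinearMap.id) (Bal.ext fun p q => by
    simp [Q.ρR_one]) z
  ρR_mul s t z := LinearMap.congr_fun
    (g := Bal.repR P.ρR Q.ρR (fun t s q => (Q.ρ_ρR s t q).symm) t ∘ₗ
      Bal.repR P.ρR Q.ρR (fun t s q => (Q.ρ_ρR s t q).symm) s)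
    (Bal.ext fun p q => by simp [Q.ρR_mul]) z
  ρ_ρR r s z := LinearMap.congr_fun
    (f := Bal.repL Q.ρ P.ρ (fun r s p => P.ρ_ρR r s p) r ∘ₗ
      Bal.repR P.ρR Q.ρR (fun t s q => (Q.ρ_ρR s t q).symm) s)
    (g := Bal.repR P.ρR Q.ρR (fun t s q => (Q.ρ_ρR s t q).symm) s ∘ₗ
      Bal.repL Q.ρ P.ρ (fun r s p => P.ρ_ρR r s p) r)
    (Bal.ext fun p q => by simp) z
  δ := Bal.coact S.coB P.δ Q.δ P.δ_right Q.δ_left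
  δ_coassoc := Bal.coact_coassoc _ _ P.δ_coassoc Q.δ_coassoc
  δ_counit := Bal.coact_counit _ _ P.δ_counit Q.δ_counit
  δ_left := Bal.coact_repL _ _ _ _ P.δ_left
  δ_right := Bal.coact_repR _ _ _ _ Q.δ_right

/-- The functoriality of `P ⊗_S Q`. -/
abbrev compMap {P P' : RelBimod K S} {Q Q' : RelBimod S L} (f : P ⟶ P') (g : Q ⟶ Q') :
    comp P Q ⟶ comp P' Q' :=
  mk' (P := comp P Q) (Q := comp P' Q') (Bal.map (lin f) (lin g) (lin_ρR f) (lin_ρ g))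
    (fun r z => LinearMap.congr_fun
      (f := Bal.map (lin f) (lin g) (lin_ρR f) (lin_ρ g) ∘ₗ (comp P Q).ρ r)
      (g := (comp P' Q').ρ r ∘ₗ Bal.map (lin f) (lin g) (lin_ρR f) (lin_ρ g))
      (Bal.ext fun p q => congrArg (fun t => Bal.mk P'.ρR Q'.ρ (t ⊗ₜ lin g q)) (lin_ρ f r p)) z)
    (fun s z => LinearMap.congr_fun
      (f := Bal.map (lin f) (lin g) (lin_ρR f) (lin_ρ g) ∘ₗ (comp P Q).ρR s)
      (g := (comp P' Q').ρR s ∘ₗ Bal.map (lin f) (lin g) (lin_ρR f) (lin_ρ g))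
      (Bal.ext fun p q => congrArg (fun t => Bal.mk P'.ρR Q'.ρ (lin f p ⊗ₜ t)) (lin_ρR g s q)) z)
    (Bal.coact_map P.δ_right Q.δ_left P'.δ_right Q'.δ_left _ _ _ _ (lin_δ f) (lin_δ g))

section Raw

variable {V W W' : Type u} [AddCommGroup V] [Module k V] [AddCommGroup W] [Module k W]
  [AddCommGroup W'] [Module k W']

/-- The coaction `y ⊗ q ↦ q₍₋₁₎ ⊗ (y ⊗ q₍₀₎)`. -/
def coactR (V : Type u) [AddCommGroup V] [Module k V] (δ : W →ₗ[k] B ⊗[k] W) :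
    V ⊗[k] W →ₗ[k] B ⊗[k] (V ⊗[k] W) :=
  (TensorProduct.leftComm k V B W).toLinearMap ∘ₗ TensorProduct.map .id δ

lemma coactR_tmul (δ : W →ₗ[k] B ⊗[k] W) (v : V) (w : W) :
    coactR V δ (v ⊗ₜ w) = TensorProduct.leftComm k V B W (v ⊗ₜ δ w) := rfl

lemma coactR_coassoc (δ : W →ₗ[k] B ⊗[k] W)
    (h : ∀ w, TensorProduct.assoc k B B W (TensorProduct.map (Coalgebra.comul (R := k)) .id
      (δ w)) = TensorProduct.map .id δ (δ w)) (z : V ⊗[k] W) :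
    TensorProduct.assoc k B B (V ⊗[k] W) (TensorProduct.map (Coalgebra.comul (R := k)) .id
      (coactR V δ z)) = TensorProduct.map .id (coactR V δ) (coactR V δ z) := by
  let T : V →ₗ[k] (B ⊗[k] (B ⊗[k] W)) →ₗ[k] B ⊗[k] (B ⊗[k] (V ⊗[k] W)) :=
    TensorProduct.curry (TensorProduct.map .id (TensorProduct.leftComm k V B W).toLinearMap ∘ₗ
      (TensorProduct.leftComm k V B (B ⊗[k] W)).toLinearMap)
  have e1 : ∀ (v : V) (w : B ⊗[k] W),
      TensorProduct.assoc k B B (V ⊗[k] W) (TensorProduct.map (Coalgebra.comul (R := k)) .id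
        (TensorProduct.leftComm k V B W (v ⊗ₜ w))) =
      T v (TensorProduct.assoc k B B W (TensorProduct.map (Coalgebra.comul (R := k)) .id w)) := by
    intro v w
    induction w with
    | zero => simp only [LinearMap.map_zero, LinearEquiv.map_zero, LinearMap.zero_apply,
        TensorProduct.zero_tmul, TensorProduct.tmul_zero, smul_zero]
    | add x y hx hy => simp only [LinearMap.map_add, LinearEquiv.map_add, TensorProduct.tmul_add, hx, hy]
    | tmul b w =>
      simp only [TensorProduct.leftComm_tmul, TensorProduct.map_tmul, LinearMap.id_apply]
      induction Coalgebra.comul (R := k) b with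
      | zero => simp only [LinearMap.map_zero, LinearEquiv.map_zero, LinearMap.zero_apply,
          TensorProduct.zero_tmul, TensorProduct.tmul_zero, smul_zero]
      | add x y hx hy => simp only [LinearMap.map_add, LinearEquiv.map_add, TensorProduct.add_tmul, hx, hy]
      | tmul b b' => rfl
  have e2 : ∀ (v : V) (w : B ⊗[k] W),
      TensorProduct.map .id (coactR V δ) (TensorProduct.leftComm k V B W (v ⊗ₜ w)) =
      T v (TensorProduct.map .id δ w) := by
    intro v w
    induction w with
    | zero => simp only [LinearMap.map_zero, LinearEquiv.map_zero, LinearMap.zero_apply,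
        TensorProduct.zero_tmul, TensorProduct.tmul_zero, smul_zero]
    | add x y hx hy => simp only [LinearMap.map_add, LinearEquiv.map_add, TensorProduct.tmul_add, hx, hy]
    | tmul b w => rfl
  induction z with
  | zero => simp only [LinearMap.map_zero, LinearEquiv.map_zero, LinearMap.zero_apply,
      TensorProduct.zero_tmul, TensorProduct.tmul_zero, smul_zero]
  | add x y hx hy => simp only [LinearMap.map_add, LinearEquiv.map_add, hx, hy]
  | tmul v w => rw [coactR_tmul, e1, e2, h]

lemma coactR_counit (δ : W →ₗ[k] B ⊗[k] W)
    (h : ∀ w, TensorProduct.lid k W (TensorProduct.map (Coalgebra.counit (R := k)) .id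
      (δ w)) = w) (z : V ⊗[k] W) :
    TensorProduct.lid k (V ⊗[k] W) (TensorProduct.map (Coalgebra.counit (R := k)) .id
      (coactR V δ z)) = z := by
  have e1 : ∀ (v : V) (w : B ⊗[k] W),
      TensorProduct.lid k (V ⊗[k] W) (TensorProduct.map (Coalgebra.counit (R := k)) .id
        (TensorProduct.leftComm k V B W (v ⊗ₜ w))) =
      v ⊗ₜ TensorProduct.lid k W (TensorProduct.map (Coalgebra.counit (R := k)) .id w) := by
    intro v w
    induction w with
    | zero => simp only [LinearMap.map_zero, LinearEquiv.map_zero, LinearMap.zero_apply,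
        TensorProduct.zero_tmul, TensorProduct.tmul_zero, smul_zero]
    | add x y hx hy => simp only [LinearMap.map_add, LinearEquiv.map_add, TensorProduct.tmul_add, hx, hy]
    | tmul b w => simp
  induction z with
  | zero => simp only [LinearMap.map_zero, LinearEquiv.map_zero, LinearMap.zero_apply,
      TensorProduct.zero_tmul, TensorProduct.tmul_zero, smul_zero]
  | add x y hx hy => simp only [LinearMap.map_add, LinearEquiv.map_add, hx, hy]
  | tmul v w => rw [coactR_tmul, e1, h]

lemma coactR_left {S : ComodAlg k (Cop A ⊗[k] B)} (δ : W →ₗ[k] B ⊗[k] W)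
    (a : A →ₐ[k] Module.End k V) (l : S.carrier →ₐ[k] Module.End k W)
    (h : ∀ s w, δ (l s w) = trep S.coB (Algebra.lmul k B) l s (δ w)) (s : S.carrier)
    (z : V ⊗[k] W) :
    coactR V δ (trep S.coA a l s z) =
      trep S.coB (Algebra.lmul k B) (trep S.coA a l) s (coactR V δ z) := by
  have e := trep_map S.coA a l a (trep S.coB (Algebra.lmul k B) l) .id δ (fun _ _ => rfl) h s z
  exact (congrArg (TensorProduct.leftComm k V B W) e).trans
    (trep_leftComm S.coA S.coB S.coB S.coA S.coA_coB a (Algebra.lmul k B) l s _)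

lemma coactR_right {S : Type u} [Ring S] [Algebra k S] (f : S →ₐ[k] B ⊗[k] S)
    (δ : W →ₗ[k] B ⊗[k] W) (r : S →ₗ[k] Module.End k W)
    (h : ∀ s w, δ (r s w) = tact (LinearMap.mul k B).flip r (f s) (δ w)) (s : S)
    (z : V ⊗[k] W) :
    coactR V δ (TensorProduct.map .id (r s) z) =
      tact (LinearMap.mul k B).flip (LinearMap.lTensorHom V ∘ₗ r) (f s) (coactR V δ z) := by
  have e1 : ∀ (u : B ⊗[k] S) (v : V) (w : B ⊗[k] W),
      TensorProduct.leftComm k V B W (v ⊗ₜ tact (LinearMap.mul k B).flip r u w) =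
      tact (LinearMap.mul k B).flip (LinearMap.lTensorHom V ∘ₗ r) u
        (TensorProduct.leftComm k V B W (v ⊗ₜ w)) := by
    intro u v w
    induction u with
    | zero => simp only [LinearMap.map_zero, LinearEquiv.map_zero, LinearMap.zero_apply,
        TensorProduct.zero_tmul, TensorProduct.tmul_zero, smul_zero]
    | add x y hx hy => simp only [LinearMap.map_add, LinearEquiv.map_add, LinearMap.add_apply, TensorProduct.tmul_add, hx, hy]
    | tmul c s =>
      induction w with
      | zero => simp only [LinearMap.map_zero, LinearEquiv.map_zero, LinearMap.zero_apply,
          TensorProduct.zero_tmul, TensorProduct.tmul_zero, smul_zero]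
      | add x y hx hy => simp only [LinearMap.map_add, LinearEquiv.map_add, TensorProduct.tmul_add, hx, hy]
      | tmul b w => rfl
  induction z with
  | zero => simp only [LinearMap.map_zero, LinearEquiv.map_zero, LinearMap.zero_apply,
      TensorProduct.zero_tmul, TensorProduct.tmul_zero, smul_zero]
  | add x y hx hy => simp only [LinearMap.map_add, LinearEquiv.map_add, hx, hy]
  | tmul v w =>
    rw [TensorProduct.map_tmul, coactR_tmul, coactR_tmul, h, e1]
    rfl

lemma coactR_map {V' : Type u} [AddCommGroup V'] [Module k V'] (δ : W →ₗ[k] B ⊗[k] W)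
    (δ' : W' →ₗ[k] B ⊗[k] W') (ξ : V →ₗ[k] V')
    (f : W →ₗ[k] W') (h : ∀ w, δ' (f w) = TensorProduct.map .id f (δ w)) (z : V ⊗[k] W) :
    coactR V' δ' (TensorProduct.map ξ f z) =
      TensorProduct.map .id (TensorProduct.map ξ f) (coactR V δ z) := by
  have e1 : ∀ (v : V) (w : B ⊗[k] W),
      TensorProduct.leftComm k V' B W' (ξ v ⊗ₜ TensorProduct.map .id f w) =
      TensorProduct.map .id (TensorProduct.map ξ f)
        (TensorProduct.leftComm k V B W (v ⊗ₜ w)) := by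
    intro v w
    induction w with
    | zero => simp only [LinearMap.map_zero, LinearEquiv.map_zero, LinearMap.zero_apply,
        TensorProduct.zero_tmul, TensorProduct.tmul_zero, smul_zero]
    | add x y hx hy => simp only [LinearMap.map_add, LinearEquiv.map_add, TensorProduct.tmul_add, hx, hy]
    | tmul b w => rfl
  induction z with
  | zero => simp only [LinearMap.map_zero, LinearEquiv.map_zero, LinearMap.zero_apply,
      TensorProduct.zero_tmul, TensorProduct.tmul_zero, smul_zero]
  | add x y hx hy => simp only [LinearMap.map_add, LinearEquiv.map_add, hx, hy]
  | tmul v w =>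
    rw [TensorProduct.map_tmul, coactR_tmul, coactR_tmul, h, e1]

end Raw

/-- The right action `P ⊙ᵣ Y = Y ⊗ P`, with `r · (y ⊗ p) · s = π_A(r₍₋₁₎) y ⊗ r₍₀₎ p s` and the
coaction `y ⊗ p ↦ p₍₋₁₎ ⊗ (y ⊗ p₍₀₎)`. -/
abbrev actR (P : RelBimod K S) (Y : FDMod k A) : RelBimod K S where
  toFDMod := P.toFDMod ⊙ᵣ Y
  ρR := LinearMap.lTensorHom Y.carrier ∘ₗ P.ρR
  ρR_one z := LinearMap.congr_fun (g := LinearMap.id) (TensorProduct.ext' fun y p =>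
    congrArg (fun t => y ⊗ₜ[k] t) (P.ρR_one p)) z
  ρR_mul s t z := LinearMap.congr_fun
    (g := LinearMap.lTensor Y.carrier (P.ρR t) ∘ₗ LinearMap.lTensor Y.carrier (P.ρR s))
    (TensorProduct.ext' fun y p => congrArg (fun t => y ⊗ₜ[k] t) (P.ρR_mul s t p)) z
  ρ_ρR r s z := (trep_map K.coA Y.ρ P.ρ Y.ρ P.ρ .id (P.ρR s) (fun _ _ => rfl)
    (fun r p => (P.ρ_ρR r s p).symm) r z).symm
  δ := coactR Y.carrier P.δ
  δ_coassoc := coactR_coassoc _ P.δ_coassoc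
  δ_counit := coactR_counit _ P.δ_counit
  δ_left := coactR_left P.δ Y.ρ P.ρ P.δ_left
  δ_right := coactR_right S.coB P.δ P.ρR P.δ_right

/-- The functoriality of `P ⊙ᵣ Y`. -/
abbrev actRMap {P P' : RelBimod K S} {Y Y' : FDMod k A} (f : P ⟶ P') (g : Y ⟶ Y') :
    actR P Y ⟶ actR P' Y' :=
  mk' (P := actR P Y) (Q := actR P' Y') (TensorProduct.map (FDMod.lin g) (lin f))
    (trep_map K.coA Y.ρ P.ρ Y'.ρ P'.ρ (FDMod.lin g) (lin f) (FDMod.lin_ρ g) (lin_ρ f))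
    (fun s z => LinearMap.congr_fun
      (f := TensorProduct.map (FDMod.lin g) (lin f) ∘ₗ LinearMap.lTensor Y.carrier (P.ρR s))
      (g := LinearMap.lTensor Y'.carrier (P'.ρR s) ∘ₗ TensorProduct.map (FDMod.lin g) (lin f))
      (TensorProduct.ext' fun y p => congrArg (fun t => FDMod.lin g y ⊗ₜ[k] t) (lin_ρR f s p)) z)
    (coactR_map _ _ _ _ (lin_δ f))

variable (S) in
/-- The regular bimodule `S`, with the coaction `s ↦ π_B(s₍₋₁₎) ⊗ s₍₀₎`. -/
abbrev reg : RelBimod S S where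
  carrier := S.carrier
  ρ := Algebra.lmul k S.carrier
  ρR := (LinearMap.mul k S.carrier).flip
  ρR_one p := mul_one p
  ρR_mul s t p := (mul_assoc p s t).symm
  ρ_ρR r s p := (mul_assoc r p s).symm
  δ := S.coB.toLinearMap
  δ_coassoc := S.coB_coassoc
  δ_counit := S.coB_counit
  δ_left r p := by
    have e : ∀ u v : B ⊗[k] S.carrier,
        u * v = tact (LinearMap.mul k B) (LinearMap.mul k S.carrier) u v := by
      intro u v
      induction u with
      | zero => simp
      | add x y hx hy => simp only [LinearMap.map_add, LinearEquiv.map_add, add_mul, LinearMap.add_apply, hx, hy]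
      | tmul b s =>
        induction v with
        | zero => simp
        | add x y hx hy => simp only [LinearMap.map_add, LinearEquiv.map_add, mul_add, hx, hy]
        | tmul c t =>
          rw [Algebra.TensorProduct.tmul_mul_tmul]
          rfl
    exact (map_mul S.coB r p).trans (e _ _)
  δ_right s p := by
    have e : ∀ u v : B ⊗[k] S.carrier,
        v * u = tact (LinearMap.mul k B).flip (LinearMap.mul k S.carrier).flip u v := by
      intro u v
      induction u with
      | zero => simp
      | add x y hx hy => simp only [LinearMap.map_add, LinearEquiv.map_add, mul_add, LinearMap.add_apply, hx, hy]
      | tmul b s =>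
        induction v with
        | zero => simp
        | add x y hx hy => simp only [LinearMap.map_add, LinearEquiv.map_add, add_mul, hx, hy]
        | tmul c t =>
          rw [Algebra.TensorProduct.tmul_mul_tmul]
          rfl
    exact (map_mul S.coB p s).trans (e _ _)

end RelBimod

end RelBimod

section BalancedIsos

variable {k : Type u} [Field k]
  {S R L A B : Type u} [Ring S] [Algebra k S] [Ring R] [Algebra k R] [Ring L] [Algebra k L]
  [Ring A] [Bialgebra k A] [Ring B] [Bialgebra k B]
  {V W X Y Y' Y'' Z : Type u} [AddCommGroup V] [Module k V] [AddCommGroup W] [Module k W]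
  [AddCommGroup Z] [Module k Z] [AddCommGroup Y] [Module k Y] [AddCommGroup Y'] [Module k Y']
  [AddCommGroup X] [Module k X] [AddCommGroup Y''] [Module k Y'']

namespace Bal

variable {r : S →ₗ[k] Module.End k V}

lemma ext₂ {l : S →ₐ[k] Module.End k (Y ⊗[k] W)} {f g : Bal r l →ₗ[k] Z}
    (h : ∀ (v : V) (y : Y) (w : W), f (mk r l (v ⊗ₜ[k] (y ⊗ₜ[k] w))) =
      g (mk r l (v ⊗ₜ[k] (y ⊗ₜ[k] w)))) : f = g :=
  ext fun v w => LinearMap.congr_fun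
    (f := f ∘ₗ mk r l ∘ₗ TensorProduct.mk k V (Y ⊗[k] W) v)
    (g := g ∘ₗ mk r l ∘ₗ TensorProduct.mk k V (Y ⊗[k] W) v) (TensorProduct.ext' (h v)) w

lemma ext' {l : S →ₐ[k] Module.End k W} {f g : Bal r l →ₗ[k] Z}
    (h : ∀ v : V, f ∘ₗ mk r l ∘ₗ TensorProduct.mk k V W v =
      g ∘ₗ mk r l ∘ₗ TensorProduct.mk k V W v) : f = g :=
  ext fun v w => LinearMap.congr_fun (h v) w

lemma ext_tensor {l : S →ₐ[k] Module.End k W} {f g : Y ⊗[k] Bal r l →ₗ[k] Z}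
    (h : ∀ (y : Y) (v : V) (w : W), f (y ⊗ₜ[k] mk r l (v ⊗ₜ w)) = g (y ⊗ₜ[k] mk r l (v ⊗ₜ w))) :
    f = g :=
  TensorProduct.ext' fun y z => by
    obtain ⟨z, rfl⟩ := mk_surjective r l z
    induction z with
    | zero => simp only [LinearMap.map_zero, LinearEquiv.map_zero, LinearMap.zero_apply,
        TensorProduct.zero_tmul, TensorProduct.tmul_zero, smul_zero]
    | add z z' hz hz' => simp only [LinearMap.map_add, LinearEquiv.map_add, TensorProduct.tmul_add, hz, hz']
    | tmul v w => exact h y v w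

lemma ext_tensor' {l : S →ₐ[k] Module.End k W} {f g : Y ⊗[k] Bal r l →ₗ[k] Z}
    (h : ∀ (y : Y) (v : V), f ∘ₗ TensorProduct.mk k Y (Bal r l) y ∘ₗ mk r l ∘ₗ
      TensorProduct.mk k V W v = g ∘ₗ TensorProduct.mk k Y (Bal r l) y ∘ₗ mk r l ∘ₗ
        TensorProduct.mk k V W v) : f = g :=
  ext_tensor fun y v w => LinearMap.congr_fun (h y v) w

lemma ext_tensor₂ {l : S →ₐ[k] Module.End k W} {f g : (Y ⊗[k] Y') ⊗[k] Bal r l →ₗ[k] Z}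
    (h : ∀ (y : Y) (y' : Y') (v : V),
      f ∘ₗ TensorProduct.mk k (Y ⊗[k] Y') (Bal r l) (y ⊗ₜ[k] y') ∘ₗ mk r l ∘ₗ
        TensorProduct.mk k V W v =
      g ∘ₗ TensorProduct.mk k (Y ⊗[k] Y') (Bal r l) (y ⊗ₜ[k] y') ∘ₗ mk r l ∘ₗ
        TensorProduct.mk k V W v) : f = g :=
  ext_tensor fun y v w => by
    induction y with
    | zero => simp only [LinearMap.map_zero, LinearEquiv.map_zero, LinearMap.zero_apply,
        TensorProduct.zero_tmul, TensorProduct.tmul_zero, smul_zero]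
    | add z z' hz hz' => simp only [LinearMap.map_add, LinearEquiv.map_add, TensorProduct.add_tmul, hz, hz']
    | tmul y y' => exact LinearMap.congr_fun (h y y' v) w

section unit

variable (r)
variable (r_mul : ∀ s t p, r (s * t) p = r t (r s p))
  {f : S →ₐ[k] A ⊗[k] S} {e : A →ₐ[k] k}
  (hf : ∀ s, TensorProduct.lid k S (TensorProduct.map e.toLinearMap .id (f s)) = s)

/-- The map `V ⊗_S (k ⊗ S) → V`, `p ⊗ (c ⊗ s) ↦ c p s`. -/
def unitMap : Bal r (trep f (crep e) (Algebra.lmul k S)) →ₗ[k] V :=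
  lift (TensorProduct.lift r.flip ∘ₗ TensorProduct.map .id (TensorProduct.lid k S).toLinearMap)
    fun s v w => by
      have h := trep_lid f e hf (Algebra.lmul k S) s w
      simp only [LinearMap.comp_apply, TensorProduct.map_tmul, LinearMap.id_apply,
        LinearEquiv.coe_coe, TensorProduct.lift.tmul, LinearMap.flip_apply, h]
      exact (r_mul _ _ _).symm

lemma unitMap_mk (v : V) (w : k ⊗[k] S) :
    unitMap r r_mul hf (mk r _ (v ⊗ₜ w)) = r (TensorProduct.lid k S w) v := rfl

/-- The isomorphism `V ⊗_S (k ⊗ S) ≅ V`, `p ⊗ (c ⊗ s) ↦ c p s`. -/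
def unitEquiv (r_one : ∀ p, r 1 p = p) :
    Bal r (trep f (crep e) (Algebra.lmul k S)) ≃ₗ[k] V :=
  LinearEquiv.ofLinearMap (unitMap r r_mul hf)
    (mk r _ ∘ₗ (TensorProduct.mk k V (k ⊗[k] S)).flip (1 ⊗ₜ 1))
    (LinearMap.ext fun p => by
      simp only [LinearMap.comp_apply, LinearMap.flip_apply, TensorProduct.mk_apply]
      rw [unitMap_mk]
      simp [r_one])
    (ext fun v w => by
      simp only [LinearMap.comp_apply, LinearMap.flip_apply, TensorProduct.mk_apply]
      rw [unitMap_mk, mk_rel]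
      refine congrArg (fun t => mk r _ (v ⊗ₜ t)) ((TensorProduct.lid k S).injective ?_)
      rw [trep_lid f e hf]
      simp)

lemma unitMap_coact {g : S →ₐ[k] B ⊗[k] S} (δ : V →ₗ[k] B ⊗[k] V)
    (h : ∀ s v, δ (r s v) = tact (LinearMap.mul k B).flip r (g s) (δ v)) (h')
    (z : Bal r (trep f (crep e) (Algebra.lmul k S))) :
    δ (unitMap r r_mul hf z) = TensorProduct.map .id (unitMap r r_mul hf)
      (coact g δ (RelBimod.coactR k g.toLinearMap) h h' z) := by
  have e1 : ∀ (v : B ⊗[k] V) (u : B ⊗[k] S) (c : k),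
      TensorProduct.map .id (unitMap r r_mul hf)
        (mm r (trep f (crep e) (Algebra.lmul k S))
          (v ⊗ₜ TensorProduct.leftComm k k B S (c ⊗ₜ u))) =
      c • tact (LinearMap.mul k B).flip r u v := by
    intro v u c
    induction u with
    | zero => simp only [LinearMap.map_zero, LinearEquiv.map_zero, LinearMap.zero_apply,
        TensorProduct.zero_tmul, TensorProduct.tmul_zero, smul_zero]
    | add x y hx hy => simp only [LinearMap.map_add, LinearEquiv.map_add, LinearMap.add_apply, TensorProduct.tmul_add, smul_add,
        hx, hy]
    | tmul b s =>
      induction v with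
      | zero => simp only [LinearMap.map_zero, LinearEquiv.map_zero, LinearMap.zero_apply,
          TensorProduct.zero_tmul, TensorProduct.tmul_zero, smul_zero]
      | add x y hx hy => simp only [LinearMap.map_add, LinearEquiv.map_add, TensorProduct.add_tmul, smul_add, hx, hy]
      | tmul d p =>
        simp only [TensorProduct.leftComm_tmul, mm_tmul, TensorProduct.map_tmul, unitMap_mk,
          TensorProduct.lid_tmul, map_smul, LinearMap.smul_apply, TensorProduct.tmul_smul]
        rfl
  refine LinearMap.congr_fun (f := δ ∘ₗ unitMap r r_mul hf)
    (g := TensorProduct.map .id (unitMap r r_mul hf) ∘ₗ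
      coact g δ (RelBimod.coactR k g.toLinearMap) h h') (ext₂ fun v c s => ?_) z
  simp only [LinearMap.comp_apply, coact_mk, RelBimod.coactR_tmul, e1, unitMap_mk,
    TensorProduct.lid_tmul, map_smul, LinearMap.smul_apply, h]
  rfl

end unit

section assoc

variable (r) (f : S →ₐ[k] A ⊗[k] S) (a : A →ₐ[k] Module.End k Y) (l : S →ₐ[k] Module.End k W)

lemma regR_comm (x s : S) (z : Y ⊗[k] S) :
    (LinearMap.lTensorHom Y ∘ₗ (LinearMap.mul k S).flip) x (trep f a (Algebra.lmul k S) s z) =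
      trep f a (Algebra.lmul k S) s ((LinearMap.lTensorHom Y ∘ₗ (LinearMap.mul k S).flip) x z) :=
  trep_map f a (Algebra.lmul k S) a (Algebra.lmul k S) .id ((LinearMap.mul k S).flip x)
    (fun _ _ => rfl) (fun t m => mul_assoc t m x) s z

/-- The right action of `S` on `V ⊗_S (Y ⊗ S)`. -/
abbrev regR : S →ₗ[k] Module.End k (Bal r (trep f a (Algebra.lmul k S))) :=
  repR r (LinearMap.lTensorHom Y ∘ₗ (LinearMap.mul k S).flip) (regR_comm f a)

/-- The map `p ⊗ (y ⊗ q) ↦ (p ⊗ (y ⊗ 1)) ⊗ q`. -/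
def assocFun₀ : V ⊗[k] (Y ⊗[k] W) →ₗ[k] Bal (regR r f a) l :=
  mk (regR r f a) l ∘ₗ TensorProduct.map (mk r (trep f a (Algebra.lmul k S)) ∘ₗ
    TensorProduct.map .id ((TensorProduct.mk k Y S).flip 1)) .id ∘ₗ
      (TensorProduct.assoc k V Y W).symm.toLinearMap

lemma assocFun₀_tmul (v : V) (y : Y) (w : W) : assocFun₀ r f a l (v ⊗ₜ (y ⊗ₜ w)) =
    mk (regR r f a) l (mk r (trep f a (Algebra.lmul k S)) (v ⊗ₜ (y ⊗ₜ 1)) ⊗ₜ w) := rfl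

lemma assocFun₀_bal (s : S) (v : V) (z : Y ⊗[k] W) :
    assocFun₀ r f a l (r s v ⊗ₜ z) = assocFun₀ r f a l (v ⊗ₜ trep f a l s z) := by
  have e1 : ∀ (u : A ⊗[k] S) (v : V) (y : Y) (w : W),
      assocFun₀ r f a l (v ⊗ₜ tact a.toLinearMap l.toLinearMap u (y ⊗ₜ w)) =
      mk (regR r f a) l (mk r (trep f a (Algebra.lmul k S))
        (v ⊗ₜ tact a.toLinearMap (LinearMap.mul k S) u (y ⊗ₜ 1)) ⊗ₜ w) := by
    intro u v y w
    induction u with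
    | zero => simp only [LinearMap.map_zero, LinearEquiv.map_zero, LinearMap.zero_apply,
        TensorProduct.zero_tmul, TensorProduct.tmul_zero, smul_zero]
    | add x y hx hy => simp only [LinearMap.map_add, LinearEquiv.map_add, LinearMap.add_apply, TensorProduct.tmul_add,
        TensorProduct.add_tmul, hx, hy]
    | tmul b s =>
      simp only [tact_tmul, AlgHom.toLinearMap_apply, assocFun₀_tmul, ← mk_rel]
      congr 2
      simp only [regR, repR_mk]
      congr 2
      exact congrArg (fun t => a b y ⊗ₜ[k] t) ((one_mul s).trans (mul_one s).symm)
  induction z with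
  | zero => simp only [LinearMap.map_zero, LinearEquiv.map_zero, LinearMap.zero_apply,
      TensorProduct.zero_tmul, TensorProduct.tmul_zero, smul_zero]
  | add x y hx hy => simp only [LinearMap.map_add, LinearEquiv.map_add, TensorProduct.tmul_add, hx, hy]
  | tmul y w =>
    rw [assocFun₀_tmul, mk_rel, trep_apply f a l, e1]
    rfl

/-- The map `p ⊗ (y ⊗ t) ↦ (q ↦ p ⊗ (y ⊗ t q))`. -/
def assocInv₀ : V ⊗[k] (Y ⊗[k] S) →ₗ[k] W →ₗ[k] Bal r (trep f a l) :=
  TensorProduct.curry (mk r (trep f a l) ∘ₗ TensorProduct.map .id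
    (TensorProduct.map .id (TensorProduct.lift l.toLinearMap) ∘ₗ
      (TensorProduct.assoc k Y S W).toLinearMap) ∘ₗ
        (TensorProduct.assoc k V (Y ⊗[k] S) W).toLinearMap)

lemma assocInv₀_tmul (v : V) (y : Y) (t : S) (w : W) :
    assocInv₀ r f a l (v ⊗ₜ (y ⊗ₜ t)) w = mk r (trep f a l) (v ⊗ₜ (y ⊗ₜ l t w)) := rfl

lemma assocInv₀_bal (s : S) (v : V) (z : Y ⊗[k] S) :
    assocInv₀ r f a l (r s v ⊗ₜ z) =
      assocInv₀ r f a l (v ⊗ₜ trep f a (Algebra.lmul k S) s z) := by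
  have e1 : ∀ (u : A ⊗[k] S) (v : V) (y : Y) (t : S) (w : W),
      assocInv₀ r f a l (v ⊗ₜ tact a.toLinearMap (LinearMap.mul k S) u (y ⊗ₜ t)) w =
      mk r (trep f a l) (v ⊗ₜ tact a.toLinearMap l.toLinearMap u (y ⊗ₜ l t w)) := by
    intro u v y t w
    induction u with
    | zero => simp only [LinearMap.map_zero, LinearEquiv.map_zero, LinearMap.zero_apply,
        TensorProduct.zero_tmul, TensorProduct.tmul_zero, smul_zero]
    | add x y hx hy => simp only [LinearMap.map_add, LinearEquiv.map_add, LinearMap.add_apply, TensorProduct.tmul_add, hx, hy]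
    | tmul b s =>
      simp only [tact_tmul, AlgHom.toLinearMap_apply, assocInv₀_tmul, LinearMap.mul_apply',
        map_mul]
      rfl
  induction z with
  | zero => simp only [LinearMap.map_zero, LinearEquiv.map_zero, LinearMap.zero_apply,
      TensorProduct.zero_tmul, TensorProduct.tmul_zero, smul_zero]
  | add x y hx hy => simp only [LinearMap.map_add, LinearEquiv.map_add, TensorProduct.tmul_add, hx, hy]
  | tmul y t =>
    refine LinearMap.ext fun w => ?_
    rw [assocInv₀_tmul, mk_rel]
    exact (e1 _ _ _ _ _).symm

/-- The isomorphism `V ⊗_S (Y ⊗ W) ≅ (V ⊗_S (Y ⊗ S)) ⊗_S W`,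
`p ⊗ (y ⊗ q) ↦ (p ⊗ (y ⊗ 1)) ⊗ q`. -/
def assocEquiv : Bal r (trep f a l) ≃ₗ[k] Bal (regR r f a) l :=
  LinearEquiv.ofLinearMap (lift (assocFun₀ r f a l) (assocFun₀_bal r f a l))
    (lift (TensorProduct.lift (lift (assocInv₀ r f a l) (assocInv₀_bal r f a l)))
      fun s z w => LinearMap.congr_fun
        (f := (lift (assocInv₀ r f a l) (assocInv₀_bal r f a l)).flip w ∘ₗ regR r f a s)
        (g := (lift (assocInv₀ r f a l) (assocInv₀_bal r f a l)).flip (l s w))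
        (ext₂ fun v y t => by
          simp only [LinearMap.comp_apply, regR, repR_mk, LinearMap.flip_apply, lift_mk]
          refine (assocInv₀_tmul r f a l v y (t * s) w).trans ?_
          rw [assocInv₀_tmul, map_mul]
          rfl) z)
    (ext fun z w => LinearMap.congr_fun
      (f := (lift (assocFun₀ r f a l) (assocFun₀_bal r f a l)) ∘ₗ
        (lift (assocInv₀ r f a l) (assocInv₀_bal r f a l)).flip w)
      (g := mk (regR r f a) l ∘ₗ (TensorProduct.mk k _ W).flip w)
      (ext₂ fun v y t => by
        simp only [LinearMap.comp_apply, LinearMap.flip_apply, lift_mk, assocInv₀_tmul,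
          assocFun₀_tmul, TensorProduct.mk_apply, ← mk_rel]
        congr 2
        simp only [regR, repR_mk]
        congr 2
        exact congrArg (fun t => y ⊗ₜ[k] t) (one_mul t)) z)
    (ext₂ fun v y w => (assocInv₀_tmul r f a l v y 1 w).trans (by
      rw [map_one]
      rfl))

end assoc

section assoc

variable (f : S →ₐ[k] A ⊗[k] S) (a : A →ₐ[k] Module.End k Y) (l : S →ₐ[k] Module.End k W)

lemma assocEquiv_mk (v : V) (y : Y) (w : W) :
    assocEquiv r f a l (mk r (trep f a l) (v ⊗ₜ (y ⊗ₜ w))) =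
      mk (regR r f a) l (mk r (trep f a (Algebra.lmul k S)) (v ⊗ₜ (y ⊗ₜ 1)) ⊗ₜ w) := rfl

lemma assocEquiv_repL (ρ : R →ₐ[k] Module.End k V) (h₁ : ∀ x s v, ρ x (r s v) = r s (ρ x v))
    (h₂) (x : R) (z : Bal r (trep f a l)) :
    assocEquiv r f a l (repL (trep f a l) ρ h₁ x z) =
      repL (r := regR r f a) l (repL (trep f a (Algebra.lmul k S)) ρ h₁) h₂ x
        (assocEquiv r f a l z) :=
  LinearMap.congr_fun
    (f := (assocEquiv r f a l).toLinearMap ∘ₗ repL (trep f a l) ρ h₁ x)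
    (g := repL (r := regR r f a) l (repL (trep f a (Algebra.lmul k S)) ρ h₁) h₂ x ∘ₗ
      (assocEquiv r f a l).toLinearMap)
    (ext₂ fun v y w => rfl) z

lemma assocEquiv_repR (b : L →ₗ[k] Module.End k W) (h₁) (h₂) (x : L)
    (z : Bal r (trep f a l)) :
    assocEquiv r f a l (repR (l := trep f a l) r (LinearMap.lTensorHom Y ∘ₗ b) h₁ x z) =
      repR (regR r f a) b h₂ x (assocEquiv r f a l z) :=
  LinearMap.congr_fun
    (f := (assocEquiv r f a l).toLinearMap ∘ₗ
      repR (l := trep f a l) r (LinearMap.lTensorHom Y ∘ₗ b) h₁ x)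
    (g := repR (regR r f a) b h₂ x ∘ₗ (assocEquiv r f a l).toLinearMap)
    (ext₂ fun v y w => rfl) z

lemma assocEquiv_coact {g : S →ₐ[k] B ⊗[k] S} (δ : V →ₗ[k] B ⊗[k] V) (δ' : W →ₗ[k] B ⊗[k] W)
    (h) (h₁) (h₂) (h₃) (h₄) (z : Bal r (trep f a l)) :
    coact (r := regR r f a) (l := l) g (coact g δ (RelBimod.coactR Y g.toLinearMap) h h₁) δ' h₂ h₃
        (assocEquiv r f a l z) =
      TensorProduct.map .id (assocEquiv r f a l).toLinearMap
        (coact g δ (RelBimod.coactR Y δ') h h₄ z) := by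
  have e1 : ∀ (v : B ⊗[k] V) (y : Y) (w : B ⊗[k] W),
      mm (regR r f a) l (mm r (trep f a (Algebra.lmul k S))
        (v ⊗ₜ TensorProduct.leftComm k Y B S (y ⊗ₜ (1 ⊗ₜ 1))) ⊗ₜ w) =
      TensorProduct.map .id (assocEquiv r f a l).toLinearMap
        (mm r (trep f a l) (v ⊗ₜ TensorProduct.leftComm k Y B W (y ⊗ₜ w))) := by
    intro v y w
    induction v with
    | zero => simp only [LinearMap.map_zero, LinearEquiv.map_zero, LinearMap.zero_apply,
        TensorProduct.zero_tmul, TensorProduct.tmul_zero, smul_zero]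
    | add x y hx hy => simp only [LinearMap.map_add, LinearEquiv.map_add, TensorProduct.add_tmul, hx, hy]
    | tmul b v =>
      induction w with
      | zero => simp only [LinearMap.map_zero, LinearEquiv.map_zero, LinearMap.zero_apply,
          TensorProduct.zero_tmul, TensorProduct.tmul_zero, smul_zero]
      | add x y hx hy => simp only [LinearMap.map_add, LinearEquiv.map_add, TensorProduct.tmul_add, hx, hy]
      | tmul c w =>
        simp only [TensorProduct.leftComm_tmul, mm_tmul, mul_one]
        rfl
  refine LinearMap.congr_fun
    (f := coact (r := regR r f a) (l := l) g
      (coact g δ (RelBimod.coactR Y g.toLinearMap) h h₁) δ' h₂ h₃ ∘ₗ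
        (assocEquiv r f a l).toLinearMap)
    (g := TensorProduct.map .id (assocEquiv r f a l).toLinearMap ∘ₗ
        coact g δ (RelBimod.coactR Y δ') h h₄) (ext₂ fun v y w => ?_) z
  have h1 : g.toLinearMap 1 = 1 ⊗ₜ 1 := map_one g
  refine Eq.trans ?_ (e1 (δ v) y (δ' w))
  rw [← h1]
  rfl

end assoc

section gamma

variable (Y) (r) (l : S →ₐ[k] Module.End k W)

/-- The isomorphism `Y ⊗ (V ⊗_S W) ≅ (Y ⊗ V) ⊗_S W`. -/
def gammaEquiv : Y ⊗[k] Bal r l ≃ₗ[k] Bal (LinearMap.lTensorHom Y ∘ₗ r) l :=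
  LinearEquiv.ofLinearMap
    (TensorProduct.lift (LinearMap.flip (lift (TensorProduct.curry
      (mk (LinearMap.lTensorHom Y ∘ₗ r) l ∘ₗ (TensorProduct.assoc k Y V W).symm.toLinearMap ∘ₗ
        (TensorProduct.comm k (V ⊗[k] W) Y).toLinearMap)) fun s v w => LinearMap.ext fun y =>
          mk_rel (LinearMap.lTensorHom Y ∘ₗ r) l s (y ⊗ₜ v) w)))
    (lift (TensorProduct.map .id (mk r l) ∘ₗ (TensorProduct.assoc k Y V W).toLinearMap)
      fun s z w => by
        induction z with
        | zero => simp only [LinearMap.map_zero, LinearEquiv.map_zero, LinearMap.zero_apply,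
            TensorProduct.zero_tmul, TensorProduct.tmul_zero, smul_zero]
        | add x y hx hy => simp only [LinearMap.map_add, LinearEquiv.map_add, TensorProduct.add_tmul, hx, hy]
        | tmul y v => exact congrArg (fun t => y ⊗ₜ[k] t) (mk_rel r l s v w))
    (ext fun z w => by
      induction z with
      | zero => simp only [LinearMap.map_zero, LinearEquiv.map_zero, LinearMap.zero_apply,
          TensorProduct.zero_tmul, TensorProduct.tmul_zero, smul_zero]
      | add x y hx hy => simp only [LinearMap.map_add, LinearEquiv.map_add, TensorProduct.add_tmul, hx, hy]
      | tmul y v => rfl)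
    (ext_tensor fun y v w => rfl)

lemma gammaEquiv_tmul (y : Y) (v : V) (w : W) :
    gammaEquiv Y r l (y ⊗ₜ[k] mk r l (v ⊗ₜ w)) = mk (LinearMap.lTensorHom Y ∘ₗ r) l
      ((y ⊗ₜ v) ⊗ₜ w) := rfl

lemma gammaEquiv_repL {f : R →ₐ[k] A ⊗[k] R} (a : A →ₐ[k] Module.End k Y)
    (ρ : R →ₐ[k] Module.End k V) (h₁) (h₂) (x : R) (z : Y ⊗[k] Bal r l) :
    gammaEquiv Y r l (trep f a (repL l ρ h₁) x z) =
      repL (r := LinearMap.lTensorHom Y ∘ₗ r) l (trep f a ρ) h₂ x (gammaEquiv Y r l z) := by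
  have e1 : ∀ (u : A ⊗[k] R) (y : Y) (v : V) (w : W),
      gammaEquiv Y r l (tact a.toLinearMap (repL l ρ h₁).toLinearMap u (y ⊗ₜ[k] mk r l (v ⊗ₜ w))) =
      mk (LinearMap.lTensorHom Y ∘ₗ r) l (tact a.toLinearMap ρ.toLinearMap u (y ⊗ₜ v) ⊗ₜ w) := by
    intro u y v w
    induction u with
    | zero => simp only [LinearMap.map_zero, LinearEquiv.map_zero, LinearMap.zero_apply,
        TensorProduct.zero_tmul, TensorProduct.tmul_zero, smul_zero]
    | add x y hx hy => simp only [LinearMap.map_add, LinearEquiv.map_add, TensorProduct.add_tmul, LinearMap.add_apply, hx, hy]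
    | tmul b s => rfl
  exact LinearMap.congr_fun
    (f := (gammaEquiv Y r l).toLinearMap ∘ₗ trep f a (repL l ρ h₁) x)
    (g := repL (r := LinearMap.lTensorHom Y ∘ₗ r) l (trep f a ρ) h₂ x ∘ₗ
      (gammaEquiv Y r l).toLinearMap) (ext_tensor fun y v w => e1 _ _ _ _) z

lemma gammaEquiv_repR (b : L →ₗ[k] Module.End k W) (h₁) (h₂) (x : L) (z : Y ⊗[k] Bal r l) :
    gammaEquiv Y r l ((LinearMap.lTensorHom Y ∘ₗ repR r b h₁) x z) =
      repR (LinearMap.lTensorHom Y ∘ₗ r) b h₂ x (gammaEquiv Y r l z) :=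
  LinearMap.congr_fun
    (f := (gammaEquiv Y r l).toLinearMap ∘ₗ (LinearMap.lTensorHom Y ∘ₗ repR r b h₁) x)
    (g := repR (LinearMap.lTensorHom Y ∘ₗ r) b h₂ x ∘ₗ (gammaEquiv Y r l).toLinearMap)
    (ext_tensor fun y v w => rfl) z

lemma gammaEquiv_coact {g : S →ₐ[k] B ⊗[k] S} (δ : V →ₗ[k] B ⊗[k] V) (δ' : W →ₗ[k] B ⊗[k] W)
    (h) (h') (h₁) (z : Y ⊗[k] Bal r l) :
    coact (r := LinearMap.lTensorHom Y ∘ₗ r) (l := l) g (RelBimod.coactR Y δ) δ' h₁ h'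
        (gammaEquiv Y r l z) =
      TensorProduct.map .id (gammaEquiv Y r l).toLinearMap
        (RelBimod.coactR Y (coact g δ δ' h h') z) := by
  have e1 : ∀ (y : Y) (v : B ⊗[k] V) (w : B ⊗[k] W),
      mm (LinearMap.lTensorHom Y ∘ₗ r) l (TensorProduct.leftComm k Y B V (y ⊗ₜ v) ⊗ₜ w) =
      TensorProduct.map .id (gammaEquiv Y r l).toLinearMap
        (TensorProduct.leftComm k Y B _ (y ⊗ₜ mm r l (v ⊗ₜ w))) := by
    intro y v w
    induction v with
    | zero => simp only [LinearMap.map_zero, LinearEquiv.map_zero, LinearMap.zero_apply,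
        TensorProduct.zero_tmul, TensorProduct.tmul_zero, smul_zero]
    | add x y hx hy => simp only [LinearMap.map_add, LinearEquiv.map_add, TensorProduct.add_tmul, TensorProduct.tmul_add, hx, hy]
    | tmul b v =>
      induction w with
      | zero => simp only [LinearMap.map_zero, LinearEquiv.map_zero, LinearMap.zero_apply,
          TensorProduct.zero_tmul, TensorProduct.tmul_zero, smul_zero]
      | add x y hx hy => simp only [LinearMap.map_add, LinearEquiv.map_add, TensorProduct.tmul_add, hx, hy]
      | tmul c w => rfl
  exact LinearMap.congr_fun
    (f := coact (r := LinearMap.lTensorHom Y ∘ₗ r) (l := l) g (RelBimod.coactR Y δ) δ' h₁ h' ∘ₗ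
      (gammaEquiv Y r l).toLinearMap)
    (g := TensorProduct.map .id (gammaEquiv Y r l).toLinearMap ∘ₗ
      RelBimod.coactR Y (coact g δ δ' h h')) (ext_tensor fun y v w => e1 _ _ _) z

end gamma

end Bal

end BalancedIsos

section RelBimodActions

open MonoidalLeftAction MonoidalRightAction

variable {k : Type u} [Field k] {A B : Type u} [Ring A] [Bialgebra k A] [Ring B] [Bialgebra k B]

namespace RelBimod

section Raw

lemma coactR_rassoc {X Y W : Type u} [AddCommGroup X] [Module k X] [AddCommGroup Y] [Module k Y]
    [AddCommGroup W] [Module k W] (δ : W →ₗ[k] B ⊗[k] W) (z : (X ⊗[k] Y) ⊗[k] W) :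
    coactR Y (coactR X δ) (rassoc X Y W z) =
      TensorProduct.map .id (rassoc (k := k) X Y W).toLinearMap (coactR (X ⊗[k] Y) δ z) := by
  have e1 : ∀ (x : X) (y : Y) (w : B ⊗[k] W),
      TensorProduct.leftComm k Y B (X ⊗[k] W) (y ⊗ₜ TensorProduct.leftComm k X B W (x ⊗ₜ w)) =
      TensorProduct.map .id (rassoc (k := k) X Y W).toLinearMap
        (TensorProduct.leftComm k (X ⊗[k] Y) B W ((x ⊗ₜ y) ⊗ₜ w)) := by
    intro x y w
    induction w with
    | zero => simp only [LinearMap.map_zero, LinearEquiv.map_zero, LinearMap.zero_apply,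
        TensorProduct.zero_tmul, TensorProduct.tmul_zero, smul_zero]
    | add x y hx hy => simp only [LinearMap.map_add, LinearEquiv.map_add, TensorProduct.tmul_add, hx, hy]
    | tmul b w => rfl
  exact LinearMap.congr_fun
    (f := coactR Y (coactR X δ) ∘ₗ (rassoc (k := k) X Y W).toLinearMap)
    (g := TensorProduct.map .id (rassoc (k := k) X Y W).toLinearMap ∘ₗ coactR (X ⊗[k] Y) δ)
    (TensorProduct.ext_threefold fun x y w => e1 x y (δ w)) z

lemma coactR_lid {W : Type u} [AddCommGroup W] [Module k W] (δ : W →ₗ[k] B ⊗[k] W)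
    (z : k ⊗[k] W) :
    δ (TensorProduct.lid k W z) =
      TensorProduct.map .id (TensorProduct.lid k W).toLinearMap (coactR k δ z) := by
  have e1 : ∀ (c : k) (w : B ⊗[k] W), c • w =
      TensorProduct.map .id (TensorProduct.lid k W).toLinearMap
        (TensorProduct.leftComm k k B W (c ⊗ₜ w)) := by
    intro c w
    induction w with
    | zero => simp only [LinearMap.map_zero, LinearEquiv.map_zero, LinearMap.zero_apply,
        TensorProduct.zero_tmul, TensorProduct.tmul_zero, smul_zero]
    | add x y hx hy => simp only [LinearMap.map_add, LinearEquiv.map_add, TensorProduct.tmul_add, smul_add, hx, hy]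
    | tmul b w => simp
  exact LinearMap.congr_fun
    (f := δ ∘ₗ (TensorProduct.lid k W).toLinearMap)
    (g := TensorProduct.map .id (TensorProduct.lid k W).toLinearMap ∘ₗ coactR k δ)
    (TensorProduct.ext' fun c w => (map_smul δ c w).trans (e1 c (δ w))) z

lemma rassoc_map {X Y W : Type u} [AddCommGroup X] [Module k X] [AddCommGroup Y] [Module k Y]
    [AddCommGroup W] [Module k W] (f : Module.End k W) (z : (X ⊗[k] Y) ⊗[k] W) :
    rassoc (k := k) X Y W (LinearMap.lTensor (X ⊗[k] Y) f z) =
      LinearMap.lTensor Y (LinearMap.lTensor X f) (rassoc X Y W z) :=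
  LinearMap.congr_fun
    (f := (rassoc (k := k) X Y W).toLinearMap ∘ₗ LinearMap.lTensor (X ⊗[k] Y) f)
    (g := LinearMap.lTensor Y (LinearMap.lTensor X f) ∘ₗ (rassoc (k := k) X Y W).toLinearMap)
    (TensorProduct.ext_threefold fun x y w => rfl) z

lemma lid_map {W : Type u} [AddCommGroup W] [Module k W] (f : Module.End k W) (z : k ⊗[k] W) :
    TensorProduct.lid k W (LinearMap.lTensor k f z) = f (TensorProduct.lid k W z) :=
  LinearMap.congr_fun
    (f := (TensorProduct.lid k W).toLinearMap ∘ₗ LinearMap.lTensor k f)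
    (g := f ∘ₗ (TensorProduct.lid k W).toLinearMap)
    (TensorProduct.ext' fun c w => (map_smul f c w).symm) z

end Raw

variable {K S L : ComodAlg k (Cop A ⊗[k] B)}

lemma actRMap_id (P : RelBimod K S) (Y : FDMod k A) : actRMap (𝟙 P) (𝟙 Y) = 𝟙 (actR P Y) :=
  hom_ext TensorProduct.map_id

lemma actRMap_comp {P P' P'' : RelBimod K S} {Y Y' Y'' : FDMod k A} (f : P ⟶ P') (f' : P' ⟶ P'')
    (g : Y ⟶ Y') (g' : Y' ⟶ Y'') :
    actRMap (f ≫ f') (g ≫ g') = actRMap f g ≫ actRMap f' g' :=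
  hom_ext (TensorProduct.map_comp (FDMod.lin g') (lin f') (FDMod.lin g) (lin f))

/-- The right action of `Rep(A)` on `{}^B_K M_S`: `P ⊙ᵣ Y = Y ⊗ P`. -/
instance rightAction : MonoidalRightAction (FDMod k A) (RelBimod K S) where
  actionObj P Y := actR P Y
  actionHomLeft f Y := actRMap f (𝟙 Y)
  actionHomRight P _ _ g := actRMap (𝟙 P) g
  actionHom f g := actRMap f g
  actionAssocIso P X Y := isoMk (rassoc X.carrier Y.carrier P.carrier)
    (trep_rassoc K.coA K.coA_coassoc X.ρ Y.ρ P.ρ)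
    (fun s z => rassoc_map (P.ρR s) z) (coactR_rassoc P.δ)
  actionUnitIso P := isoMk (TensorProduct.lid k P.carrier) (trep_lid K.coA _ K.coA_counit P.ρ)
    (fun s z => lid_map (P.ρR s) z) (coactR_lid P.δ)
  actionHom_def f g := by rw [← actRMap_comp, Category.comp_id, Category.id_comp]
  actionHomRight_id Y P := actRMap_id P Y
  id_actionHomLeft Y P := actRMap_id P Y
  actionHom_comp f₁ f₂ g₁ g₂ := actRMap_comp f₁ f₂ g₁ g₂
  actionAssocIso_hom_naturality f g h := hom_ext (TensorProduct.ext_threefold fun _ _ _ => rfl)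
  actionUnitIso_hom_naturality f := hom_ext (TensorProduct.ext' fun a x => map_smul (lin f) a x)
  actionHomRight_whiskerRight f Y M := hom_ext (TensorProduct.ext_threefold fun _ _ _ => rfl)
  whiskerRight_actionHomLeft Y _ _ f M := hom_ext (TensorProduct.ext_threefold fun _ _ _ => rfl)
  actionHom_associator X Y Z M := hom_ext (TensorProduct.ext_fourfold fun _ _ _ _ => rfl)
  actionHom_leftUnitor X M := hom_ext (TensorProduct.ext_threefold fun a x m =>
    (TensorProduct.smul_tmul a x m))
  actionHom_rightUnitor X M := hom_ext (TensorProduct.ext_threefold fun x a m =>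
    (TensorProduct.smul_tmul' a x m))

lemma compMap_id (P : RelBimod K S) (Q : RelBimod S L) : compMap (𝟙 P) (𝟙 Q) = 𝟙 (comp P Q) :=
  hom_ext (Bal.ext fun _ _ => rfl)

lemma compMap_comp {P P' P'' : RelBimod K S} {Q Q' Q'' : RelBimod S L} (f : P ⟶ P')
    (f' : P' ⟶ P'') (g : Q ⟶ Q') (g' : Q' ⟶ Q'') :
    compMap (f ≫ f') (g ≫ g') = compMap f g ≫ compMap f' g' :=
  hom_ext (Bal.ext fun _ _ => rfl)

/-- The left action `X ⊙ₗ P = P ⊗_S (X ⊗ S)`, where `s · (x ⊗ t) = π_A(s₍₋₁₎) x ⊗ s₍₀₎ t`. -/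
abbrev actL (X : FDMod k A) (P : RelBimod K S) : RelBimod K S := comp P (reg S ⊙ᵣ X)

/-- The functoriality of `X ⊙ₗ P`. -/
abbrev actLMap {X X' : FDMod k A} {P P' : RelBimod K S} (f : X ⟶ X') (g : P ⟶ P') :
    actL X P ⟶ actL X' P' := compMap g (reg S ⊴ᵣ f)

/-- The isomorphism `P ⊗_S (Y ⊗ Q) ≅ (P ⊗_S (Y ⊗ S)) ⊗_S Q`,
`p ⊗ (y ⊗ q) ↦ (p ⊗ (y ⊗ 1)) ⊗ q`. -/
def actLComp (Y : FDMod k A) (P : RelBimod K S) (Q : RelBimod S L) :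
    comp P (Q ⊙ᵣ Y) ≅ comp (actL Y P) Q :=
  isoMk (P := comp P (actR Q Y)) (Q := comp (comp P (actR (reg S) Y)) Q)
    (Bal.assocEquiv P.ρR S.coA Y.ρ Q.ρ)
    (Bal.assocEquiv_repL _ _ _ _ _ _) (Bal.assocEquiv_repR _ _ _ _ _ _)
    (Bal.assocEquiv_coact _ _ _ _ _ P.δ_right (actR (reg S) Y).δ_left
      (comp P (actR (reg S) Y)).δ_right Q.δ_left (actR Q Y).δ_left)

/-- The associativity isomorphism `p ⊗ ((x ⊗ y) ⊗ s) ↦ (p ⊗ (y ⊗ 1)) ⊗ (x ⊗ s)`. -/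
def actLAssoc (X Y : FDMod k A) (P : RelBimod K S) : actL (X ⊗ Y) P ≅ actL X (actL Y P) where
  hom := compMap (𝟙 P) (αᵣ (reg S) X Y).hom ≫ (actLComp Y P (reg S ⊙ᵣ X)).hom
  inv := (actLComp Y P (reg S ⊙ᵣ X)).inv ≫ compMap (𝟙 P) (αᵣ (reg S) X Y).inv
  hom_inv_id := by
    rw [Category.assoc, Iso.hom_inv_id_assoc, ← compMap_comp, Iso.hom_inv_id, Category.comp_id,
      compMap_id]
  inv_hom_id := by
    rw [Category.assoc, ← Category.assoc (compMap _ _), ← compMap_comp, Iso.inv_hom_id,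
      Category.comp_id, compMap_id, Category.id_comp, Iso.inv_hom_id]

/-- The isomorphism `p ⊗ (c ⊗ s) ↦ c p s`. -/
def actLUnit (P : RelBimod K S) : actL (𝟙_ (FDMod k A)) P ≅ P :=
  isoMk (P := comp P (actR (reg S) (FDMod.char (Bialgebra.counitAlgHom k A))))
    (Bal.unitEquiv P.ρR P.ρR_mul S.coA_counit P.ρR_one)
    (fun x z => LinearMap.congr_fun
      (f := Bal.unitMap P.ρR P.ρR_mul S.coA_counit ∘ₗ
        (comp P (actR (reg S) (FDMod.char (Bialgebra.counitAlgHom k A)))).ρ x)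
      (g := P.ρ x ∘ₗ Bal.unitMap P.ρR P.ρR_mul S.coA_counit)
      (Bal.ext fun p w => (P.ρ_ρR x _ p).symm) z)
    (fun s z => LinearMap.congr_fun
      (f := Bal.unitMap P.ρR P.ρR_mul S.coA_counit ∘ₗ
        (comp P (actR (reg S) (FDMod.char (Bialgebra.counitAlgHom k A)))).ρR s)
      (g := P.ρR s ∘ₗ Bal.unitMap P.ρR P.ρR_mul S.coA_counit)
      (Bal.ext₂ fun p c t => by
        refine Eq.trans (b := P.ρR (c • (t * s)) p) rfl ?_
        rw [← smul_mul_assoc, P.ρR_mul]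
        rfl) z)
    (Bal.unitMap_coact P.ρR P.ρR_mul S.coA_counit P.δ P.δ_right
      (actR (reg S) (FDMod.char (Bialgebra.counitAlgHom k A))).δ_left)

/-- The left action of `Rep(A)` on `{}^B_K M_S`: `X ⊙ₗ P = P ⊗_S (X ⊗ S)`. -/
instance leftAction : MonoidalLeftAction (FDMod k A) (RelBimod K S) where
  actionObj X P := actL X P
  actionHomLeft f P := actLMap f (𝟙 P)
  actionHomRight X _ _ g := actLMap (𝟙 X) g
  actionHom f g := actLMap f g
  actionAssocIso X Y P := actLAssoc X Y P
  actionUnitIso P := actLUnit P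
  actionHom_def f g := by
    change compMap _ _ = compMap _ _ ≫ compMap _ _
    rw [← compMap_comp, MonoidalRightAction.actionHomRight_id, Category.comp_id, Category.id_comp]
  actionHomRight_id X P := by
    change compMap _ _ = _
    rw [MonoidalRightAction.actionHomRight_id, compMap_id]
  id_actionHomLeft X P := by
    change compMap _ _ = _
    rw [MonoidalRightAction.actionHomRight_id, compMap_id]
  actionHom_comp f₁ f₂ g₁ g₂ := by
    change compMap _ _ = compMap _ _ ≫ compMap _ _
    rw [← compMap_comp, MonoidalRightAction.actionHomRight_comp]
  actionAssocIso_hom_naturality f g h := hom_ext (Bal.ext' fun _ =>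
    TensorProduct.ext_threefold fun _ _ _ => rfl)
  actionUnitIso_hom_naturality {P Q} f := hom_ext (Bal.ext₂ fun p c s =>
    lin_ρR f (c • s) p)
  whiskerLeft_actionHomLeft X Y Y' f P := by
    rw [← Category.assoc, Iso.eq_comp_inv]
    exact hom_ext (Bal.ext' fun _ => TensorProduct.ext_threefold fun _ _ _ => rfl)
  whiskerRight_actionHomLeft X f M := by
    rw [← Category.assoc, Iso.eq_comp_inv]
    exact hom_ext (Bal.ext' fun _ => TensorProduct.ext_threefold fun _ _ _ => rfl)
  associator_actionHom X Y Z P := hom_ext (Bal.ext' fun _ =>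
    TensorProduct.ext_fourfold fun _ _ _ _ => rfl)
  leftUnitor_actionHom X P := hom_ext (Bal.ext' fun p =>
    TensorProduct.ext_threefold fun c x s =>
      congrArg (fun t => Bal.mk P.ρR (trep S.coA X.ρ (Algebra.lmul k S.carrier)) (p ⊗ₜ[k] t))
        ((TensorProduct.smul_tmul c x s).trans
          (congrArg (fun t => x ⊗ₜ[k] t) (one_mul (c • s)).symm)))
  rightUnitor_actionHom X P := hom_ext (Bal.ext' fun p =>
    TensorProduct.ext_threefold fun x c s =>
      Eq.trans (b := c • Bal.mk P.ρR (trep S.coA X.ρ (Algebra.lmul k S.carrier))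
          (p ⊗ₜ[k] (x ⊗ₜ[k] s)))
        ((congrArg (fun t => Bal.mk P.ρR (trep S.coA X.ρ (Algebra.lmul k S.carrier)) (p ⊗ₜ[k] t))
          (TensorProduct.smul_tmul' c x s).symm).trans
            ((congrArg _ (TensorProduct.tmul_smul c p _)).trans (map_smul _ _ _)))
        ((map_smul _ _ _).symm.trans
          ((congrArg _ (TensorProduct.smul_tmul' c p (x ⊗ₜ[k] s))).trans
            (congrArg (fun t => Bal.mk P.ρR (trep S.coA X.ρ (Algebra.lmul k S.carrier))
              (t ⊗ₜ[k] (x ⊗ₜ[k] s)))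
              (Eq.symm ((congrArg (fun t => t p) (map_smul P.ρR c 1)).trans
                (congrArg (fun t => c • t) (P.ρR_one p))))))))

/-- The isomorphism `(X ⊙ₗ P) ⊙ᵣ Y ≅ X ⊙ₗ (P ⊙ᵣ Y)`, `y ⊗ (p ⊗ (x ⊗ s)) ↦ (y ⊗ p) ⊗ (x ⊗ s)`. -/
def gammaIso (X : FDMod k A) (P : RelBimod K S) (Y : FDMod k A) :
    (X ⊙ₗ P) ⊙ᵣ Y ≅ X ⊙ₗ (P ⊙ᵣ Y) :=
  isoMk (P := actR (comp P (reg S ⊙ᵣ X)) Y) (Q := comp (actR P Y) (reg S ⊙ᵣ X))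
    (Bal.gammaEquiv Y.carrier P.ρR (reg S ⊙ᵣ X).ρ)
    (Bal.gammaEquiv_repL _ _ _ _ _ _ _) (Bal.gammaEquiv_repR _ _ _ _ _ _)
    (Bal.gammaEquiv_coact Y.carrier P.ρR (reg S ⊙ᵣ X).ρ P.δ (reg S ⊙ᵣ X).δ P.δ_right
      (reg S ⊙ᵣ X).δ_left (actR P Y).δ_right)

lemma gammaIso_assoc_left (X X' : FDMod k A) (P : RelBimod K S) (Y : FDMod k A) :
    (gammaIso (X ⊗ X') P Y).hom ≫ (αₗ X X' (P ⊙ᵣ Y)).hom =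
      (αₗ X X' P).hom ⊵ᵣ Y ≫ (gammaIso X (X' ⊙ₗ P) Y).hom ≫ X ⊴ₗ (gammaIso X' P Y).hom :=
  hom_ext (Bal.ext_tensor' fun y p =>
    TensorProduct.ext_threefold fun x x' s => by
      let b := Bal.mk (Bal.regR (actR P Y).ρR S.coA X'.ρ) (reg S ⊙ᵣ X).ρ
        (Bal.mk (actR P Y).ρR (reg S ⊙ᵣ X').ρ ((y ⊗ₜ[k] p) ⊗ₜ[k] (x' ⊗ₜ[k] 1)) ⊗ₜ[k] (x ⊗ₜ[k] s))
      refine Eq.trans (b := b) ?_ (Eq.symm ?_)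
      · exact Bal.assocEquiv_mk S.coA X'.ρ (reg S ⊙ᵣ X).ρ (y ⊗ₜ[k] p) x' (x ⊗ₜ[k] s)
      · exact (congrArg (lin ((gammaIso X (X' ⊙ₗ P) Y).hom ≫ X ⊴ₗ (gammaIso X' P Y).hom))
          (congrArg (fun t => y ⊗ₜ[k] t)
            (Bal.assocEquiv_mk S.coA X'.ρ (reg S ⊙ᵣ X).ρ p x' (x ⊗ₜ[k] s)))).trans
          (congrArg (lin (X ⊴ₗ (gammaIso X' P Y).hom))
            (Bal.gammaEquiv_tmul Y.carrier (X' ⊙ₗ P).ρR (reg S ⊙ᵣ X).ρ y _ (x ⊗ₜ[k] s))))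

/-- `{}^B_K M_S` is a `Rep(A)`-bimodule category, with
`y ⊗ (p ⊗ (x ⊗ s)) ↦ (y ⊗ p) ⊗ (x ⊗ s)`. -/
instance bimoduleCategory : BimoduleCategory (FDMod k A) (FDMod k A) (RelBimod K S) where
  γ X P Y := gammaIso X P Y
  γ_naturality f g h := hom_ext (Bal.ext_tensor fun _ _ _ => rfl)
  γ_assoc_left X X' P Y := gammaIso_assoc_left X X' P Y
  γ_assoc_right X P Y Y' := hom_ext (Bal.ext_tensor₂ fun _ _ _ =>
    TensorProduct.ext' fun _ _ => rfl)
  γ_unit_left P Y := hom_ext (Bal.ext_tensor fun y p w =>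
    Eq.refl (y ⊗ₜ[k] P.ρR (TensorProduct.lid k S.carrier w) p))
  γ_unit_right X P := hom_ext (Bal.ext_tensor' fun c p => TensorProduct.ext' fun x s =>
    (congrArg (Bal.mk P.ρR (reg S ⊙ᵣ X).ρ) (TensorProduct.smul_tmul' c p (x ⊗ₜ[k] s)).symm).trans
      (map_smul _ _ _))

end RelBimod

end RelBimodActions

section Equivalence

open MonoidalLeftAction MonoidalRightAction
open Functor.OplaxLeftLinear Functor.OplaxRightLinear

section Raw

variable {k : Type u} [Field k] {S B : Type u} [Ring S] [Algebra k S] [Ring B] [Bialgebra k B]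
  {V V' W X X' : Type u} [AddCommGroup V] [Module k V] [AddCommGroup V'] [Module k V']
  [AddCommGroup W] [Module k W] [AddCommGroup X] [Module k X] [AddCommGroup X'] [Module k X']
  {r : S →ₗ[k] Module.End k V} {r' : S →ₗ[k] Module.End k V'} {l : S →ₐ[k] Module.End k W}
  {f : S →ₐ[k] B ⊗[k] S} {δ : V →ₗ[k] B ⊗[k] V}

lemma Bal.str_map_left (h : ∀ s v, δ (r s v) = tact (LinearMap.mul k B).flip r (f s) (δ v))
    (a : B →ₐ[k] Module.End k X) (a' : B →ₐ[k] Module.End k X')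
    (ξ : X →ₗ[k] X') (hξ : ∀ b x, ξ (a b x) = a' b (ξ x)) (hh) (z : Bal r (trep f a l)) :
    Bal.str f δ h a' (Bal.map (l' := trep f a' l) .id (TensorProduct.map ξ .id)
        (fun _ _ => rfl) hh z) =
      TensorProduct.map ξ .id (Bal.str f δ h a z) := by
  have e := Bal.str_map h a a' h .id (fun _ _ => rfl)
      (fun v => by rw [TensorProduct.map_id]; rfl) ξ hξ (.id : W →ₗ[k] W)
      (fun _ _ => rfl) hh z
  have e' : Bal.map (r := r) (l := l) .id .id (fun _ _ => rfl) (fun _ _ => rfl) = .id :=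
    Bal.ext fun _ _ => rfl
  rw [e'] at e
  exact e

lemma Bal.str_map_right (h : ∀ s v, δ (r s v) = tact (LinearMap.mul k B).flip r (f s) (δ v))
    {δ' : V' →ₗ[k] B ⊗[k] V'}
    (h' : ∀ s v, δ' (r' s v) = tact (LinearMap.mul k B).flip r' (f s) (δ' v))
    (a : B →ₐ[k] Module.End k X) (φ : V →ₗ[k] V') (hφ : ∀ s v, φ (r s v) = r' s (φ v))
    (cφ : ∀ v, δ' (φ v) = TensorProduct.map .id φ (δ v)) (z : Bal r (trep f a l)) :
    Bal.str f δ' h' a (Bal.map (r' := r') φ .id hφ (fun _ _ => rfl) z) =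
      TensorProduct.map .id (Bal.map φ .id hφ (fun _ _ => rfl)) (Bal.str (l := l) f δ h a z) := by
  have hh : ∀ s (w : X ⊗[k] W), TensorProduct.map .id .id (trep f a l s w) =
      trep f a l s (TensorProduct.map .id .id w) := fun s w => by
    rw [TensorProduct.map_id]
    rfl
  have e := Bal.str_map h a a h' φ hφ cφ .id (fun _ _ => rfl) (.id : W →ₗ[k] W)
      (fun _ _ => rfl) hh z
  have e' : Bal.map (r := r) (l := trep f a l) (r' := r') (l' := trep f a l) φ
      (TensorProduct.map .id .id) hφ hh = Bal.map φ .id hφ (fun _ _ => rfl) :=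
    Bal.ext fun v w => by
      rw [Bal.map_mk, Bal.map_mk, TensorProduct.map_id]
  rw [e'] at e
  exact e

end Raw

section General

variable (k : Type*) [Field k] (C D M N : Type*) [Category* C] [MonoidalCategory C] [Category* D]
  [MonoidalCategory D]
  [Category* M] [MonoidalLeftAction C M] [MonoidalRightAction D M] [BimoduleCategory C D M]
  [Category* N] [MonoidalLeftAction C N] [MonoidalRightAction D N] [BimoduleCategory C D N]
  [Preadditive M] [Linear k M] [Preadditive N] [Linear k N]

/-- A `k`-linear functor of `(C, D)`-bimodule categories: a functor with natural isomorphisms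
`δₗ : F (X ⊙ₗ m) ≅ X ⊙ₗ F m` and `δᵣ : F (m ⊙ᵣ Y) ≅ F m ⊙ᵣ Y`, making it a left and a right module
functor, that are compatible with `γ`. -/
structure BimoduleFunctor where
  F : M ⥤ N
  additive : F.Additive
  linear : F.Linear k
  [left : F.OplaxLeftLinear C]
  [right : F.OplaxRightLinear D]
  isIso_left (X : C) (m : M) : IsIso (δₗ F X m)
  isIso_right (m : M) (Y : D) : IsIso (δᵣ F m Y)
  compat (X : C) (m : M) (Y : D) :
    F.map (BimoduleCategory.γ X m Y).hom ≫ δₗ F X (m ⊙ᵣ Y) ≫ X ⊴ₗ δᵣ F m Y =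
      δᵣ F (X ⊙ₗ m) Y ≫ δₗ F X m ⊵ᵣ Y ≫ (BimoduleCategory.γ X (F.obj m) Y).hom

attribute [instance] BimoduleFunctor.left BimoduleFunctor.right

/-- An equivalence of `(C, D)`-bimodule categories: bimodule functors in both directions, with
both composites isomorphic to the identity through natural isomorphisms that are compatible with
the left and right module structures. -/
structure BimoduleEquivalence where
  functor : BimoduleFunctor k C D M N
  inverse : BimoduleFunctor k C D N M
  unitIso : 𝟭 M ≅ functor.F ⋙ inverse.F
  counitIso : inverse.F ⋙ functor.F ≅ 𝟭 N
  unit_left (X : C) (m : M) :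
    unitIso.hom.app (X ⊙ₗ m) ≫ inverse.F.map (δₗ functor.F X m) ≫
      δₗ inverse.F X (functor.F.obj m) = X ⊴ₗ unitIso.hom.app m
  unit_right (m : M) (Y : D) :
    unitIso.hom.app (m ⊙ᵣ Y) ≫ inverse.F.map (δᵣ functor.F m Y) ≫
      δᵣ inverse.F (functor.F.obj m) Y = unitIso.hom.app m ⊵ᵣ Y
  counit_left (X : C) (n : N) :
    functor.F.map (δₗ inverse.F X n) ≫ δₗ functor.F X (inverse.F.obj n) ≫
      X ⊴ₗ counitIso.hom.app n = counitIso.hom.app (X ⊙ₗ n)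
  counit_right (n : N) (Y : D) :
    functor.F.map (δᵣ inverse.F n Y) ≫ δᵣ functor.F (inverse.F.obj n) Y ≫
      counitIso.hom.app n ⊵ᵣ Y = counitIso.hom.app (n ⊙ᵣ Y)

end General

variable {k : Type u} [Field k] {A B : Type u} [Ring A] [Bialgebra k A] [Ring B] [Bialgebra k B]

/-- The category of left `S`-modules is an exact `Rep(B)`-module category: `X ⊙ₗ M` is projective
for every projective `X` in `Rep(B)` and every left `S`-module `M`. -/
def IsExactModuleCategory (S : ComodAlg k (Cop A ⊗[k] B)) : Prop :=
  ∀ (X : FDMod k B) (M : FDMod k S.carrier), Projective X → Projective (X ⊙ₗ M)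

variable {S K : ComodAlg k (Cop A ⊗[k] B)}

/-- The functor `N ↦ P ⊗_S N` from left `S`-modules to left `K`-modules. -/
abbrev tensorFunctor (P : RelBimod K S) : FDMod k S.carrier ⥤ FDMod k K.carrier where
  obj N :=
    { carrier := Bal P.ρR N.ρ
      ρ := Bal.repL N.ρ P.ρ fun r s p => P.ρ_ρR r s p }
  map f := FDMod.mk' (Bal.map .id (FDMod.lin f) (fun _ _ => rfl) (FDMod.lin_ρ f))
    fun r z => LinearMap.congr_fun
      (f := Bal.map .id (FDMod.lin f) (fun _ _ => rfl) (FDMod.lin_ρ f) ∘ₗ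
        Bal.repL _ P.ρ (fun r s p => P.ρ_ρR r s p) r)
      (g := Bal.repL _ P.ρ (fun r s p => P.ρ_ρR r s p) r ∘ₗ
        Bal.map .id (FDMod.lin f) (fun _ _ => rfl) (FDMod.lin_ρ f))
      (Bal.ext fun p n => rfl) z
  map_id N := FDMod.hom_ext (Bal.ext fun p n => rfl)
  map_comp f g := FDMod.hom_ext (Bal.ext fun p n => rfl)

/-- The `Rep(B)`-module structure
`P ⊗_S (X ⊗ N) → X ⊗ (P ⊗_S N)`, `p ⊗ (x ⊗ n) ↦ p₍₋₁₎ x ⊗ (p₍₀₎ ⊗ n)` of `N ↦ P ⊗_S N`. -/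
instance tensorFunctorOplax (P : RelBimod K S) :
    (tensorFunctor P).OplaxLeftLinear (FDMod k B) where
  δₗ X N := FDMod.mk' (M := (tensorFunctor P).obj (X ⊙ₗ N)) (N := X ⊙ₗ (tensorFunctor P).obj N)
    (Bal.str (l := N.ρ) S.coB P.δ P.δ_right X.ρ)
    (Bal.str_repL P.δ_right X.ρ P.ρ (fun r s p => P.ρ_ρR r s p) P.δ_left)
  δₗ_naturality_left {X X'} f N := FDMod.hom_ext (LinearMap.ext fun z =>
    Bal.str_map_left P.δ_right X.ρ X'.ρ (FDMod.lin f) (FDMod.lin_ρ f)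
      (FDMod.lin_ρ (f ⊵ₗ N)) z)
  δₗ_naturality_right X N N' f := FDMod.hom_ext (LinearMap.ext fun z =>
    Bal.str_map P.δ_right X.ρ X.ρ P.δ_right .id (fun _ _ => rfl)
      (fun v => by rw [TensorProduct.map_id]; rfl) .id (fun _ _ => rfl) (FDMod.lin f)
      (FDMod.lin_ρ f) (FDMod.lin_ρ (X ⊴ₗ f)) z)
  δₗ_associativity X X' N := FDMod.hom_ext (LinearMap.ext fun z =>
    Bal.str_assoc P.δ_right X.ρ X'.ρ P.δ_coassoc (FDMod.lin_ρ (αₗ X X' N).hom) z)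
  δₗ_unitality_inv N := FDMod.hom_ext (LinearMap.ext fun z =>
    (Bal.str_unit P.δ_right P.δ_counit (FDMod.lin_ρ (λₗ[FDMod k B] N).inv) z).symm)

/-- The functor `P ↦ (N ↦ P ⊗_S N)` from `{}^B_K M_S` to `Fun_{Rep(B)}(_S M, _K M)`, which is
defined as soon as the functors `N ↦ P ⊗_S N` are right exact module functors. -/
def Phi (h : ∀ P : RelBimod K S, IsModuleFunctor S K (tensorFunctor P) ∧
    RightExact (tensorFunctor P)) : RelBimod K S ⥤ ModFun S K where
  obj P :=
    { F := tensorFunctor P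
      isModuleFunctor := (h P).1
      rightExact := (h P).2 }
  map {P Q} f := ModFun.mkHom
    { app := fun N => FDMod.mk' (M := (tensorFunctor P).obj N) (N := (tensorFunctor Q).obj N)
        (Bal.map (RelBimod.lin f) .id (RelBimod.lin_ρR f) (fun _ _ => rfl))
        fun r z => LinearMap.congr_fun
          (f := Bal.map (RelBimod.lin f) .id (RelBimod.lin_ρR f) (fun _ _ => rfl) ∘ₗ
            Bal.repL N.ρ P.ρ (fun r s p => P.ρ_ρR r s p) r)
          (g := Bal.repL N.ρ Q.ρ (fun r s p => Q.ρ_ρR r s p) r ∘ₗ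
            Bal.map (RelBimod.lin f) .id (RelBimod.lin_ρR f) (fun _ _ => rfl))
          (Bal.ext fun p n => congrArg (fun t => Bal.mk Q.ρR N.ρ (t ⊗ₜ[k] n))
            (RelBimod.lin_ρ f r p)) z
      naturality := fun N N' g => FDMod.hom_ext (Bal.ext fun p n => rfl) }
    fun X N => FDMod.hom_ext (LinearMap.ext fun z =>
      Bal.str_map_right P.δ_right Q.δ_right X.ρ (RelBimod.lin f) (RelBimod.lin_ρR f)
        (RelBimod.lin_δ f) z)
  map_id P := ModFun.hom_ext fun N => FDMod.hom_ext (Bal.ext fun p n => rfl)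
  map_comp f g := ModFun.hom_ext fun N => FDMod.hom_ext (Bal.ext fun p n => rfl)

end Equivalence

end HopfBimod

end

open HopfBimod

/-!
The functor `Φ` sends a colinear bimodule `P` to `N ↦ P ⊗_S N`. Its structure map
`p ⊗ (x ⊗ n) ↦ p₍₋₁₎ x ⊗ (p₍₀₎ ⊗ n)` has the inverse `x ⊗ (p ⊗ n) ↦ p₍₀₎ ⊗ (S⁻¹(p₍₋₁₎) x ⊗ n)`
(`Bal.str_bijective`), so `Φ(P)` is a module functor as soon as the antipode of `B` is bijective.
For a finite-dimensional Hopf algebra it is (`antipode_bijective`): an algebra map is determined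
by its restriction to the image of any power of the antipode, and the Fitting projection onto the
image of a high even power is an algebra map which is the identity there.

That `Φ` is an equivalence is a Watts theorem with coactions. Everything is read off at the
regular module: a morphism `Φ(P) ⟶ Φ(Q)` is determined by its component at `S`, where
`P ⊗_S S ≅ P`, and its compatibility with the module structures at `B` and `S` says that it is
colinear (`faithful_Phi`, `full_Phi`). Conversely, for a right exact module functor `F` the space
`F(S)` carries a right action of `S`, the images of the right multiplications, and the coaction
`F(S) → F(B ⊗ S) ≅ B ⊗ F(S)` induced by the coaction `S → B ⊗ S`. The maps `F(S) ⊗_S N → F(N)`,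
`p ⊗ n ↦ F(s ↦ s n)(p)`, are bijective for free `N`, and then for all `N` because both sides are
right exact (`evBal_bijective`). That the coaction determines the module structure of `F` follows
from naturality for the maps `B → X` and `S → N` out of the regular modules (`lin_δ_ev`).

The associativity isomorphisms of tensor products make `Φ` a bimodule functor (`phiLaxLeft`,
`phiLaxRight`). A bimodule functor that is an equivalence of categories is an equivalence of
bimodule categories, since its module structures transfer to a quasi-inverse along the counit
(`BimoduleEquivalence.ofIsEquivalence`).

If the module category of `S` is exact, then tensoring with the regular module `B` turns an exact
sequence into one of projective modules, which splits and is therefore preserved by every additive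
functor; as `F(B ⊗ N) ≅ B ⊗ F(N)` and `B` is faithfully flat over `k`, the functor `F` is right
exact (`rightExact_of_isExactModuleCategory`).
-/

/-! ### Bimodule functors and equivalences -/

noncomputable section AbstractBimodule

open Functor.OplaxLeftLinear Functor.OplaxRightLinear Functor.LaxLeftLinear Functor.LaxRightLinear

open MonoidalLeftAction (actionHomRight_comp actionHomRight_comp_assoc actionHomRight_id)
open MonoidalRightAction (comp_actionHomLeft comp_actionHomLeft_assoc id_actionHomLeft)

namespace HopfBimod

section Lax

variable {C D M N : Type*} [Category* C] [MonoidalCategory C] [Category* D] [MonoidalCategory D]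
  [Category* M] [Category* N]

/-- A lax module functor whose structure morphisms are invertible is an oplax module functor
through the inverses. -/
abbrev oplaxLeftOfLax [MonoidalLeftAction C M] [MonoidalLeftAction C N] (F : M ⥤ N)
    [F.LaxLeftLinear C] (h : ∀ (X : C) (m : M), IsIso (μₗ F X m)) : F.OplaxLeftLinear C where
  δₗ X m := inv (μₗ F X m)
  δₗ_naturality_left f m := by
    rw [IsIso.comp_inv_eq, Category.assoc, IsIso.eq_inv_comp, μₗ_naturality_left]
  δₗ_naturality_right X _ _ g := by
    rw [IsIso.comp_inv_eq, Category.assoc, IsIso.eq_inv_comp, μₗ_naturality_right]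
  δₗ_associativity X X' m := by
    have h1 := μₗ_associativity F X X' m
    rw [IsIso.inv_comp_eq, ← Category.assoc, h1]
    simp only [Category.assoc, IsIso.hom_inv_id_assoc]
    rw [← actionHomRight_comp, IsIso.hom_inv_id, actionHomRight_id, Category.comp_id]
  δₗ_unitality_inv m := by
    rw [IsIso.eq_comp_inv, μₗ_unitality_inv]

/-- A lax right module functor whose structure morphisms are invertible is an oplax right module
functor through the inverses. -/
abbrev oplaxRightOfLax [MonoidalRightAction D M] [MonoidalRightAction D N] (F : M ⥤ N)
    [F.LaxRightLinear D] (h : ∀ (m : M) (Y : D), IsIso (μᵣ F m Y)) : F.OplaxRightLinear D where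
  δᵣ m Y := inv (μᵣ F m Y)
  δᵣ_naturality_left f m := by
    rw [IsIso.comp_inv_eq, Category.assoc, IsIso.eq_inv_comp, μᵣ_naturality_left]
  δᵣ_naturality_right X _ _ g := by
    rw [IsIso.comp_inv_eq, Category.assoc, IsIso.eq_inv_comp, μᵣ_naturality_right]
  δᵣ_associativity m Y Y' := by
    have h1 := μᵣ_associativity F m Y Y'
    rw [IsIso.inv_comp_eq, ← Category.assoc, h1]
    simp only [Category.assoc, IsIso.hom_inv_id_assoc]
    rw [← comp_actionHomLeft, IsIso.hom_inv_id, id_actionHomLeft, Category.comp_id]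
  δᵣ_unitality_inv m := by
    rw [IsIso.eq_comp_inv, μᵣ_unitality_inv]

end Lax

section Bimodule

variable (k : Type*) [Field k] {C D M N : Type*} [Category* C] [MonoidalCategory C] [Category* D]
  [MonoidalCategory D]
  [Category* M] [MonoidalLeftAction C M] [MonoidalRightAction D M] [BimoduleCategory C D M]
  [Category* N] [MonoidalLeftAction C N] [MonoidalRightAction D N] [BimoduleCategory C D N]
  [Preadditive M] [Linear k M] [Preadditive N] [Linear k N]

/-- A bimodule functor given by lax structures with invertible structure morphisms. -/
def BimoduleFunctor.ofLax (F : M ⥤ N) (additive : F.Additive) (linear : F.Linear k)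
    [F.LaxLeftLinear C] [F.LaxRightLinear D] (hl : ∀ (X : C) (m : M), IsIso (μₗ F X m))
    (hr : ∀ (m : M) (Y : D), IsIso (μᵣ F m Y))
    (compat : ∀ (X : C) (m : M) (Y : D),
      (BimoduleCategory.γ X (F.obj m) Y).hom ≫ X ⊴ₗ μᵣ F m Y ≫ μₗ F X (m ⊙ᵣ Y) =
        μₗ F X m ⊵ᵣ Y ≫ μᵣ F (X ⊙ₗ m) Y ≫ F.map (BimoduleCategory.γ X m Y).hom) :
    BimoduleFunctor k C D M N where
  F := F
  additive := additive
  linear := linear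
  left := oplaxLeftOfLax F hl
  right := oplaxRightOfLax F hr
  isIso_left X m := inferInstanceAs (IsIso (inv (μₗ F X m)))
  isIso_right m Y := inferInstanceAs (IsIso (inv (μᵣ F m Y)))
  compat X m Y := by
    change F.map (BimoduleCategory.γ X m Y).hom ≫ inv (μₗ F X (m ⊙ᵣ Y)) ≫ X ⊴ₗ inv (μᵣ F m Y) =
      inv (μᵣ F (X ⊙ₗ m) Y) ≫ inv (μₗ F X m) ⊵ᵣ Y ≫ (BimoduleCategory.γ X (F.obj m) Y).hom
    rw [← cancel_epi (μᵣ F (X ⊙ₗ m) Y), ← cancel_epi (μₗ F X m ⊵ᵣ Y),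
      ← reassoc_of% (compat X m Y), IsIso.hom_inv_id_assoc, IsIso.hom_inv_id_assoc,
      ← actionHomRight_comp, IsIso.hom_inv_id, actionHomRight_id, Category.comp_id,
      ← comp_actionHomLeft_assoc, IsIso.hom_inv_id, id_actionHomLeft, Category.id_comp]

variable {k} (E : BimoduleFunctor k C D M N)

namespace BimoduleFunctor

instance (X : C) (m : M) : IsIso (δₗ E.F X m) := E.isIso_left X m

instance (m : M) (Y : D) : IsIso (δᵣ E.F m Y) := E.isIso_right m Y

/-- Two morphisms with values in `X ⊙ₗ m'` are equal if their images in `X ⊙ₗ n` are, where `n` is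
any object isomorphic to `F m'`. -/
lemma ext_left [E.F.Faithful] {m m' : M} {n : N} {X : C} (e : E.F.obj m' ≅ n)
    {f g : m ⟶ X ⊙ₗ m'}
    (h : E.F.map f ≫ δₗ E.F X m' ≫ X ⊴ₗ e.hom = E.F.map g ≫ δₗ E.F X m' ≫ X ⊴ₗ e.hom) :
    f = g := by
  rw [← Category.assoc, ← Category.assoc, cancel_mono, cancel_mono] at h
  exact E.F.map_injective h

/-- Two morphisms with values in `m' ⊙ᵣ Y` are equal if their images in `n ⊙ᵣ Y` are, where `n` is
any object isomorphic to `F m'`. -/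
lemma ext_right [E.F.Faithful] {m m' : M} {n : N} {Y : D} (e : E.F.obj m' ≅ n)
    {f g : m ⟶ m' ⊙ᵣ Y}
    (h : E.F.map f ≫ δᵣ E.F m' Y ≫ e.hom ⊵ᵣ Y = E.F.map g ≫ δᵣ E.F m' Y ≫ e.hom ⊵ᵣ Y) :
    f = g := by
  rw [← Category.assoc, ← Category.assoc, cancel_mono, cancel_mono] at h
  exact E.F.map_injective h

variable [E.F.IsEquivalence]

/-- The isomorphism `F (G n) ≅ n` for the inverse `G` of the functor `F` underlying `E`. -/
def counitApp (n : N) : E.F.obj (E.F.inv.obj n) ≅ n := E.F.asEquivalence.counitIso.app n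

/-- The structure morphism `G (X ⊙ₗ n) ⟶ X ⊙ₗ G n` of the inverse `G` of `E`. -/
def invδₗ (X : C) (n : N) : E.F.inv.obj (X ⊙ₗ n) ⟶ X ⊙ₗ E.F.inv.obj n :=
  E.F.preimage ((E.counitApp (X ⊙ₗ n)).hom ≫
    X ⊴ₗ (E.counitApp n).inv ≫ inv (δₗ E.F X (E.F.inv.obj n)))

/-- The structure morphism `G (n ⊙ᵣ Y) ⟶ G n ⊙ᵣ Y` of the inverse `G` of `E`. -/
def invδᵣ (n : N) (Y : D) : E.F.inv.obj (n ⊙ᵣ Y) ⟶ E.F.inv.obj n ⊙ᵣ Y :=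
  E.F.preimage ((E.counitApp (n ⊙ᵣ Y)).hom ≫
    (E.counitApp n).inv ⊵ᵣ Y ≫ inv (δᵣ E.F (E.F.inv.obj n) Y))

/-- The isomorphism `m ≅ G (F m)` for the inverse `G` of the functor `F` underlying `E`. -/
def unitApp (m : M) : m ≅ E.F.inv.obj (E.F.obj m) := E.F.asEquivalence.unitIso.app m

lemma map_unitApp (m : M) : E.F.map (E.unitApp m).hom ≫ (E.counitApp (E.F.obj m)).hom = 𝟙 _ :=
  E.F.asEquivalence.functor_unitIso_comp m

lemma counitApp_naturality {n n' : N} (f : n ⟶ n') :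
    E.F.map (E.F.inv.map f) ≫ (E.counitApp n').hom = (E.counitApp n).hom ≫ f :=
  E.F.asEquivalence.counitIso.hom.naturality f

/-- The defining property of `invδₗ`: the counit is compatible with the left module structures. -/
lemma map_invδₗ (X : C) (n : N) : E.F.map (E.invδₗ X n) ≫ δₗ E.F X (E.F.inv.obj n) ≫
    X ⊴ₗ (E.counitApp n).hom = (E.counitApp (X ⊙ₗ n)).hom := by
  rw [invδₗ, E.F.map_preimage]
  simp only [Category.assoc, IsIso.inv_hom_id_assoc]
  rw [← actionHomRight_comp, Iso.inv_hom_id, actionHomRight_id, Category.comp_id]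

lemma map_invδₗ_assoc (X : C) (n : N) {n' : N} (f : X ⊙ₗ n ⟶ n') :
    E.F.map (E.invδₗ X n) ≫ δₗ E.F X (E.F.inv.obj n) ≫ X ⊴ₗ (E.counitApp n).hom ≫ f =
      (E.counitApp (X ⊙ₗ n)).hom ≫ f := by
  rw [← map_invδₗ, Category.assoc, Category.assoc]

/-- The defining property of `invδᵣ`: the counit is compatible with the right module structures. -/
lemma map_invδᵣ (n : N) (Y : D) : E.F.map (E.invδᵣ n Y) ≫ δᵣ E.F (E.F.inv.obj n) Y ≫
    (E.counitApp n).hom ⊵ᵣ Y = (E.counitApp (n ⊙ᵣ Y)).hom := by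
  rw [invδᵣ, E.F.map_preimage]
  simp only [Category.assoc, IsIso.inv_hom_id_assoc]
  rw [← comp_actionHomLeft, Iso.inv_hom_id, id_actionHomLeft, Category.comp_id]

lemma map_invδᵣ_assoc (n : N) (Y : D) {n' : N} (f : n ⊙ᵣ Y ⟶ n') :
    E.F.map (E.invδᵣ n Y) ≫ δᵣ E.F (E.F.inv.obj n) Y ≫ (E.counitApp n).hom ⊵ᵣ Y ≫ f =
      (E.counitApp (n ⊙ᵣ Y)).hom ≫ f := by
  rw [← map_invδᵣ, Category.assoc, Category.assoc]

instance (X : C) (n : N) : IsIso (E.invδₗ X n) := by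
  have h := E.map_invδₗ X n
  have : IsIso (E.F.map (E.invδₗ X n)) := by
    rw [← IsIso.eq_comp_inv] at h
    rw [h]
    infer_instance
  exact isIso_of_reflects_iso _ E.F

instance (n : N) (Y : D) : IsIso (E.invδᵣ n Y) := by
  have h := E.map_invδᵣ n Y
  have : IsIso (E.F.map (E.invδᵣ n Y)) := by
    rw [← IsIso.eq_comp_inv] at h
    rw [h]
    infer_instance
  exact isIso_of_reflects_iso _ E.F

/-- The left module structure of the inverse of `E`. -/
abbrev invOplaxLeft : E.F.inv.OplaxLeftLinear C where
  δₗ X n := E.invδₗ X n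
  δₗ_naturality_left {X X'} f n := E.ext_left (E.counitApp n) (by
    rw [E.F.map_comp, E.F.map_comp, Category.assoc, Category.assoc, map_invδₗ,
      δₗ_naturality_left_assoc, ← MonoidalLeftAction.action_exchange, map_invδₗ_assoc,
      counitApp_naturality])
  δₗ_naturality_right X n n' g := E.ext_left (E.counitApp n') (by
    rw [E.F.map_comp, E.F.map_comp, Category.assoc, Category.assoc, map_invδₗ,
      δₗ_naturality_right_assoc, ← actionHomRight_comp, counitApp_naturality, counitApp_naturality,
      actionHomRight_comp, map_invδₗ_assoc])
  δₗ_associativity X X' n := by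
    refine E.ext_left (E.F.mapIso (Iso.refl _)) ?_
    -- After this composition `map_invδₗ` turns each side into a counit followed by `αₗ`.
    rw [← cancel_mono (X ⊴ₗ (δₗ E.F X' (E.F.inv.obj n) ≫ X' ⊴ₗ (E.counitApp n).hom))]
    have h2 : E.F.map (E.invδₗ (X ⊗ X') n) ≫ δₗ E.F (X ⊗ X') (E.F.inv.obj n) =
        (E.counitApp ((X ⊗ X') ⊙ₗ n)).hom ≫ (X ⊗ X') ⊴ₗ (E.counitApp n).inv := by
      rw [← map_invδₗ, Category.assoc, Category.assoc, ← actionHomRight_comp, Iso.hom_inv_id,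
        actionHomRight_id, Category.comp_id]
    simp only [E.F.map_comp, Category.assoc, Functor.mapIso_refl, Iso.refl_hom, actionHomRight_id,
      Category.id_comp, actionHomRight_comp]
    rw [← δₗ_associativity_assoc, reassoc_of% h2, δₗ_naturality_right_assoc]
    simp only [← actionHomRight_comp]
    rw [map_invδₗ, map_invδₗ, counitApp_naturality]
    have h3 : (αₗ X X' (E.F.obj (E.F.inv.obj n))).hom ≫ X ⊴ₗ X' ⊴ₗ (E.counitApp n).hom =
        (X ⊗ X') ⊴ₗ (E.counitApp n).hom ≫ (αₗ X X' n).hom := by simp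
    rw [h3, ← actionHomRight_comp_assoc, Iso.inv_hom_id,
      actionHomRight_id, Category.id_comp]
  δₗ_unitality_inv n := by
    refine E.ext_left (E.counitApp n) ?_
    rw [E.F.map_comp, Category.assoc, map_invδₗ, counitApp_naturality,
      ← δₗ_unitality_inv_assoc, MonoidalLeftAction.actionUnitIso_inv_naturality]

/-- The right module structure of the inverse of `E`. -/
abbrev invOplaxRight : E.F.inv.OplaxRightLinear D where
  δᵣ n Y := E.invδᵣ n Y
  δᵣ_naturality_right n Y Y' f := E.ext_right (E.counitApp n) (by
    rw [E.F.map_comp, E.F.map_comp, Category.assoc, Category.assoc, map_invδᵣ,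
      δᵣ_naturality_right_assoc, MonoidalRightAction.action_exchange, map_invδᵣ_assoc,
      counitApp_naturality])
  δᵣ_naturality_left {n n'} g Y := E.ext_right (E.counitApp n') (by
    rw [E.F.map_comp, E.F.map_comp, Category.assoc, Category.assoc, map_invδᵣ,
      δᵣ_naturality_left_assoc, ← comp_actionHomLeft, counitApp_naturality, counitApp_naturality,
      comp_actionHomLeft, map_invδᵣ_assoc])
  δᵣ_associativity n Y Y' := by
    refine E.ext_right (E.F.mapIso (Iso.refl _)) ?_
    -- After this composition `map_invδᵣ` turns each side into a counit followed by `αᵣ`.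
    rw [← cancel_mono ((δᵣ E.F (E.F.inv.obj n) Y ≫ (E.counitApp n).hom ⊵ᵣ Y) ⊵ᵣ Y')]
    have h2 : E.F.map (E.invδᵣ n (Y ⊗ Y')) ≫ δᵣ E.F (E.F.inv.obj n) (Y ⊗ Y') =
        (E.counitApp (n ⊙ᵣ (Y ⊗ Y'))).hom ≫ (E.counitApp n).inv ⊵ᵣ (Y ⊗ Y') := by
      rw [← map_invδᵣ, Category.assoc, Category.assoc, ← comp_actionHomLeft, Iso.hom_inv_id,
        id_actionHomLeft, Category.comp_id]
    simp only [E.F.map_comp, Category.assoc, Functor.mapIso_refl, Iso.refl_hom, id_actionHomLeft,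
      Category.id_comp, comp_actionHomLeft]
    rw [← δᵣ_associativity_assoc, reassoc_of% h2, δᵣ_naturality_left_assoc]
    simp only [← comp_actionHomLeft]
    rw [map_invδᵣ, map_invδᵣ, counitApp_naturality]
    have h3 : (αᵣ (E.F.obj (E.F.inv.obj n)) Y Y').hom ≫ ((E.counitApp n).hom ⊵ᵣ Y) ⊵ᵣ Y' =
        (E.counitApp n).hom ⊵ᵣ (Y ⊗ Y') ≫ (αᵣ n Y Y').hom := by simp
    rw [h3, ← comp_actionHomLeft_assoc, Iso.inv_hom_id,
      id_actionHomLeft, Category.id_comp]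
  δᵣ_unitality_inv n := by
    refine E.ext_right (E.counitApp n) ?_
    rw [E.F.map_comp, Category.assoc, map_invδᵣ, counitApp_naturality,
      ← δᵣ_unitality_inv_assoc, MonoidalRightAction.actionUnitIso_inv_naturality]

/-- The inverse of a bimodule functor whose underlying functor is an equivalence. -/
def inverse : BimoduleFunctor k C D N M where
  F := E.F.inv
  additive := by
    have : E.F.asEquivalence.functor.Additive := E.additive
    exact inferInstanceAs E.F.asEquivalence.inverse.Additive
  linear := by
    have : E.F.asEquivalence.functor.Additive := E.additive
    have : E.F.asEquivalence.functor.Linear k := E.linear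
    exact inferInstanceAs (E.F.asEquivalence.inverse.Linear k)
  left := E.invOplaxLeft
  right := E.invOplaxRight
  isIso_left X n := inferInstanceAs (IsIso (E.invδₗ X n))
  isIso_right n Y := inferInstanceAs (IsIso (E.invδᵣ n Y))
  compat X n Y := by
    change E.F.inv.map (BimoduleCategory.γ X n Y).hom ≫ E.invδₗ X (n ⊙ᵣ Y) ≫ X ⊴ₗ E.invδᵣ n Y =
      E.invδᵣ (X ⊙ₗ n) Y ≫ E.invδₗ X n ⊵ᵣ Y ≫ (BimoduleCategory.γ X (E.F.inv.obj n) Y).hom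
    refine E.ext_left (E.F.mapIso (Iso.refl _)) ?_
    rw [← cancel_mono (X ⊴ₗ (δᵣ E.F (E.F.inv.obj n) Y ≫ (E.counitApp n).hom ⊵ᵣ Y))]
    simp only [E.F.map_comp, Category.assoc, Functor.mapIso_refl, Iso.refl_hom, actionHomRight_id,
      Category.id_comp, actionHomRight_comp]
    rw [reassoc_of% (E.compat X (E.F.inv.obj n) Y), δₗ_naturality_right_assoc,
      δᵣ_naturality_left_assoc, ← BimoduleCategory.γ_nat_mid]
    simp only [← actionHomRight_comp, ← comp_actionHomLeft_assoc, Category.assoc]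
    rw [map_invδᵣ, map_invδₗ, map_invδₗ, counitApp_naturality, map_invδᵣ_assoc]

end BimoduleFunctor

/-- A bimodule functor whose underlying functor is an equivalence of categories is an equivalence
of bimodule categories. -/
def BimoduleEquivalence.ofIsEquivalence [E.F.IsEquivalence] : BimoduleEquivalence k C D M N where
  functor := E
  inverse := E.inverse
  unitIso := E.F.asEquivalence.unitIso
  counitIso := E.F.asEquivalence.counitIso
  unit_left X m := by
    refine E.ext_left (E.counitApp (E.F.obj m)) ?_
    change E.F.map ((E.unitApp (X ⊙ₗ m)).hom ≫ E.F.inv.map (δₗ E.F X m) ≫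
      E.invδₗ X (E.F.obj m)) ≫ _ = E.F.map (X ⊴ₗ (E.unitApp m).hom) ≫ _
    rw [E.F.map_comp, E.F.map_comp, Category.assoc, Category.assoc, E.map_invδₗ,
      E.counitApp_naturality, δₗ_naturality_right_assoc, ← actionHomRight_comp,
      E.map_unitApp, reassoc_of% (E.map_unitApp (X ⊙ₗ m)), actionHomRight_id,
      Category.comp_id]
  unit_right m Y := by
    refine E.ext_right (E.counitApp (E.F.obj m)) ?_
    change E.F.map ((E.unitApp (m ⊙ᵣ Y)).hom ≫ E.F.inv.map (δᵣ E.F m Y) ≫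
      E.invδᵣ (E.F.obj m) Y) ≫ _ = E.F.map ((E.unitApp m).hom ⊵ᵣ Y) ≫ _
    rw [E.F.map_comp, E.F.map_comp, Category.assoc, Category.assoc, E.map_invδᵣ,
      E.counitApp_naturality, δᵣ_naturality_left_assoc, ← comp_actionHomLeft,
      E.map_unitApp, reassoc_of% (E.map_unitApp (m ⊙ᵣ Y)), id_actionHomLeft,
      Category.comp_id]
  counit_left X n := E.map_invδₗ X n
  counit_right n Y := E.map_invδᵣ n Y

end Bimodule

end HopfBimod

end AbstractBimodule

/-! ### The antipode of a finite-dimensional Hopf algebra -/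

section Antipode

open HopfAlgebra WithConv

namespace HopfBimod

variable {k : Type*} [Field k] {B : Type*} [Ring B] [HopfAlgebra k B]

/-- For an algebra map `f` the composite `f ∘ S` with the antipode is the convolution inverse of
`f`, so that it determines `f`. -/
lemma algHom_ext_of_antipode {C : Type*} [Ring C] [Algebra k C] {f g : B →ₐ[k] C}
    (h : ∀ b, f (antipode k b) = g (antipode k b)) : f = g := by
  have key : ∀ f : B →ₐ[k] C,
      toConv f.toLinearMap * toConv (f.toLinearMap ∘ₗ antipode k) = 1 ∧
      toConv (f.toLinearMap ∘ₗ antipode k) * toConv f.toLinearMap = 1 := by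
    intro f
    constructor
    · have := LinearMap.algHom_comp_convMul_distrib f (toConv (LinearMap.id (R := k) (M := B)))
        (toConv (antipode k))
      rw [LinearMap.id_mul_antipode] at this
      refine Eq.trans (congrArg toConv this.symm) ?_
      ext b
      simp
    · have := LinearMap.algHom_comp_convMul_distrib f (toConv (antipode k))
        (toConv (LinearMap.id (R := k) (M := B)))
      rw [LinearMap.antipode_mul_id] at this
      refine Eq.trans (congrArg toConv this.symm) ?_
      ext b
      simp
  have e : f.toLinearMap ∘ₗ antipode k = g.toLinearMap ∘ₗ antipode k := LinearMap.ext h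
  have h1 := left_inv_eq_right_inv (key f).1 (e ▸ (key g).2)
  exact AlgHom.toLinearMap_injective (toConv_injective h1)

/-- An algebra map is determined by its restriction to the image of a power of the antipode. -/
lemma algHom_ext_of_antipode_pow (n : ℕ) : ∀ {C : Type _} [Ring C] [Algebra k C]
    {f g : B →ₐ[k] C}, (∀ b, f ((antipode k ^ n) b) = g ((antipode k ^ n) b)) → f = g := by
  induction n with
  | zero => exact fun h => AlgHom.ext h
  | succ n ih =>
    intro C _ _ f g h
    have h1 := ih (f := (AlgHom.op f).comp (antipodeAlgHomOp k B))
      (g := (AlgHom.op g).comp (antipodeAlgHomOp k B)) fun b => by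
        have := h b
        rw [pow_succ'] at this
        exact congrArg MulOpposite.op this
    exact algHom_ext_of_antipode fun b => MulOpposite.op_injective (AlgHom.congr_fun h1 b)

variable (k B) in
/-- The square of the antipode is multiplicative, hence so are its powers. -/
def antipodeSqPow (n : ℕ) : B →ₐ[k] B :=
  AlgHom.ofLinearMap ((antipode k * antipode k) ^ n)
    (by induction n with
      | zero => rfl
      | succ n ih => simp [pow_succ, ih])
    (by induction n with
      | zero => exact fun _ _ => rfl
      | succ n ih => simp [pow_succ, ih, antipode_mul_antidistrib])

variable [FiniteDimensional k B]

variable (k B) in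
/-- The antipode of a finite-dimensional Hopf algebra is bijective. By Fitting's lemma `B` is the
direct sum of the kernel and the image of an even power `T` of the antipode; the projection onto
the image of `T` is an algebra map that agrees with the identity there, so it is the identity. -/
lemma antipode_bijective : Function.Bijective (antipode k : B →ₗ[k] B) := by
  obtain ⟨n, hn, hn1⟩ := (LinearMap.eventually_isCompl_ker_pow_range_pow
    (antipode k * antipode k : Module.End k B)).and (Filter.eventually_ge_atTop 1) |>.exists
  let T := antipodeSqPow k B n
  have hT : ∀ b, T b = ((antipode k * antipode k : Module.End k B) ^ n) b := fun _ => rfl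
  let T' : T.range →ₐ[k] T.range := (T.comp T.range.val).codRestrict T.range fun b => ⟨b, rfl⟩
  have inj : Function.Injective T' := by
    rw [injective_iff_map_eq_zero]
    rintro ⟨b, c, rfl⟩ h
    have h1 : T (T c) = 0 := congrArg Subtype.val h
    have h2 := Submodule.disjoint_def.1 hn.disjoint (T c) h1 ⟨c, rfl⟩
    exact Subtype.ext h2
  let E : T.range ≃ₐ[k] T.range := AlgEquiv.ofBijective T'
    ⟨inj, LinearMap.injective_iff_surjective (f := T'.toLinearMap).1 inj⟩
  let e : B →ₐ[k] B := T.range.val.comp (E.symm.toAlgHom.comp T.rangeRestrict)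
  have he : e = AlgHom.id k B := algHom_ext_of_antipode_pow (2 * n) fun b => by
    have h1 : ((antipode k : Module.End k B) ^ (2 * n)) b = T b := by
      rw [pow_mul, pow_two]
      rfl
    rw [h1]
    have h2 : T.rangeRestrict (T b) = E ⟨T b, b, rfl⟩ := rfl
    change ((E.symm (T.rangeRestrict (T b)) : T.range) : B) = T b
    rw [h2, E.symm_apply_apply]
  have surj : Function.Surjective (antipode k : B →ₗ[k] B) := fun b => by
    obtain ⟨c, hc⟩ : ∃ c, T c = b := by
      have h : ((E.symm (T.rangeRestrict b) : T.range) : B) = b := AlgHom.congr_fun he b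
      obtain ⟨c, hc⟩ := (E.symm (T.rangeRestrict b)).2
      exact ⟨c, hc.trans h⟩
    obtain ⟨m, rfl⟩ := Nat.exists_eq_add_of_le' hn1
    rw [hT, pow_succ'] at hc
    exact ⟨_, hc⟩
  exact ⟨LinearMap.injective_iff_surjective.2 surj, surj⟩

variable (k B) in
/-- The inverse of the antipode of a finite-dimensional Hopf algebra. -/
noncomputable def antipodeInv : B →ₗ[k] B :=
  (LinearEquiv.ofBijective _ (antipode_bijective k B)).symm.toLinearMap

lemma antipode_antipodeInv (b : B) : antipode k (antipodeInv k B b) = b :=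
  (LinearEquiv.ofBijective _ (antipode_bijective k B)).apply_symm_apply b

lemma antipodeInv_mul (a b : B) :
    antipodeInv k B (a * b) = antipodeInv k B b * antipodeInv k B a :=
  (antipode_bijective k B).1 (by
    simp only [antipode_mul_antidistrib, antipode_antipodeInv])

/-- The identity `b₍₂₎ S⁻¹(b₍₁₎) = ε(b)`. -/
lemma mul_antipodeInv_comul (b : B) :
    LinearMap.mul' k B (TensorProduct.comm k B B (TensorProduct.map (antipodeInv k B) .id
      (Coalgebra.comul (R := k) b))) = algebraMap k B (Coalgebra.counit (R := k) b) := by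
  apply (antipode_bijective k B).1
  have h : ∀ w : B ⊗[k] B, antipode k (LinearMap.mul' k B (TensorProduct.comm k B B
      (TensorProduct.map (antipodeInv k B) .id w))) =
      LinearMap.mul' k B ((antipode k).lTensor B w) := by
    intro w
    induction w with
    | zero => simp only [map_zero]
    | add x y hx hy => simp only [map_add, hx, hy]
    | tmul x y => simp [antipode_mul_antidistrib, antipode_antipodeInv]
  rw [h, mul_antipode_lTensor_comul_apply, Algebra.algebraMap_eq_smul_one, map_smul, antipode_one]

/-- The identity `S⁻¹(b₍₂₎) b₍₁₎ = ε(b)`. -/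
lemma antipodeInv_mul_comul (b : B) :
    LinearMap.mul' k B (TensorProduct.comm k B B (TensorProduct.map .id (antipodeInv k B)
      (Coalgebra.comul (R := k) b))) = algebraMap k B (Coalgebra.counit (R := k) b) := by
  apply (antipode_bijective k B).1
  have h : ∀ w : B ⊗[k] B, antipode k (LinearMap.mul' k B (TensorProduct.comm k B B
      (TensorProduct.map .id (antipodeInv k B) w))) =
      LinearMap.mul' k B ((antipode k).rTensor B w) := by
    intro w
    induction w with
    | zero => simp only [map_zero]
    | add x y hx hy => simp only [map_add, hx, hy]
    | tmul x y => simp [antipode_mul_antidistrib, antipode_antipodeInv]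
  rw [h, mul_antipode_rTensor_comul_apply, Algebra.algebraMap_eq_smul_one, map_smul, antipode_one]

end HopfBimod

end Antipode

/-! ### Invertibility of the module structure of a tensor product functor -/

noncomputable section StrEquiv

namespace HopfBimod

namespace Bal

variable {k : Type u} [Field k] {S B : Type u} [Ring S] [Algebra k S]
  {V W X Z : Type u} [AddCommGroup V] [Module k V] [AddCommGroup W] [Module k W]
  [AddCommGroup X] [Module k X] [AddCommGroup Z] [Module k Z]

/-- In a comodule, `v₍₀₎` tensored with a product of `v₍₋₂₎` and `v₍₋₁₎` that vanishes up to the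
counit collapses to `v`. -/
lemma comodule_collapse [Ring B] [Bialgebra k B] {δ : V →ₗ[k] B ⊗[k] V}
    (c : ∀ v, TensorProduct.assoc k B B V (TensorProduct.map (Coalgebra.comul (R := k)) .id
      (δ v)) = TensorProduct.map .id δ (δ v))
    (cu : ∀ v, TensorProduct.lid k V (TensorProduct.map (Coalgebra.counit (R := k)) .id
      (δ v)) = v) (m : B ⊗[k] B →ₗ[k] B)
    (hm : ∀ b, m (Coalgebra.comul (R := k) b) = algebraMap k B (Coalgebra.counit (R := k) b))
    (v : V) :
    TensorProduct.map m .id ((TensorProduct.assoc k B B V).symm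
      (TensorProduct.map .id δ (δ v))) = 1 ⊗ₜ v := by
  have h : ∀ w : B ⊗[k] V, TensorProduct.map m .id ((TensorProduct.assoc k B B V).symm
      (TensorProduct.assoc k B B V (TensorProduct.map (Coalgebra.comul (R := k)) .id w))) =
      1 ⊗ₜ TensorProduct.lid k V (TensorProduct.map (Coalgebra.counit (R := k)) .id w) := by
    intro w
    rw [LinearEquiv.symm_apply_apply]
    induction w with
    | zero => simp only [map_zero, TensorProduct.tmul_zero]
    | add x y hx hy => simp only [map_add, hx, hy, TensorProduct.tmul_add]
    | tmul b v =>
      simp only [TensorProduct.map_tmul, LinearMap.id_apply, hm, TensorProduct.lid_tmul]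
      rw [Algebra.algebraMap_eq_smul_one, TensorProduct.smul_tmul]
  rw [← c, h, cu]

variable [Ring B] [HopfAlgebra k B] [FiniteDimensional k B]

variable (r : S →ₗ[k] Module.End k V) (l : S →ₐ[k] Module.End k W)
  (f : S →ₐ[k] B ⊗[k] S) (a : B →ₐ[k] Module.End k X)

/-- The map `(b ⊗ v) ⊗ (x ⊗ w) ↦ v ⊗ (S⁻¹(b) x ⊗ w)`. -/
def qq : (B ⊗[k] V) ⊗[k] (X ⊗[k] W) →ₗ[k] Bal r (trep f a l) :=
  mk r (trep f a l) ∘ₗ (TensorProduct.leftComm k X V W).toLinearMap ∘ₗ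
    TensorProduct.map (TensorProduct.lift (a.toLinearMap ∘ₗ antipodeInv k B)) .id ∘ₗ
      (TensorProduct.tensorTensorTensorComm k B V X W).toLinearMap

lemma qq_tmul (b : B) (v : V) (x : X) (w : W) :
    qq r l f a ((b ⊗ₜ v) ⊗ₜ (x ⊗ₜ w)) =
      mk r (trep f a l) (v ⊗ₜ (a (antipodeInv k B b) x ⊗ₜ w)) := rfl

/-- The identity `s₍₋₁₎ S⁻¹(s₍₋₂₎) x ⊗ s₍₀₎ w = x ⊗ s w`. -/
lemma trep_antipodeInv
    (fc : ∀ s, TensorProduct.assoc k B B S (TensorProduct.map (Coalgebra.comul (R := k)) .id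
      (f s)) = TensorProduct.map .id f.toLinearMap (f s))
    (fu : ∀ s, TensorProduct.lid k S (TensorProduct.map (Coalgebra.counit (R := k)) .id
      (f s)) = s) (s : S) (x : X) (w : W) :
    TensorProduct.lift ((trep f a l).toLinearMap.flip ∘ₗ (TensorProduct.mk k X W).flip w ∘ₗ
      a.toLinearMap.flip x ∘ₗ antipodeInv k B) (f s) = x ⊗ₜ l s w := by
  let T : B ⊗[k] S →ₗ[k] X ⊗[k] W :=
    TensorProduct.map (a.toLinearMap.flip x) (l.toLinearMap.flip w)
  let m : B ⊗[k] B →ₗ[k] B := LinearMap.mul' k B ∘ₗ (TensorProduct.comm k B B).toLinearMap ∘ₗ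
    TensorProduct.map (antipodeInv k B) .id
  have h : ∀ u : B ⊗[k] S, TensorProduct.lift ((trep f a l).toLinearMap.flip ∘ₗ
      (TensorProduct.mk k X W).flip w ∘ₗ a.toLinearMap.flip x ∘ₗ antipodeInv k B) u =
      T (TensorProduct.map m .id ((TensorProduct.assoc k B B S).symm
        (TensorProduct.map .id f.toLinearMap u))) := by
    intro u
    induction u with
    | zero => simp only [map_zero]
    | add u u' hu hu' => simp only [map_add, hu, hu']
    | tmul b s =>
      change trep f a l s (a (antipodeInv k B b) x ⊗ₜ w) =
        T (TensorProduct.map m .id ((TensorProduct.assoc k B B S).symm (b ⊗ₜ f s)))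
      rw [trep_apply]
      induction f s with
      | zero => simp only [map_zero, LinearMap.zero_apply, TensorProduct.tmul_zero]
      | add u u' hu hu' => simp only [map_add, LinearMap.add_apply, TensorProduct.tmul_add, hu, hu']
      | tmul c t =>
        change a c (a (antipodeInv k B b) x) ⊗ₜ[k] l t w = a (c * antipodeInv k B b) x ⊗ₜ[k] l t w
        rw [map_mul]
        rfl
  rw [h]
  refine (congrArg T (comodule_collapse (δ := f.toLinearMap) fc fu m
    mul_antipodeInv_comul s)).trans ?_
  change a 1 x ⊗ₜ[k] l s w = _
  rw [map_one]
  rfl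

/-- The map `qq` is balanced over the diagonal action of `S` on `B ⊗ V`, so that it induces a map on
`X ⊗ (V ⊗_S W)`. -/
lemma qq_bal
    (fc : ∀ s, TensorProduct.assoc k B B S (TensorProduct.map (Coalgebra.comul (R := k)) .id
      (f s)) = TensorProduct.map .id f.toLinearMap (f s))
    (fu : ∀ s, TensorProduct.lid k S (TensorProduct.map (Coalgebra.counit (R := k)) .id
      (f s)) = s) (s : S) (d : B ⊗[k] V) (x : X) (w : W) :
    qq r l f a (tact (LinearMap.mul k B).flip r (f s) d ⊗ₜ (x ⊗ₜ w)) =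
      qq r l f a (d ⊗ₜ (x ⊗ₜ l s w)) := by
  induction d with
  | zero => simp only [map_zero, TensorProduct.zero_tmul]
  | add d d' hd hd' => simp only [map_add, TensorProduct.add_tmul, hd, hd']
  | tmul b v =>
    have h : ∀ u : B ⊗[k] S,
        qq r l f a (tact (LinearMap.mul k B).flip r u (b ⊗ₜ v) ⊗ₜ (x ⊗ₜ w)) =
        mk r (trep f a l) (v ⊗ₜ TensorProduct.lift ((trep f a l).toLinearMap.flip ∘ₗ
          (TensorProduct.mk k X W).flip w ∘ₗ a.toLinearMap.flip (a (antipodeInv k B b) x) ∘ₗ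
            antipodeInv k B) u) := by
      intro u
      induction u with
      | zero => simp only [map_zero, LinearMap.zero_apply, TensorProduct.tmul_zero,
          TensorProduct.zero_tmul]
      | add u u' hu hu' => simp only [map_add, LinearMap.add_apply, TensorProduct.tmul_add,
          TensorProduct.add_tmul, hu, hu']
      | tmul c t =>
        change mk r (trep f a l) (r t v ⊗ₜ (a (antipodeInv k B (b * c)) x ⊗ₜ w)) =
          mk r (trep f a l) (v ⊗ₜ trep f a l t
            (a (antipodeInv k B c) (a (antipodeInv k B b) x) ⊗ₜ w))
        rw [mk_rel, antipodeInv_mul, map_mul]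
        rfl
    rw [h, trep_antipodeInv l f a fc fu, qq_tmul]

variable {r l f} {δ : V →ₗ[k] B ⊗[k] V}
    (h : ∀ s v, δ (r s v) = tact (LinearMap.mul k B).flip r (f s) (δ v))

/-- The map `X ⊗ (V ⊗_S W) → V ⊗_S (X ⊗ W)`, `x ⊗ (v ⊗ w) ↦ v₍₀₎ ⊗ (S⁻¹(v₍₋₁₎) x ⊗ w)`. -/
def strInv
    (fc : ∀ s, TensorProduct.assoc k B B S (TensorProduct.map (Coalgebra.comul (R := k)) .id
      (f s)) = TensorProduct.map .id f.toLinearMap (f s))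
    (fu : ∀ s, TensorProduct.lid k S (TensorProduct.map (Coalgebra.counit (R := k)) .id
      (f s)) = s) : X ⊗[k] Bal r l →ₗ[k] Bal r (trep f a l) :=
  TensorProduct.lift (LinearMap.flip (lift (TensorProduct.curry (qq r l f a ∘ₗ
    TensorProduct.map δ .id ∘ₗ (TensorProduct.leftComm k X V W).toLinearMap ∘ₗ
      (TensorProduct.comm k (V ⊗[k] W) X).toLinearMap)) fun s v w => LinearMap.ext fun x =>
          (congrArg (fun t => qq r l f a (t ⊗ₜ (x ⊗ₜ w))) (h s v)).trans
            (qq_bal r l f a fc fu s (δ v) x w)))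

lemma strInv_tmul (fc) (fu) (x : X) (v : V) (w : W) :
    strInv a h fc fu (x ⊗ₜ mk r l (v ⊗ₜ w)) = qq r l f a (δ v ⊗ₜ (x ⊗ₜ w)) := rfl

/-- The map `v ⊗ (x ⊗ w) ↦ v₍₋₁₎ x ⊗ (v₍₀₎ ⊗ w)` is bijective, with inverse
`x ⊗ (v ⊗ w) ↦ v₍₀₎ ⊗ (S⁻¹(v₍₋₁₎) x ⊗ w)`. -/
lemma str_bijective
    (fc : ∀ s, TensorProduct.assoc k B B S (TensorProduct.map (Coalgebra.comul (R := k)) .id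
      (f s)) = TensorProduct.map .id f.toLinearMap (f s))
    (fu : ∀ s, TensorProduct.lid k S (TensorProduct.map (Coalgebra.counit (R := k)) .id
      (f s)) = s)
    (c : ∀ v, TensorProduct.assoc k B B V (TensorProduct.map (Coalgebra.comul (R := k)) .id
      (δ v)) = TensorProduct.map .id δ (δ v))
    (cu : ∀ v, TensorProduct.lid k V (TensorProduct.map (Coalgebra.counit (R := k)) .id
      (δ v)) = v) : Function.Bijective (str (l := l) f δ h a) := by
  refine Function.bijective_iff_has_inverse.2 ⟨strInv a h fc fu, fun z => ?_, fun z => ?_⟩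
  · let m : B ⊗[k] B →ₗ[k] B := LinearMap.mul' k B ∘ₗ (TensorProduct.comm k B B).toLinearMap ∘ₗ
      TensorProduct.map .id (antipodeInv k B)
    refine LinearMap.congr_fun (f := strInv a h fc fu ∘ₗ str (l := l) f δ h a)
      (g := LinearMap.id) (ext₂ fun v x w => ?_) z
    let T : B ⊗[k] V →ₗ[k] Bal r (trep f a l) :=
      mk r (trep f a l) ∘ₗ (TensorProduct.leftComm k X V W).toLinearMap ∘ₗ
        (TensorProduct.assoc k X V W).toLinearMap ∘ₗ
        (TensorProduct.mk k (X ⊗[k] V) W).flip w ∘ₗ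
          TensorProduct.map (a.toLinearMap.flip x) .id
    have h1 : ∀ d : B ⊗[k] V, strInv a h fc fu (nn r l a (d ⊗ₜ (x ⊗ₜ w))) =
        T (TensorProduct.map m .id ((TensorProduct.assoc k B B V).symm
          (TensorProduct.map .id δ d))) := by
      intro d
      induction d with
      | zero => simp only [map_zero, TensorProduct.zero_tmul]
      | add d d' hd hd' => simp only [map_add, TensorProduct.add_tmul, hd, hd']
      | tmul b v =>
        rw [nn_tmul, strInv_tmul]
        change _ = T (TensorProduct.map m .id ((TensorProduct.assoc k B B V).symm (b ⊗ₜ δ v)))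
        induction δ v with
        | zero => simp only [map_zero, TensorProduct.zero_tmul, TensorProduct.tmul_zero]
        | add d d' hd hd' => simp only [map_add, TensorProduct.add_tmul, TensorProduct.tmul_add,
            hd, hd']
        | tmul b' v =>
          rw [qq_tmul]
          change _ = mk r (trep f a l) (v ⊗ₜ (a (antipodeInv k B b' * b) x ⊗ₜ w))
          rw [map_mul]
          rfl
    rw [LinearMap.comp_apply, str_mk, h1, comodule_collapse c cu m antipodeInv_mul_comul]
    change mk r (trep f a l) (v ⊗ₜ (a 1 x ⊗ₜ w)) = _
    rw [map_one]
    rfl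
  · let m : B ⊗[k] B →ₗ[k] B := LinearMap.mul' k B ∘ₗ (TensorProduct.comm k B B).toLinearMap ∘ₗ
      TensorProduct.map (antipodeInv k B) .id
    refine LinearMap.congr_fun (f := str (l := l) f δ h a ∘ₗ strInv a h fc fu)
      (g := LinearMap.id) (ext_tensor fun x v w => ?_) z
    let T : B ⊗[k] V →ₗ[k] X ⊗[k] Bal r l :=
      TensorProduct.map (a.toLinearMap.flip x) (mk r l ∘ₗ (TensorProduct.mk k V W).flip w)
    have h1 : ∀ d : B ⊗[k] V, str (l := l) f δ h a (qq r l f a (d ⊗ₜ (x ⊗ₜ w))) =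
        T (TensorProduct.map m .id ((TensorProduct.assoc k B B V).symm
          (TensorProduct.map .id δ d))) := by
      intro d
      induction d with
      | zero => simp only [map_zero, TensorProduct.zero_tmul]
      | add d d' hd hd' => simp only [map_add, TensorProduct.add_tmul, hd, hd']
      | tmul b v =>
        rw [qq_tmul, str_mk]
        change _ = T (TensorProduct.map m .id ((TensorProduct.assoc k B B V).symm (b ⊗ₜ δ v)))
        induction δ v with
        | zero => simp only [map_zero, TensorProduct.zero_tmul, TensorProduct.tmul_zero]
        | add d d' hd hd' => simp only [map_add, TensorProduct.add_tmul, TensorProduct.tmul_add,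
            hd, hd']
        | tmul b' v =>
          rw [nn_tmul]
          change _ = a (b' * antipodeInv k B b) x ⊗ₜ[k] mk r l (v ⊗ₜ w)
          rw [map_mul]
          rfl
    rw [LinearMap.comp_apply, strInv_tmul, h1, comodule_collapse c cu m mul_antipodeInv_comul]
    change a 1 x ⊗ₜ[k] mk r l (v ⊗ₜ w) = _
    rw [map_one]
    rfl

end Bal

end HopfBimod

end StrEquiv

/-! ### Tensor product functors and free modules -/

noncomputable section TensorFunctor

open FDMod

namespace HopfBimod

section

variable {k : Type u} [Field k] {S : Type u} [Ring S] [Algebra k S]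
  {V X Y Z : Type u} [AddCommGroup V] [Module k V] [AddCommGroup X] [Module k X]
  [AddCommGroup Y] [Module k Y] [AddCommGroup Z] [Module k Z] {r : S →ₗ[k] Module.End k V}
  {lX : S →ₐ[k] Module.End k X} {lY : S →ₐ[k] Module.End k Y} {lZ : S →ₐ[k] Module.End k Z}

namespace Bal

lemma map_surjective (g : Y →ₗ[k] Z) (hg : ∀ s y, g (lY s y) = lZ s (g y))
    (h : Function.Surjective g) :
    Function.Surjective (map (r := r) (r' := r) .id g (fun _ _ => rfl) hg) := fun z => by
  obtain ⟨t, rfl⟩ := mk_surjective r lZ z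
  obtain ⟨u, rfl⟩ := LinearMap.lTensor_surjective V h t
  exact ⟨mk r lY u, rfl⟩

/-- The functor `V ⊗_S -` is right exact: the relations defining `V ⊗_S Z` lift along a
surjection `Y → Z`. -/
lemma map_exact (f : X →ₗ[k] Y) (g : Y →ₗ[k] Z) (hf : ∀ s x, f (lX s x) = lY s (f x))
    (hg : ∀ s y, g (lY s y) = lZ s (g y)) (he : Function.Exact f g)
    (h : Function.Surjective g) :
    Function.Exact (map (r := r) (r' := r) .id f (fun _ _ => rfl) hf)
      (map (r := r) (r' := r) .id g (fun _ _ => rfl) hg) := fun z => by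
  refine ⟨fun hz => ?_, ?_⟩
  · obtain ⟨t, rfl⟩ := mk_surjective r lY z
    have h1 : balRel r lZ ≤ (balRel r lY).map (LinearMap.lTensor V g) := by
      refine Submodule.span_le.2 ?_
      rintro _ ⟨s, v, w, rfl⟩
      obtain ⟨y, rfl⟩ := h w
      refine ⟨r s v ⊗ₜ y - v ⊗ₜ lY s y, Submodule.subset_span ⟨s, v, y, rfl⟩, ?_⟩
      rw [map_sub, LinearMap.lTensor_tmul, LinearMap.lTensor_tmul, hg]
    obtain ⟨t', ht', e⟩ := h1 ((Submodule.Quotient.mk_eq_zero _).1 hz)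
    have e' : LinearMap.lTensor V g (t - t') = 0 := by
      rw [map_sub, e]
      exact sub_self _
    obtain ⟨u, hu⟩ := (lTensor_exact V he h _).1 e'
    refine ⟨mk r lX u, ?_⟩
    have e0 : mk r lY t' = 0 := (Submodule.Quotient.mk_eq_zero _).2 ht'
    refine (congrArg (mk r lY) hu).trans ?_
    rw [map_sub, e0, sub_zero]
  · rintro ⟨x, rfl⟩
    refine LinearMap.congr_fun (f := map (r := r) (r' := r) .id g (fun _ _ => rfl) hg ∘ₗ
      map (r := r) (r' := r) .id f (fun _ _ => rfl) hf) (g := 0) (ext fun v x => ?_) x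
    change mk r lZ (v ⊗ₜ g (f x)) = 0
    rw [he.apply_apply_eq_zero, TensorProduct.tmul_zero, map_zero]

end Bal

end

variable {k : Type u} [Field k] {A B : Type u} [Ring A] [Bialgebra k A] [Ring B]

section

variable [Bialgebra k B] {K S : ComodAlg k (Cop A ⊗[k] B)} (P : RelBimod K S)

lemma rightExact_tensorFunctor : RightExact (tensorFunctor P) := fun _ _ _ f g he hg =>
  ⟨Bal.map_exact (lin f) (lin g) (lin_ρ f) (lin_ρ g) he hg,
    Bal.map_surjective (lin g) (lin_ρ g) hg⟩

end

variable [HopfAlgebra k B] [FiniteDimensional k B] {K S : ComodAlg k (Cop A ⊗[k] B)}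
  (P : RelBimod K S)

/-- The structure maps of `N ↦ P ⊗_S N` are invertible because the antipode of `B` is. -/
lemma isModuleFunctor_tensorFunctor : IsModuleFunctor S K (tensorFunctor P) where
  additive := ⟨fun {X Y f g} => hom_ext (Bal.ext fun p n =>
    (congrArg (Bal.mk P.ρR Y.ρ) (TensorProduct.tmul_add p (lin f n) (lin g n))).trans
      (map_add _ _ _))⟩
  linear := ⟨fun {X Y} f c => hom_ext (Bal.ext fun p n =>
    (congrArg (Bal.mk P.ρR Y.ρ) (TensorProduct.tmul_smul c p (lin f n))).trans
      (map_smul _ _ _))⟩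
  isIso X N := (isoMk (M := (tensorFunctor P).obj (X ⊙ₗ N)) (N := X ⊙ₗ (tensorFunctor P).obj N)
    (LinearEquiv.ofBijective (Bal.str (l := N.ρ) S.coB P.δ P.δ_right X.ρ)
      (Bal.str_bijective X.ρ P.δ_right S.coB_coassoc S.coB_counit P.δ_coassoc P.δ_counit))
    (Bal.str_repL P.δ_right X.ρ P.ρ (fun r s p => P.ρ_ρR r s p) P.δ_left)).isIso_hom

end HopfBimod

end TensorFunctor

noncomputable section RegularModule

namespace HopfBimod

namespace FDMod

variable {k : Type u} [Field k] {S : Type u} [Ring S] [Algebra k S]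

lemma lin_sum {N N' : FDMod k S} {ι : Type*} (s : Finset ι) (f : ι → (N ⟶ N')) :
    lin (∑ i ∈ s, f i) = ∑ i ∈ s, lin (f i) := by
  induction s using Finset.cons_induction with
  | empty => rfl
  | cons i s hi hs => rw [Finset.sum_cons, Finset.sum_cons, lin_add, hs]

/-- The kernel of a morphism. -/
abbrev ker {N N' : FDMod k S} (g : N ⟶ N') : FDMod k S where
  carrier := LinearMap.ker (lin g)
  ρ :=
    { toFun := fun s => (N.ρ s).restrict fun n hn => by
        rw [LinearMap.mem_ker] at hn ⊢
        rw [lin_ρ, hn, map_zero]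
      map_one' := LinearMap.ext fun n => Subtype.ext (by simp)
      map_mul' := fun s t => LinearMap.ext fun n => Subtype.ext (by simp)
      map_zero' := LinearMap.ext fun n => Subtype.ext (by simp)
      map_add' := fun s t => LinearMap.ext fun n => Subtype.ext (by simp)
      commutes' := fun c => LinearMap.ext fun n => Subtype.ext (by simp) }

/-- The inclusion of the kernel. -/
def kerι {N N' : FDMod k S} (g : N ⟶ N') : ker g ⟶ N :=
  mk' (LinearMap.ker (lin g)).subtype fun _ _ => rfl

lemma exact_kerι {N N' : FDMod k S} (g : N ⟶ N') : Function.Exact (lin (kerι g)) (lin g) :=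
  LinearMap.exact_subtype_ker_map (lin g)

variable [FiniteDimensional k S]

variable (k S) in
/-- The regular left module. -/
abbrev regular : FDMod k S where
  carrier := S
  ρ := Algebra.lmul k S

/-- The map `s ↦ s n` from the regular module to `N`. -/
def fromRegular (N : FDMod k S) (n : N.carrier) : regular k S ⟶ N :=
  mk' (N.ρ.toLinearMap.flip n) fun s t => by
    change N.ρ (s * t) n = _
    rw [map_mul]
    rfl

lemma fromRegular_comp {N N' : FDMod k S} (g : N ⟶ N') (n : N.carrier) :
    fromRegular N n ≫ g = fromRegular N' (lin g n) :=
  hom_ext (LinearMap.ext fun s => lin_ρ g s n)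

lemma fromRegular_one : fromRegular (regular k S) 1 = 𝟙 _ :=
  hom_ext (LinearMap.ext fun s => mul_one s)

lemma fromRegular_add (N : FDMod k S) (n n' : N.carrier) :
    fromRegular N (n + n') = fromRegular N n + fromRegular N n' :=
  hom_ext (LinearMap.ext fun s => map_add (N.ρ s) n n')

lemma fromRegular_smul (N : FDMod k S) (c : k) (n : N.carrier) :
    fromRegular N (c • n) = c • fromRegular N n :=
  hom_ext (LinearMap.ext fun s => map_smul (N.ρ s) c n)

variable (k S) in
/-- The free left module of rank `n`. -/
abbrev free (n : ℕ) : FDMod k S where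
  carrier := Fin n → S
  ρ := Algebra.lsmul k k (Fin n → S)

/-- The `i`-th coordinate. -/
def proj (n : ℕ) (i : Fin n) : free k S n ⟶ regular k S :=
  mk' (LinearMap.proj i) fun _ _ => rfl

/-- The identity of a free module as the sum of the projections onto its coordinates. -/
lemma sum_proj_fromRegular (n : ℕ) :
    ∑ i, proj n i ≫ fromRegular (free k S n) (Pi.single i 1) = 𝟙 (free k S n) := by
  have h : ∀ (s : Finset (Fin n)) (x : Fin n → S),
      lin (∑ i ∈ s, proj n i ≫ fromRegular (free k S n) (Pi.single i 1)) x =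
      ∑ i ∈ s, Pi.single i (x i) := by
    intro s x
    induction s using Finset.cons_induction with
    | empty => rfl
    | cons i s hi hs =>
      rw [Finset.sum_cons, Finset.sum_cons, lin_add, LinearMap.add_apply, hs]
      refine congrArg (· + _) ?_
      change x i • (Pi.single i 1 : Fin n → S) = _
      rw [← Pi.single_smul', smul_eq_mul, mul_one]
  refine hom_ext (LinearMap.ext fun x => (h _ x).trans ?_)
  exact Finset.univ_sum_single x

/-- Every module is a quotient of a free module. -/
lemma exists_free_cover (N : FDMod k S) :
    ∃ (n : ℕ) (g : free k S n ⟶ N), Function.Surjective (lin g) := by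
  let b := Module.finBasis k N.carrier
  refine ⟨_, mk' (M := free k S (Module.finrank k N.carrier))
    (∑ i, N.ρ.toLinearMap.flip (b i) ∘ₗ LinearMap.proj i) fun s x => ?_, fun n => ?_⟩
  · rw [LinearMap.sum_apply, LinearMap.sum_apply, map_sum]
    refine Finset.sum_congr rfl fun i _ => ?_
    change N.ρ (s * x i) (b i) = N.ρ s (N.ρ (x i) (b i))
    rw [map_mul]
    rfl
  · refine ⟨fun i => algebraMap k S (b.repr n i), ?_⟩
    rw [lin_mk', LinearMap.sum_apply]
    refine Eq.trans (Finset.sum_congr rfl fun i _ => ?_) (b.sum_repr n)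
    change N.ρ (algebraMap k S (b.repr n i)) (b i) = _
    rw [AlgHom.commutes]
    rfl

end FDMod

end HopfBimod

end RegularModule

/-! ### Module functors and their values at the regular module -/

noncomputable section Evaluation

open FDMod MonoidalLeftAction
open Functor.OplaxLeftLinear

namespace HopfBimod

section Ev

variable {k : Type u} [Field k] {S T : Type u} [Ring S] [Algebra k S] [FiniteDimensional k S]
  [Ring T] [Algebra k T] (F : FDMod k S ⥤ FDMod k T) [F.Additive] [F.Linear k]

/-- The map `F(S) → N → F(N)`, `(p, n) ↦ F(s ↦ s n)(p)`. -/
def ev (N : FDMod k S) :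
    (F.obj (regular k S)).carrier →ₗ[k] N.carrier →ₗ[k] (F.obj N).carrier :=
  LinearMap.flip
    { toFun := fun n => lin (F.map (fromRegular N n))
      map_add' := fun n n' => by rw [fromRegular_add, F.map_add, lin_add]
      map_smul' := fun c n => by rw [fromRegular_smul, F.map_smul, lin_smul, RingHom.id_apply] }

lemma ev_apply (N : FDMod k S) (p : (F.obj (regular k S)).carrier) (n : N.carrier) :
    ev F N p n = lin (F.map (fromRegular N n)) p := rfl

lemma map_ev {N N' : FDMod k S} (g : N ⟶ N') (p : (F.obj (regular k S)).carrier)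
    (n : N.carrier) : lin (F.map g) (ev F N p n) = ev F N' p (lin g n) := by
  rw [ev_apply, ev_apply, ← fromRegular_comp, F.map_comp]
  rfl

lemma ev_one (p : (F.obj (regular k S)).carrier) : ev F (regular k S) p (1 : S) = p := by
  rw [ev_apply, fromRegular_one, F.map_id]
  rfl

lemma ev_ev (N : FDMod k S) (p : (F.obj (regular k S)).carrier) (s : S) (n : N.carrier) :
    ev F N (ev F (regular k S) p s) n = ev F N p (N.ρ s n) :=
  map_ev F (fromRegular N n) p s

lemma ev_ρ (N : FDMod k S) (t : T) (p : (F.obj (regular k S)).carrier) (n : N.carrier) :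
    ev F N ((F.obj (regular k S)).ρ t p) n = (F.obj N).ρ t (ev F N p n) :=
  lin_ρ (F.map (fromRegular N n)) t p

/-- The right action of `S` on `F(S)`. -/
abbrev evR : S →ₗ[k] Module.End k (F.obj (regular k S)).carrier := (ev F (regular k S)).flip

/-- The map `F(S) ⊗_S N → F(N)`, `p ⊗ n ↦ F(s ↦ s n)(p)`. -/
def evBal (N : FDMod k S) : Bal (evR F) N.ρ →ₗ[k] (F.obj N).carrier :=
  Bal.lift (TensorProduct.lift (ev F N)) fun s p n => ev_ev F N p s n

lemma evBal_mk (N : FDMod k S) (p : (F.obj (regular k S)).carrier) (n : N.carrier) :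
    evBal F N (Bal.mk _ _ (p ⊗ₜ n)) = ev F N p n := rfl

lemma evBal_map {N N' : FDMod k S} (g : N ⟶ N') (z : Bal (evR F) N.ρ) :
    evBal F N' (Bal.map .id (lin g) (fun _ _ => rfl) (lin_ρ g) z) =
      lin (F.map g) (evBal F N z) :=
  LinearMap.congr_fun (f := evBal F N' ∘ₗ Bal.map .id (lin g) (fun _ _ => rfl) (lin_ρ g))
    (g := lin (F.map g) ∘ₗ evBal F N) (Bal.ext fun p n => (map_ev F g p n).symm) z

/-- On a free module the inverse of `evBal` is given by the coordinates. -/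
lemma evBal_free_bijective (n : ℕ) : Function.Bijective (evBal F (free k S n)) := by
  let T : (F.obj (free k S n)).carrier →ₗ[k] Bal (evR F) (free k S n).ρ :=
    ∑ i, Bal.mk (evR F) (free k S n).ρ ∘ₗ
      (TensorProduct.mk k _ (free k S n).carrier).flip (Pi.single i 1 : Fin n → S) ∘ₗ
        lin (F.map (proj n i))
  have hT : ∀ q, T q = ∑ i, Bal.mk (evR F) (free k S n).ρ
      (lin (F.map (proj n i)) q ⊗ₜ (Pi.single i 1 : Fin n → S)) := fun q => by
    rw [LinearMap.sum_apply]
    rfl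
  refine Function.bijective_iff_has_inverse.2 ⟨T, fun z => ?_, fun q => ?_⟩
  · refine LinearMap.congr_fun (f := T ∘ₗ evBal F (free k S n)) (g := LinearMap.id)
      (Bal.ext fun p x => ?_) z
    rw [LinearMap.comp_apply, evBal_mk, hT]
    have h : ∀ i, Bal.mk (evR F) (free k S n).ρ
        (lin (F.map (proj n i)) (ev F (free k S n) p x) ⊗ₜ (Pi.single i 1 : Fin n → S)) =
        Bal.mk (evR F) (free k S n).ρ (p ⊗ₜ (Pi.single i ((x : Fin n → S) i) : Fin n → S)) := by
      intro i
      rw [map_ev]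
      refine (Bal.mk_rel (evR F) (free k S n).ρ ((x : Fin n → S) i) p _).trans ?_
      refine congrArg (fun t => Bal.mk (evR F) (free k S n).ρ (p ⊗ₜ t)) ?_
      change (x : Fin n → S) i • (Pi.single i 1 : Fin n → S) = _
      rw [← Pi.single_smul', smul_eq_mul, mul_one]
    rw [Finset.sum_congr rfl fun i _ => h i, ← map_sum, ← TensorProduct.tmul_sum]
    exact congrArg (fun t => Bal.mk (evR F) (free k S n).ρ (p ⊗ₜ t))
      (Finset.univ_sum_single (x : Fin n → S))
  · rw [hT, map_sum]
    have h : ∀ i, evBal F (free k S n) (Bal.mk (evR F) (free k S n).ρ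
        (lin (F.map (proj n i)) q ⊗ₜ (Pi.single i 1 : Fin n → S))) =
        lin (F.map (proj n i ≫ fromRegular (free k S n) (Pi.single i 1))) q := by
      intro i
      rw [F.map_comp]
      rfl
    rw [Finset.sum_congr rfl fun i _ => h i, ← LinearMap.sum_apply, ← lin_sum, ← F.map_sum,
      sum_proj_fromRegular, F.map_id]
    rfl

/-- A right exact functor is the tensor product with its value at the regular module: this holds
for free modules, and both functors preserve presentations. -/
lemma evBal_bijective (hF : RightExact F) (N : FDMod k S) : Function.Bijective (evBal F N) := by
  -- Surjectivity comes first, for all modules: injectivity needs it at the kernel of a free cover.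
  have hs : ∀ N : FDMod k S, Function.Surjective (evBal F N) := fun N q => by
    obtain ⟨n, g, hg⟩ := exists_free_cover N
    obtain ⟨q, rfl⟩ := (hF _ _ (exact_kerι g) hg).2 q
    obtain ⟨z, rfl⟩ := (evBal_free_bijective F n).2 q
    exact ⟨_, evBal_map F g z⟩
  refine ⟨(injective_iff_map_eq_zero _).2 fun z hz => ?_, hs N⟩
  obtain ⟨n, g, hg⟩ := exists_free_cover N
  obtain ⟨y, rfl⟩ := Bal.map_surjective (r := evR F) (lin g) (lin_ρ g) hg z
  rw [evBal_map] at hz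
  obtain ⟨w, hw⟩ := ((hF _ _ (exact_kerι g) hg).1 _).1 hz
  obtain ⟨w, rfl⟩ := hs _ w
  rw [← evBal_map] at hw
  rw [← (evBal_free_bijective F n).1 hw]
  exact (Bal.map_exact (lin (kerι g)) (lin g) (lin_ρ (kerι g)) (lin_ρ g)
    (exact_kerι g) hg).apply_apply_eq_zero w

end Ev

section ModuleFunctor

variable {k : Type u} [Field k] {A B : Type u} [Ring A] [Bialgebra k A] [Ring B] [Bialgebra k B]
  [FiniteDimensional k B] {K S : ComodAlg k (Cop A ⊗[k] B)}
  (F : FDMod k S.carrier ⥤ FDMod k K.carrier) [F.Additive] [F.Linear k]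
  [F.OplaxLeftLinear (FDMod k B)]

/-- The coaction on `F(S)` given by the image of `S → B ⊗ S` under a `Rep(B)`-module functor
`F`. -/
def evδ : (F.obj (regular k S.carrier)).carrier →ₗ[k]
    B ⊗[k] (F.obj (regular k S.carrier)).carrier :=
  lin (δₗ F (regular k B) (regular k S.carrier)) ∘ₗ
    (ev F (regular k B ⊙ₗ regular k S.carrier)).flip ((1 : B) ⊗ₜ[k] (1 : S.carrier))

/-- The module structure of `F` is determined by the coaction on `F(S)`, by naturality for the
maps `B → X`, `b ↦ b x`, and `S → N`, `s ↦ s n`. -/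
lemma lin_δ_ev (X : FDMod k B) (N : FDMod k S.carrier)
    (p : (F.obj (regular k S.carrier)).carrier) (x : X.carrier) (n : N.carrier) :
    lin (δₗ F X N) (ev F (X ⊙ₗ N) p (x ⊗ₜ[k] n)) =
      TensorProduct.map (X.ρ.toLinearMap.flip x) ((ev F N).flip n) (evδ F p) := by
  let φ : regular k B ⊙ₗ regular k S.carrier ⟶ X ⊙ₗ N := fromRegular X x ⊵ₗ _ ≫ X ⊴ₗ fromRegular N n
  have h1 : lin φ ((1 : B) ⊗ₜ[k] (1 : S.carrier)) = x ⊗ₜ[k] n := by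
    change X.ρ 1 x ⊗ₜ[k] N.ρ 1 n = _
    rw [map_one, map_one]
    rfl
  have h2 : F.map φ ≫ δₗ F X N =
      δₗ F _ _ ≫ fromRegular X x ⊵ₗ _ ≫ X ⊴ₗ F.map (fromRegular N n) := by
    rw [F.map_comp, Category.assoc, δₗ_naturality_right, δₗ_naturality_left_assoc]
  have h3 := congrArg (fun t => lin t (ev F (regular k B ⊙ₗ regular k S.carrier) p
    ((1 : B) ⊗ₜ[k] (1 : S.carrier)))) h2
  refine Eq.trans ?_ (h3.trans ?_)
  · rw [← h1, ← map_ev]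
    rfl
  · refine LinearMap.congr_fun (f := lin (fromRegular X x ⊵ₗ _ ≫ X ⊴ₗ F.map (fromRegular N n)))
      (g := TensorProduct.map (X.ρ.toLinearMap.flip x) ((ev F N).flip n)) ?_ (evδ F p)
    exact TensorProduct.ext' fun b q => rfl

lemma tact_lmul_one {A' B' : Type u} [Ring A'] [Algebra k A'] [Ring B'] [Algebra k B']
    (u : A' ⊗[k] B') :
    tact (Algebra.lmul k A').toLinearMap (Algebra.lmul k B').toLinearMap u (1 ⊗ₜ 1) = u := by
  induction u with
  | zero => simp only [map_zero, LinearMap.zero_apply]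
  | add x y hx hy => rw [map_add, LinearMap.add_apply, hx, hy]
  | tmul a b =>
    change (a * 1) ⊗ₜ[k] (b * 1) = _
    rw [mul_one, mul_one]

/-- Coassociativity is the associativity of the module structure of `F`, evaluated at `S` and at
`(1 ⊗ 1) ⊗ 1`. -/
lemma evδ_coassoc (p : (F.obj (regular k S.carrier)).carrier) :
    TensorProduct.assoc k B B _ (TensorProduct.map (Coalgebra.comul (R := k)) .id (evδ F p)) =
      TensorProduct.map .id (evδ F) (evδ F p) := by
  let o : ((regular k B ⊗ regular k B) ⊙ₗ regular k S.carrier).carrier :=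
    ((1 : B) ⊗ₜ[k] (1 : B)) ⊗ₜ[k] (1 : S.carrier)
  have h := congrArg (fun t => lin t (ev F _ p o))
    (δₗ_associativity F (regular k B) (regular k B) (regular k S.carrier))
  have h1 : (regular k B ⊗ regular k B).ρ.toLinearMap.flip ((1 : B) ⊗ₜ[k] (1 : B)) =
      Coalgebra.comul (R := k) := LinearMap.ext fun b => tact_lmul_one _
  have h2 : (ev F (regular k S.carrier)).flip (1 : S.carrier) = .id :=
    LinearMap.ext fun q => ev_one F q
  have h3 : (regular k B).ρ.toLinearMap.flip (1 : B) = .id := LinearMap.ext fun b => mul_one b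
  refine Eq.trans ?_ (h.trans ?_)
  · have e := lin_δ_ev F (regular k B ⊗ regular k B) (regular k S.carrier) p
      ((1 : B) ⊗ₜ[k] (1 : B)) (1 : S.carrier)
    rw [h1, h2] at e
    exact congrArg (TensorProduct.assoc k B B _) e.symm
  · have e := lin_δ_ev F (regular k B) (regular k B ⊙ₗ regular k S.carrier) p (1 : B)
      ((1 : B) ⊗ₜ[k] (1 : S.carrier))
    rw [h3] at e
    have e' := map_ev F (αₗ (regular k B) (regular k B) (regular k S.carrier)).hom p o
    refine (congrArg (fun t => lin (regular k B ⊴ₗ δₗ F (regular k B) (regular k S.carrier))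
      (lin (δₗ F (regular k B) (regular k B ⊙ₗ regular k S.carrier)) t)) e').trans ?_
    refine (congrArg (lin (regular k B ⊴ₗ δₗ F (regular k B) (regular k S.carrier))) e).trans ?_
    exact (LinearMap.congr_fun (TensorProduct.map_comp _ _ _ _) _).symm

lemma evδ_counit (p : (F.obj (regular k S.carrier)).carrier) :
    TensorProduct.lid k _ (TensorProduct.map (Coalgebra.counit (R := k)) .id (evδ F p)) = p := by
  have h := congrArg (fun t => lin t p)
    (δₗ_unitality_inv (C := FDMod k B) F (regular k S.carrier))
  have h2 : (ev F (regular k S.carrier)).flip (1 : S.carrier) = .id :=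
    LinearMap.ext fun q => ev_one F q
  have h1 : (𝟙_ (FDMod k B)).ρ.toLinearMap.flip (1 : k) = Coalgebra.counit (R := k) :=
    LinearMap.ext fun b => mul_one _
  have e := lin_δ_ev F (𝟙_ (FDMod k B)) (regular k S.carrier) p (1 : k) (1 : S.carrier)
  rw [h1, h2] at e
  have e' := map_ev F (λₗ[FDMod k B] (regular k S.carrier)).inv p (1 : S.carrier)
  rw [ev_one] at e'
  have e2 := (h.trans ((congrArg (lin (δₗ F (𝟙_ (FDMod k B)) (regular k S.carrier))) e').trans e))
  refine ((TensorProduct.lid k _).symm_apply_eq.1 ?_).symm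
  exact e2

/-- The object `F(S)` of `{}^B_K M_S` for a `Rep(B)`-module functor `F`. -/
abbrev evBimod : RelBimod K S where
  toFDMod := F.obj (regular k S.carrier)
  ρR := evR F
  ρR_one p := ev_one F p
  ρR_mul s t p := (ev_ev F (regular k S.carrier) p s t).symm
  ρ_ρR r s p := (ev_ρ F (regular k S.carrier) r p s).symm
  δ := evδ F
  δ_coassoc := evδ_coassoc F
  δ_counit := evδ_counit F
  δ_left r p := (congrArg (lin (δₗ F (regular k B) (regular k S.carrier)))
    (ev_ρ F _ r p _)).trans (lin_ρ (δₗ F (regular k B) (regular k S.carrier)) r _)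
  δ_right s p := by
    -- Both sides are linear in `coB s = s · (1 ⊗ 1)`, so `lin_δ_ev` applies to its summands.
    have h : ∀ u : B ⊗[k] S.carrier, lin (δₗ F (regular k B) (regular k S.carrier))
        (ev F (regular k B ⊙ₗ regular k S.carrier) p u) =
        tact (LinearMap.mul k B).flip (evR F) u (evδ F p) := by
      intro u
      induction u with
      | zero => simp only [map_zero, LinearMap.zero_apply]
      | add x y hx hy =>
        rw [map_add (tact _ _), LinearMap.add_apply, ← hx, ← hy]
        exact (congrArg (lin (δₗ F (regular k B) (regular k S.carrier)))
          (map_add (ev F (regular k B ⊙ₗ regular k S.carrier) p) x y)).trans (map_add _ _ _)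
      | tmul b s => exact lin_δ_ev F (regular k B) (regular k S.carrier) p b s
    refine (congrArg (lin (δₗ F (regular k B) (regular k S.carrier))) (ev_ev F _ p s _)).trans ?_
    refine Eq.trans ?_ (h (S.coB s))
    exact congrArg (fun t => lin (δₗ F (regular k B) (regular k S.carrier))
      (ev F (regular k B ⊙ₗ regular k S.carrier) p t)) (tact_lmul_one (S.coB s))

lemma evBal_ρ (N : FDMod k S.carrier) (r : K.carrier) (z : Bal (evR F) N.ρ) :
    evBal F N (((tensorFunctor (evBimod F)).obj N).ρ r z) = (F.obj N).ρ r (evBal F N z) :=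
  LinearMap.congr_fun (f := evBal F N ∘ₗ ((tensorFunctor (evBimod F)).obj N).ρ r)
    (g := (F.obj N).ρ r ∘ₗ evBal F N) (Bal.ext fun p n => ev_ρ F N r p n) z

/-- The maps `evBal` are compatible with the module structures of `N ↦ F(S) ⊗_S N` and `F`. -/
lemma evBal_str (X : FDMod k B) (N : FDMod k S.carrier) (z : Bal (evR F) (X ⊙ₗ N).ρ) :
    lin (δₗ F X N) (evBal F (X ⊙ₗ N) z) = TensorProduct.map .id (evBal F N)
      (Bal.str (l := N.ρ) S.coB (evδ F) (evBimod F).δ_right X.ρ z) := by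
  refine LinearMap.congr_fun (f := lin (δₗ F X N) ∘ₗ evBal F (X ⊙ₗ N))
    (g := TensorProduct.map .id (evBal F N) ∘ₗ
      Bal.str (l := N.ρ) S.coB (evδ F) (evBimod F).δ_right X.ρ) (Bal.ext₂ fun p x n => ?_) z
  refine (lin_δ_ev F X N p x n).trans ?_
  change _ = TensorProduct.map .id (evBal F N) (Bal.nn (evR F) N.ρ X.ρ (evδ F p ⊗ₜ (x ⊗ₜ[k] n)))
  induction evδ F p with
  | zero => simp only [map_zero, TensorProduct.zero_tmul]
  | add u v hu hv => simp only [map_add, TensorProduct.add_tmul, hu, hv]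
  | tmul b q => rfl

end ModuleFunctor

/-- Every right exact `Rep(B)`-module functor `F` is isomorphic to `N ↦ F(S) ⊗_S N`. -/
lemma essSurj_Phi {k : Type u} [Field k] {A B : Type u} [Ring A] [Bialgebra k A] [Ring B]
    [Bialgebra k B] [FiniteDimensional k B] {K S : ComodAlg k (Cop A ⊗[k] B)}
    (h : ∀ P : RelBimod K S, IsModuleFunctor S K (tensorFunctor P) ∧
      RightExact (tensorFunctor P)) : (Phi h).EssSurj where
  mem_essImage G := by
    have := G.isModuleFunctor.additive
    have := G.isModuleFunctor.linear
    refine ⟨evBimod G.F, ⟨ModFun.isoMk (NatIso.ofComponents (fun N => FDMod.isoMk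
      (M := (tensorFunctor (evBimod G.F)).obj N)
      (LinearEquiv.ofBijective (evBal G.F N) (evBal_bijective G.F G.rightExact N))
      (evBal_ρ G.F N)) fun g => hom_ext (LinearMap.ext (evBal_map G.F g)))
      fun X N => hom_ext (LinearMap.ext (evBal_str G.F X N))⟩⟩

end HopfBimod

end Evaluation

/-! ### Morphisms between tensor product functors -/

noncomputable section FullyFaithful

open FDMod MonoidalLeftAction
open Functor.OplaxLeftLinear

namespace HopfBimod

section

variable {k : Type u} [Field k] {S V : Type u} [Ring S] [Algebra k S] [AddCommGroup V]
  [Module k V] (r : S →ₗ[k] Module.End k V) (r_mul : ∀ s t p, r (s * t) p = r t (r s p))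

/-- The isomorphism `V ⊗_S S → V`, `p ⊗ s ↦ p s`, as a linear map. -/
def Bal.regMap : Bal r (Algebra.lmul k S) →ₗ[k] V :=
  Bal.lift (TensorProduct.lift r.flip) fun s v w => (r_mul s w v).symm

lemma Bal.regMap_mk (v : V) (s : S) :
    Bal.regMap r r_mul (Bal.mk r (Algebra.lmul k S) (v ⊗ₜ s)) = r s v := rfl

variable {r} in
lemma Bal.mk_regMap (r_one : ∀ p, r 1 p = p) (z : Bal r (Algebra.lmul k S)) :
    Bal.mk r (Algebra.lmul k S) (Bal.regMap r r_mul z ⊗ₜ 1) = z :=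
  LinearMap.congr_fun (f := Bal.mk r (Algebra.lmul k S) ∘ₗ
    (TensorProduct.mk k V S).flip 1 ∘ₗ Bal.regMap r r_mul) (g := LinearMap.id)
    (Bal.ext fun v s => (Bal.mk_rel r (Algebra.lmul k S) s v 1).trans
      (congrArg (fun t => Bal.mk r (Algebra.lmul k S) (v ⊗ₜ t)) (mul_one s))) z

end

variable {k : Type u} [Field k] {A B : Type u} [Ring A] [Bialgebra k A] [Ring B] [Bialgebra k B]
  {K S : ComodAlg k (Cop A ⊗[k] B)} (h : ∀ P : RelBimod K S,
    IsModuleFunctor S K (tensorFunctor P) ∧ RightExact (tensorFunctor P))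

/-- A colinear bimodule map `f` is recovered from `Φ(f)` at the regular module, as `P ⊗_S S ≅ P`. -/
lemma faithful_Phi : (Phi h).Faithful where
  map_injective {P Q} f g e := RelBimod.hom_ext (LinearMap.ext fun p => by
    have e' := congrArg (fun α => Bal.regMap Q.ρR Q.ρR_mul (lin ((ModFun.nat α).app
      (regular k S.carrier)) (Bal.mk P.ρR (Algebra.lmul k S.carrier) (p ⊗ₜ[k] (1 : S.carrier)))))
        e
    exact (Q.ρR_one _).symm.trans (e'.trans (Q.ρR_one _)))

variable {h} in
/-- The linear map underlying the preimage of a morphism `α : Φ(P) ⟶ Φ(Q)` of module functors: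
the component of `α` at the regular module. -/
def preimageLin {P Q : RelBimod K S} (α : (Phi h).obj P ⟶ (Phi h).obj Q) :
    P.carrier →ₗ[k] Q.carrier :=
  Bal.regMap Q.ρR Q.ρR_mul ∘ₗ lin ((ModFun.nat α).app (regular k S.carrier)) ∘ₗ
    Bal.mk P.ρR (Algebra.lmul k S.carrier) ∘ₗ
      (TensorProduct.mk k P.carrier S.carrier).flip (1 : S.carrier)

variable {h} in
/-- By naturality for the maps `S → N`, `s ↦ s n`, a morphism `α : Φ(P) ⟶ Φ(Q)` is determined by its
component at the regular module. -/
lemma nat_app_mk {P Q : RelBimod K S} (α : (Phi h).obj P ⟶ (Phi h).obj Q)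
    (N : FDMod k S.carrier) (p : P.carrier) (n : N.carrier) :
    lin ((ModFun.nat α).app N) (Bal.mk P.ρR N.ρ (p ⊗ₜ n)) =
      Bal.mk Q.ρR N.ρ (preimageLin α p ⊗ₜ n) := by
  have e0 : ∀ R : RelBimod K S, ∀ q : R.carrier,
      lin ((tensorFunctor R).map (fromRegular N n)) (Bal.mk R.ρR (Algebra.lmul k S.carrier)
        (q ⊗ₜ[k] (1 : S.carrier))) = Bal.mk R.ρR N.ρ (q ⊗ₜ n) := fun R q => by
    change Bal.mk R.ρR N.ρ (q ⊗ₜ N.ρ 1 n) = _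
    rw [map_one]
    rfl
  have e1 := congrArg (fun t => lin t (Bal.mk P.ρR (Algebra.lmul k S.carrier)
    (p ⊗ₜ[k] (1 : S.carrier)))) ((ModFun.nat α).naturality (fromRegular N n))
  refine (congrArg (lin ((ModFun.nat α).app N)) (e0 P p)).symm.trans (e1.trans ?_)
  refine (congrArg (lin ((tensorFunctor Q).map (fromRegular N n)))
    (Bal.mk_regMap Q.ρR_mul Q.ρR_one _).symm).trans ?_
  exact e0 Q _

lemma full_Phi [FiniteDimensional k B] : (Phi h).Full where
  map_surjective {P Q} α := by
    refine ⟨RelBimod.mk' (preimageLin α) (fun r p => ?_) (fun s p => ?_) fun p => ?_,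
      ModFun.hom_ext fun N => hom_ext (Bal.ext fun p n => (nat_app_mk α N p n).symm)⟩
    · have e := lin_ρ ((ModFun.nat α).app (regular k S.carrier)) r
        (Bal.mk P.ρR (Algebra.lmul k S.carrier) (p ⊗ₜ[k] (1 : S.carrier)))
      have e' : ∀ z, Bal.regMap Q.ρR Q.ρR_mul
          (((tensorFunctor Q).obj (regular k S.carrier)).ρ r z) =
          Q.ρ r (Bal.regMap Q.ρR Q.ρR_mul z) := fun z =>
        LinearMap.congr_fun (f := Bal.regMap Q.ρR Q.ρR_mul ∘ₗ
          ((tensorFunctor Q).obj (regular k S.carrier)).ρ r)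
          (g := Q.ρ r ∘ₗ Bal.regMap Q.ρR Q.ρR_mul)
          (Bal.ext fun q s => (Q.ρ_ρR r s q).symm) z
      exact (congrArg (Bal.regMap Q.ρR Q.ρR_mul) e).trans (e' _)
    · have e := (congrArg (lin ((ModFun.nat α).app (regular k S.carrier)))
        (Bal.mk_rel P.ρR (Algebra.lmul k S.carrier) s p 1)).trans
          (nat_app_mk α (regular k S.carrier) p (s * 1))
      refine (congrArg (Bal.regMap Q.ρR Q.ρR_mul) e).trans ?_
      refine (Bal.regMap_mk Q.ρR Q.ρR_mul _ (s * 1)).trans ?_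
      rw [mul_one]
    -- Colinearity: `α` respects the module structures at `B` and `S`, evaluated at `p ⊗ (1 ⊗ 1)`.
    · let o : (regular k B ⊙ₗ regular k S.carrier).carrier := (1 : B) ⊗ₜ[k] (1 : S.carrier)
      have e0 : ∀ (R : RelBimod K S) (u : B ⊗[k] R.carrier),
          Bal.nn R.ρR (Algebra.lmul k S.carrier) (Algebra.lmul k B)
            (u ⊗ₜ[k] ((1 : B) ⊗ₜ[k] (1 : S.carrier))) =
          TensorProduct.map .id (Bal.mk R.ρR (Algebra.lmul k S.carrier) ∘ₗ
            (TensorProduct.mk k R.carrier S.carrier).flip (1 : S.carrier)) u := by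
        intro R u
        induction u with
        | zero => simp only [map_zero, TensorProduct.zero_tmul]
        | add u v hu hv => simp only [map_add, TensorProduct.add_tmul, hu, hv]
        | tmul b q =>
          change (b * 1) ⊗ₜ[k] _ = b ⊗ₜ[k] _
          rw [mul_one]
          rfl
      have e := congrArg (fun t => TensorProduct.map .id (Bal.regMap Q.ρR Q.ρR_mul)
        (lin t (Bal.mk P.ρR (regular k B ⊙ₗ regular k S.carrier).ρ (p ⊗ₜ o))))
          (ModFun.nat_δ α (regular k B) (regular k S.carrier))
      refine Eq.trans ?_ (e.trans ?_)
      · refine Eq.symm ((congrArg (fun t => TensorProduct.map .id (Bal.regMap Q.ρR Q.ρR_mul)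
          (Bal.str (l := Algebra.lmul k S.carrier) S.coB Q.δ Q.δ_right (Algebra.lmul k B) t))
            (nat_app_mk α _ p o)).trans ?_)
        refine (congrArg (TensorProduct.map .id (Bal.regMap Q.ρR Q.ρR_mul))
          (e0 Q (Q.δ (preimageLin α p)))).trans ?_
        rw [← LinearMap.comp_apply, ← TensorProduct.map_comp]
        refine LinearMap.congr_fun (g := LinearMap.id) ?_ _
        exact TensorProduct.ext' fun b q => congrArg (fun t => b ⊗ₜ[k] t) (Q.ρR_one q)
      · refine (congrArg (fun t => TensorProduct.map .id (Bal.regMap Q.ρR Q.ρR_mul)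
          (TensorProduct.map .id (lin ((ModFun.nat α).app (regular k S.carrier))) t))
            (e0 P (P.δ p))).trans ?_
        exact LinearMap.congr_fun (f := TensorProduct.map .id (Bal.regMap Q.ρR Q.ρR_mul) ∘ₗ
          TensorProduct.map .id (lin ((ModFun.nat α).app (regular k S.carrier))) ∘ₗ
            TensorProduct.map .id (Bal.mk P.ρR (Algebra.lmul k S.carrier) ∘ₗ
              (TensorProduct.mk k P.carrier S.carrier).flip (1 : S.carrier)))
          (g := TensorProduct.map .id (preimageLin α)) (TensorProduct.ext' fun b q => rfl) (P.δ p)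

end HopfBimod

end FullyFaithful

/-! ### Compatibility of tensor product functors with the actions of `Rep(A)` -/

noncomputable section BimoduleStructure

open FDMod MonoidalLeftAction MonoidalRightAction
open Functor.OplaxLeftLinear Functor.LaxLeftLinear Functor.LaxRightLinear

namespace HopfBimod

variable {k : Type u} [Field k] {A B : Type u} [Ring A] [Bialgebra k A] [Ring B] [Bialgebra k B]
  {K S : ComodAlg k (Cop A ⊗[k] B)} (h : ∀ P : RelBimod K S,
    IsModuleFunctor S K (tensorFunctor P) ∧ RightExact (tensorFunctor P))

/-- The isomorphism `p ⊗ (x ⊗ m) ↦ (p ⊗ (x ⊗ 1)) ⊗ m` is compatible with the `Rep(B)`-module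
structures of `X ⊙ₗ Φ(P)` and `Φ(X ⊙ₗ P)`. -/
lemma str_assocEquiv (P : RelBimod K S) (X : FDMod k A) (Z : FDMod k B)
    (M : FDMod k S.carrier) (z : Bal P.ρR ((Z ⊙ₗ M) ⊙ᵣ X).ρ) :
    Bal.str (l := M.ρ) S.coB (X ⊙ₗ P).δ (X ⊙ₗ P).δ_right Z.ρ
        (Bal.assocEquiv P.ρR S.coA X.ρ (Z ⊙ₗ M).ρ z) =
      TensorProduct.map .id (Bal.assocEquiv P.ρR S.coA X.ρ M.ρ).toLinearMap
        (Bal.str (l := (M ⊙ᵣ X).ρ) S.coB P.δ P.δ_right Z.ρ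
          (lin ((tensorFunctor P).map (BimoduleCategory.γ Z M X).hom) z)) := by
  have e : ∀ (u : B ⊗[k] P.carrier) (x : X.carrier) (c : Z.carrier) (m : M.carrier),
      Bal.nn (X ⊙ₗ P).ρR M.ρ Z.ρ (Bal.mm P.ρR (trep S.coA X.ρ (Algebra.lmul k S.carrier))
        (u ⊗ₜ TensorProduct.leftComm k X.carrier B S.carrier (x ⊗ₜ (1 ⊗ₜ 1))) ⊗ₜ (c ⊗ₜ[k] m)) =
      TensorProduct.map .id (Bal.assocEquiv P.ρR S.coA X.ρ M.ρ).toLinearMap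
        (Bal.nn P.ρR (M ⊙ᵣ X).ρ Z.ρ (u ⊗ₜ (c ⊗ₜ[k] (x ⊗ₜ[k] m)))) := by
    intro u x c m
    induction u with
    | zero => simp only [map_zero, TensorProduct.zero_tmul]
    | add u v hu hv => simp only [map_add, TensorProduct.add_tmul, hu, hv]
    | tmul b p =>
      rw [TensorProduct.leftComm_tmul, Bal.mm_tmul, mul_one]
      rfl
  refine LinearMap.congr_fun
    (f := Bal.str (l := M.ρ) S.coB (X ⊙ₗ P).δ (X ⊙ₗ P).δ_right Z.ρ ∘ₗ
      (Bal.assocEquiv P.ρR S.coA X.ρ (Z ⊙ₗ M).ρ).toLinearMap)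
    (g := TensorProduct.map .id (Bal.assocEquiv P.ρR S.coA X.ρ M.ρ).toLinearMap ∘ₗ
        Bal.str (l := (M ⊙ᵣ X).ρ) S.coB P.δ P.δ_right Z.ρ ∘ₗ
          lin ((tensorFunctor P).map (BimoduleCategory.γ Z M X).hom))
    (Bal.ext' fun p => TensorProduct.ext_threefold' fun x c m => ?_) z
  have h1 : S.coB 1 = 1 ⊗ₜ 1 := map_one S.coB
  refine Eq.trans ?_ (e (P.δ p) x c m)
  rw [← h1]
  rfl

/-- The isomorphism `X ⊙ₗ Φ(P) ≅ Φ(X ⊙ₗ P)`, with components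
`P ⊗_S (X ⊗ M) ≅ (P ⊗_S (X ⊗ S)) ⊗_S M`, `p ⊗ (x ⊗ m) ↦ (p ⊗ (x ⊗ 1)) ⊗ m`. -/
def phiLeft (X : FDMod k A) (P : RelBimod K S) : X ⊙ₗ (Phi h).obj P ≅ (Phi h).obj (X ⊙ₗ P) :=
  ModFun.isoMk (F := ModFun.actL X ((Phi h).obj P))
    (NatIso.ofComponents (fun M => FDMod.isoMk (M := (tensorFunctor P).obj (M ⊙ᵣ X))
      (N := (tensorFunctor (X ⊙ₗ P)).obj M) (Bal.assocEquiv P.ρR S.coA X.ρ M.ρ)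
      (Bal.assocEquiv_repL S.coA X.ρ M.ρ P.ρ (fun r s p => P.ρ_ρR r s p)
        fun r s p => (X ⊙ₗ P).ρ_ρR r s p))
      fun g => hom_ext (Bal.ext₂ fun _ _ _ => rfl))
    fun Z M => hom_ext (LinearMap.ext fun z => str_assocEquiv P X Z M z)

/-- The isomorphism `y ⊗ (p ⊗ m) ↦ (y ⊗ p) ⊗ m` is compatible with the `Rep(B)`-module structures of
`Φ(P) ⊙ᵣ Y` and `Φ(P ⊙ᵣ Y)`. -/
lemma str_gammaEquiv (P : RelBimod K S) (Y : FDMod k A) (Z : FDMod k B)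
    (M : FDMod k S.carrier) (z : Y.carrier ⊗[k] Bal P.ρR (Z ⊙ₗ M).ρ) :
    Bal.str (l := M.ρ) S.coB (P ⊙ᵣ Y).δ (P ⊙ᵣ Y).δ_right Z.ρ
        (Bal.gammaEquiv Y.carrier P.ρR (Z ⊙ₗ M).ρ z) =
      TensorProduct.map .id (Bal.gammaEquiv Y.carrier P.ρR M.ρ).toLinearMap
        (TensorProduct.leftComm k Y.carrier Z.carrier (Bal P.ρR M.ρ)
          (TensorProduct.map .id (Bal.str (l := M.ρ) S.coB P.δ P.δ_right Z.ρ) z)) := by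
  have e : ∀ (u : B ⊗[k] P.carrier) (y : Y.carrier) (c : Z.carrier) (m : M.carrier),
      Bal.nn (P ⊙ᵣ Y).ρR M.ρ Z.ρ
        (TensorProduct.leftComm k Y.carrier B P.carrier (y ⊗ₜ u) ⊗ₜ (c ⊗ₜ[k] m)) =
      TensorProduct.map .id (Bal.gammaEquiv Y.carrier P.ρR M.ρ).toLinearMap
        (TensorProduct.leftComm k Y.carrier Z.carrier (Bal P.ρR M.ρ)
          (y ⊗ₜ Bal.nn P.ρR M.ρ Z.ρ (u ⊗ₜ (c ⊗ₜ[k] m)))) := by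
    intro u y c m
    induction u with
    | zero => simp only [map_zero, TensorProduct.zero_tmul, TensorProduct.tmul_zero]
    | add u v hu hv => simp only [map_add, TensorProduct.add_tmul, TensorProduct.tmul_add, hu, hv]
    | tmul b p => rfl
  exact LinearMap.congr_fun
    (f := Bal.str (l := M.ρ) S.coB (P ⊙ᵣ Y).δ (P ⊙ᵣ Y).δ_right Z.ρ ∘ₗ
      (Bal.gammaEquiv Y.carrier P.ρR (Z ⊙ₗ M).ρ).toLinearMap)
    (g := TensorProduct.map .id (Bal.gammaEquiv Y.carrier P.ρR M.ρ).toLinearMap ∘ₗ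
        (TensorProduct.leftComm k Y.carrier Z.carrier (Bal P.ρR M.ρ)).toLinearMap ∘ₗ
          TensorProduct.map .id (Bal.str (l := M.ρ) S.coB P.δ P.δ_right Z.ρ))
    (Bal.ext_tensor' fun y p => TensorProduct.ext' fun c m => e (P.δ p) y c m) z

/-- The isomorphism `Φ(P) ⊙ᵣ Y ≅ Φ(P ⊙ᵣ Y)`, with components `Y ⊗ (P ⊗_S M) ≅ (Y ⊗ P) ⊗_S M`. -/
def phiRight (P : RelBimod K S) (Y : FDMod k A) : (Phi h).obj P ⊙ᵣ Y ≅ (Phi h).obj (P ⊙ᵣ Y) :=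
  ModFun.isoMk (F := ModFun.actR ((Phi h).obj P) Y)
    (NatIso.ofComponents (fun M => FDMod.isoMk (M := (tensorFunctor P).obj M ⊙ᵣ Y)
      (N := (tensorFunctor (P ⊙ᵣ Y)).obj M) (Bal.gammaEquiv Y.carrier P.ρR M.ρ)
      (Bal.gammaEquiv_repL Y.carrier P.ρR M.ρ Y.ρ P.ρ (fun r s p => P.ρ_ρR r s p)
        fun r s p => (P ⊙ᵣ Y).ρ_ρR r s p))
      fun g => hom_ext (Bal.ext_tensor fun _ _ _ => rfl))
    fun Z M => hom_ext (LinearMap.ext fun z => str_gammaEquiv P Y Z M z)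

/-- The left `Rep(A)`-module structure of `Φ`. -/
instance phiLaxLeft : (Phi h).LaxLeftLinear (FDMod k A) where
  μₗ X P := (phiLeft h X P).hom
  μₗ_naturality_left f P := ModFun.hom_ext fun M => hom_ext (Bal.ext₂ fun _ _ _ => rfl)
  μₗ_naturality_right X _ _ f := ModFun.hom_ext fun M => hom_ext (Bal.ext₂ fun _ _ _ => rfl)
  μₗ_associativity X X' P := ModFun.hom_ext fun M => hom_ext (Bal.ext' fun p =>
    TensorProduct.ext_threefold fun x x' m => rfl)
  μₗ_unitality P := ModFun.hom_ext fun M => hom_ext (Bal.ext₂ fun p c m => by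
    change Bal.mk P.ρR M.ρ (p ⊗ₜ[k] (c • m)) = Bal.mk P.ρR M.ρ (P.ρR (c • 1) p ⊗ₜ[k] m)
    rw [Bal.mk_rel, map_smul, map_one]
    rfl)

/-- The right `Rep(A)`-module structure of `Φ`. -/
instance phiLaxRight : (Phi h).LaxRightLinear (FDMod k A) where
  μᵣ P Y := (phiRight h P Y).hom
  μᵣ_naturality_right P _ _ f := ModFun.hom_ext fun M => hom_ext (Bal.ext_tensor fun _ _ _ => rfl)
  μᵣ_naturality_left f Y := ModFun.hom_ext fun M => hom_ext (Bal.ext_tensor fun _ _ _ => rfl)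
  μᵣ_associativity P Y Y' := ModFun.hom_ext fun M => hom_ext (Bal.ext_tensor₂ fun y y' p =>
    LinearMap.ext fun m => rfl)
  μᵣ_unitality P := ModFun.hom_ext fun M => hom_ext (Bal.ext_tensor fun c p m => rfl)

end HopfBimod

end BimoduleStructure

/-! ### The equivalence of bimodule categories -/

noncomputable section BimoduleEquiv

open FDMod

namespace HopfBimod

variable {k : Type u} [Field k] {A B : Type u} [Ring A] [Bialgebra k A] [Ring B] [Bialgebra k B]
  {K S : ComodAlg k (Cop A ⊗[k] B)} (h : ∀ P : RelBimod K S,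
    IsModuleFunctor S K (tensorFunctor P) ∧ RightExact (tensorFunctor P))

/-- The functor `Φ` as a `Rep(A)`-bimodule functor. -/
def phiBimoduleFunctor :
    BimoduleFunctor k (FDMod k A) (FDMod k A) (RelBimod K S) (ModFun S K) :=
  BimoduleFunctor.ofLax k (Phi h)
    ⟨fun {P Q f g} => ModFun.hom_ext fun N => hom_ext (Bal.ext fun p n =>
      (congrArg (Bal.mk Q.ρR N.ρ) (TensorProduct.add_tmul (RelBimod.lin f p)
        (RelBimod.lin g p) n)).trans (map_add _ _ _))⟩
    ⟨fun {P Q} f c => ModFun.hom_ext fun N => hom_ext (Bal.ext fun p n =>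
      (congrArg (Bal.mk Q.ρR N.ρ) (TensorProduct.smul_tmul' c (RelBimod.lin f p) n).symm).trans
        (map_smul _ _ _))⟩
    (fun X P => (phiLeft h X P).isIso_hom) (fun P Y => (phiRight h P Y).isIso_hom)
    fun X P Y => ModFun.hom_ext fun M => hom_ext (Bal.ext_tensor' fun y p =>
      TensorProduct.ext' fun x m => rfl)

end HopfBimod

end BimoduleEquiv

/-! ### Exact module categories -/

section Exactness

open FDMod MonoidalLeftAction
open Functor.OplaxLeftLinear

namespace HopfBimod

namespace FDMod

variable {k : Type u} [Field k] {S T : Type u} [Ring S] [Algebra k S] [Ring T] [Algebra k T]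

/-- The image of a morphism. -/
abbrev range {N N' : FDMod k S} (g : N ⟶ N') : FDMod k S where
  carrier := LinearMap.range (lin g)
  ρ :=
    { toFun := fun s => (N'.ρ s).restrict fun n hn => by
        obtain ⟨m, rfl⟩ := hn
        exact ⟨N.ρ s m, lin_ρ g s m⟩
      map_one' := LinearMap.ext fun n => Subtype.ext (by simp)
      map_mul' := fun s t => LinearMap.ext fun n => Subtype.ext (by simp)
      map_zero' := LinearMap.ext fun n => Subtype.ext (by simp)
      map_add' := fun s t => LinearMap.ext fun n => Subtype.ext (by simp)
      commutes' := fun c => LinearMap.ext fun n => Subtype.ext (by simp) }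

/-- The quotient by the image of a morphism. -/
abbrev coker {N N' : FDMod k S} (g : N ⟶ N') : FDMod k S where
  carrier := N'.carrier ⧸ LinearMap.range (lin g)
  ρ :=
    { toFun := fun s => (LinearMap.range (lin g)).mapQ _ (N'.ρ s) fun n hn => by
        obtain ⟨m, rfl⟩ := hn
        exact ⟨N.ρ s m, lin_ρ g s m⟩
      map_one' := Submodule.linearMap_qext _ (LinearMap.ext fun n => by simp)
      map_mul' := fun s t => Submodule.linearMap_qext _ (LinearMap.ext fun n => by simp)
      map_zero' := Submodule.linearMap_qext _ (LinearMap.ext fun n => by simp)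
      map_add' := fun s t => Submodule.linearMap_qext _ (LinearMap.ext fun n => by simp)
      commutes' := fun c => Submodule.linearMap_qext _ (LinearMap.ext fun n => by simp) }

/-- An epimorphism is surjective, as it kills the projection onto its cokernel. -/
lemma surjective_of_epi {N N' : FDMod k S} (g : N ⟶ N') [Epi g] :
    Function.Surjective (lin g) := by
  let q : N' ⟶ coker g := mk' (LinearMap.range (lin g)).mkQ fun _ _ => rfl
  have h : g ≫ q = g ≫ 0 := hom_ext (LinearMap.ext fun n =>
    (Submodule.Quotient.mk_eq_zero _).2 ⟨n, rfl⟩)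
  have h' := congrArg lin ((cancel_epi g).1 h)
  exact LinearMap.range_eq_top.1 ((Submodule.ker_mkQ _).symm.trans (LinearMap.ker_eq_top.2 h'))

lemma epi_of_surjective {N N' : FDMod k S} (g : N ⟶ N') (hg : Function.Surjective (lin g)) :
    Epi g where
  left_cancellation a b e := hom_ext (LinearMap.ext fun n => by
    obtain ⟨m, rfl⟩ := hg n
    exact congrArg (fun t => lin t m) e)

lemma projective_regular [FiniteDimensional k S] : Projective (regular k S) where
  factors {E X} f e _ := by
    obtain ⟨m, hm⟩ := surjective_of_epi e (lin f (1 : S))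
    refine ⟨fromRegular E m, ?_⟩
    rw [fromRegular_comp, hm, ← fromRegular_comp, fromRegular_one, Category.id_comp]

/-- An exact sequence `X → Y → Z → 0` with `Y` and `Z` projective splits, and so it stays exact
under every additive functor. -/
lemma exact_map_of_projective (F : FDMod k S ⥤ FDMod k T) [F.Additive] {X Y Z : FDMod k S}
    (f : X ⟶ Y) (g : Y ⟶ Z) [Projective Y] [Projective Z]
    (he : Function.Exact (lin f) (lin g)) (hg : Function.Surjective (lin g)) :
    Function.Exact (lin (F.map f)) (lin (F.map g)) ∧ Function.Surjective (lin (F.map g)) := by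
  have := epi_of_surjective g hg
  let h : Z ⟶ Y := Projective.factorThru (𝟙 Z) g
  have hh : h ≫ g = 𝟙 Z := Projective.factorThru_comp _ _
  -- `1 - g h` takes values in the kernel of `g`, which is the image of `f`, so it lifts along `f`.
  let p : X ⟶ range f := mk' (lin f).rangeRestrict fun s x => Subtype.ext (lin_ρ f s x)
  have : Epi p := epi_of_surjective p (lin f).surjective_rangeRestrict
  have hc : (𝟙 Y - g ≫ h) ≫ g = 0 := by
    rw [Preadditive.sub_comp, Category.assoc, hh, Category.id_comp, Category.comp_id, sub_self]
  let c : Y ⟶ range f := mk' (LinearMap.codRestrict _ (lin (𝟙 Y - g ≫ h)) fun y =>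
    (he _).1 (congrArg (fun t => lin t y) hc)) fun s y => Subtype.ext (lin_ρ (𝟙 Y - g ≫ h) s y)
  let u : Y ⟶ X := Projective.factorThru c p
  have hu : u ≫ f = 𝟙 Y - g ≫ h := hom_ext (LinearMap.ext fun y =>
    congrArg (fun t => ((lin t y : LinearMap.range (lin f)) : Y.carrier))
      (Projective.factorThru_comp c p))
  have hfg : f ≫ g = 0 := hom_ext (LinearMap.ext fun x => he.apply_apply_eq_zero x)
  have h1 : F.map h ≫ F.map g = 𝟙 _ := by rw [← F.map_comp, hh, F.map_id]
  have h2 : F.map u ≫ F.map f + F.map g ≫ F.map h = 𝟙 _ := by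
    rw [← F.map_comp, ← F.map_comp, ← F.map_add, hu, sub_add_cancel, F.map_id]
  have h3 : F.map f ≫ F.map g = 0 := by rw [← F.map_comp, hfg, F.map_zero]
  refine ⟨fun y => ⟨fun hy => ⟨lin (F.map u) y, ?_⟩, ?_⟩,
    fun z => ⟨lin (F.map h) z, congrArg (fun t => lin t z) h1⟩⟩
  · have h4 : lin (F.map f) (lin (F.map u) y) + lin (F.map h) (lin (F.map g) y) = y :=
      congrArg (fun t => lin t y) h2
    rw [hy, map_zero, add_zero] at h4
    exact h4
  · rintro ⟨x, rfl⟩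
    exact congrArg (fun t => lin t x) h3

end FDMod

variable {k : Type u} [Field k] {A B : Type u} [Ring A] [Bialgebra k A] [Ring B] [Bialgebra k B]
  [FiniteDimensional k B] {K S : ComodAlg k (Cop A ⊗[k] B)}

/-- Tensoring with the projective module `B` turns an exact sequence into one of projective
modules; its image under `F` is exact, and `B ⊗ -` reflects exactness. -/
lemma rightExact_of_isExactModuleCategory (hS : IsExactModuleCategory S)
    (F : FDMod k S.carrier ⥤ FDMod k K.carrier) [F.OplaxLeftLinear (FDMod k B)]
    (hF : IsModuleFunctor S K F) : RightExact F := by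
  intro X Y Z f g he hg
  have := hF.additive
  have : ∀ M, Projective (regular k B ⊙ₗ M) := fun M => hS _ M projective_regular
  -- The counit shows that `B` is nonzero, hence faithfully flat over `k`.
  have : Nontrivial B := ⟨⟨1, 0, fun e => by
    have e' := congrArg (Coalgebra.counit (R := k)) e
    rw [Bialgebra.counit_one, map_zero] at e'
    exact one_ne_zero e'⟩⟩
  obtain ⟨h1, h2⟩ := exact_map_of_projective F (regular k B ⊴ₗ f) (regular k B ⊴ₗ g)
    (lTensor_exact B he hg) (LinearMap.lTensor_surjective B hg)
  have hi : ∀ M, Function.Bijective (lin (δₗ F (regular k B) M)) := fun M => by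
    have := hF.isIso (regular k B) M
    refine Function.bijective_iff_has_inverse.2 ⟨lin (inv (δₗ F (regular k B) M)), fun x => ?_,
      fun x => ?_⟩
    · exact congrArg (fun t => lin t x) (IsIso.hom_inv_id (δₗ F (regular k B) M))
    · exact congrArg (fun t => lin t x) (IsIso.inv_hom_id (δₗ F (regular k B) M))
  have hn : ∀ {M N : FDMod k S.carrier} (a : M ⟶ N) x,
      lin (δₗ F (regular k B) N) (lin (F.map (regular k B ⊴ₗ a)) x) =
        LinearMap.lTensor B (lin (F.map a)) (lin (δₗ F (regular k B) M) x) := fun a x =>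
    congrArg (fun t => lin t x) (δₗ_naturality_right F (regular k B) a)
  refine ⟨(Module.FaithfullyFlat.lTensor_exact_iff_exact k B _ _).1 fun y => ?_,
    (Module.FaithfullyFlat.lTensor_surjective_iff_surjective k B _).1 fun z => ?_⟩
  · obtain ⟨y, rfl⟩ := (hi Y).2 y
    refine ⟨fun hy => ?_, ?_⟩
    · obtain ⟨x, rfl⟩ := (h1 y).1 ((hi Z).1 (((hn g y).trans hy).trans (map_zero _).symm))
      exact ⟨_, (hn f x).symm⟩
    · rintro ⟨x, hx⟩
      obtain ⟨x, rfl⟩ := (hi X).2 x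
      have e := (hi Y).1 ((hn f x).trans hx)
      refine (hn g y).symm.trans ?_
      rw [← e, h1.apply_apply_eq_zero, map_zero]
  · obtain ⟨z, rfl⟩ := (hi Z).2 z
    obtain ⟨y, rfl⟩ := h2 z
    exact ⟨_, (hn g y).symm⟩

end HopfBimod

end Exactness

theorem mainTheorem1 {k : Type u} [Field k] [IsAlgClosed k] [CharZero k] {A B : Type u}
    [Ring A] [HopfAlgebra k A] [FiniteDimensional k A]
    [Ring B] [HopfAlgebra k B] [FiniteDimensional k B]
    (K S : ComodAlg k (Cop A ⊗[k] B)) (hK : K.IsRightSimple) (hS : S.IsRightSimple) :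
    (∃ h : ∀ P : RelBimod K S,
        IsModuleFunctor S K (tensorFunctor P) ∧ RightExact (tensorFunctor P),
      ∃ E : BimoduleEquivalence k (FDMod k A) (FDMod k A) (RelBimod K S) (ModFun S K),
        E.functor.F = Phi h) ∧
    (IsExactModuleCategory S →
      ∀ (F : FDMod k S.carrier ⥤ FDMod k K.carrier) [F.OplaxLeftLinear (FDMod k B)],
        IsModuleFunctor S K F → RightExact F) := by
  let h : ∀ P : RelBimod K S,
      IsModuleFunctor S K (tensorFunctor P) ∧ RightExact (tensorFunctor P) :=
    fun P => ⟨isModuleFunctor_tensorFunctor P, rightExact_tensorFunctor P⟩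
  have : (phiBimoduleFunctor h).F.IsEquivalence :=
    { faithful := faithful_Phi h, full := full_Phi h, essSurj := essSurj_Phi h }
  exact ⟨⟨h, BimoduleEquivalence.ofIsEquivalence (phiBimoduleFunctor h), rfl⟩,
    fun hex F _ hF => rightExact_of_isExactModuleCategory hex F hF⟩
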